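/- Let $\mathcal M$ be an o-minimal expansion of an ordered group, let "definable" mean definable in $\mathcal M$ with parameters, and let $G$ be a definable abelian group, equipped with its group topology, i.e. the (unique) topology making $G$ a topological group and a definable manifold (with a finite atlas of definable charts onto open subsets of some $M^k$). All topological notions in $G$ refer to this topology. For $A,B\subseteq G$ write $A=_0B$ if $A\cap U=B\cap U$ for some open $U\ni 0$. A definable set $X\subseteq G$ is *$G$-linear* if $X-g=_0X-h$ for all $g,h\in X$; two $G$-linear sets $X,Y$ are *$G$-equivalent* if $X-g=_0Y-h$ for all $g\in X$, $h\in Y$. For definable $X\subseteq G$ let $X_{lin}$ be the set of those $g\in X$ that have an open neighbourhood $U$ with $X-g=_0X-h$ for all $h\in U\cap X$, and let $X_{lin}^{max}$ be the union of all definably connected components of $X_{lin}$ of maximal dimension. A definable set $A\subseteq X$ is *large in* $X$ if $\dim(X\setminus A)<\dim X$; here $\dim$ is the o-minimal dimension, with $\dim\emptyset=-\infty$. Let $d\ge 0$ be an integer and let $X,Y\subseteq G$ be definable sets with $\dim X=\dim Y=d$. If $\dim(X+Y)=d$, then $X_{lin}$ is (definable and) large in $X$, $Y_{lin}$ is (definable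 and) large in $Y$, and $X_{lin}^{max}$ and $Y_{lin}^{max}$ are $G$-linear sets that are $G$-equivalent to each other. -/

import Mathlib

open Set
open scoped Pointwise

universe u v w

/-! ### O-minimal expansions of ordered groups -/

/-- A singleton or an open interval with endpoints in `M ∪ {-∞, +∞}`. -/
def IsPointOrInterval {M : Type w} [LinearOrder M] (I : Set M) : Prop :=
  (∃ a, I = {a}) ∨ (∃ a b, I = Ioo a b) ∨ (∃ a, I = Iio a) ∨ (∃ a, I = Ioi a) ∨ I = univ

/-- `M` is an o-minimal structure: its order is dense without endpoints and definable, and every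
subset of `M` definable with parameters is a finite union of points and open intervals. -/
structure IsOMinimal (L : FirstOrder.Language.{u, v}) (M : Type w) [L.Structure M] [LinearOrder M] :
    Prop where
  denselyOrdered : DenselyOrdered M
  noMinOrder : NoMinOrder M
  noMaxOrder : NoMaxOrder M
  definable_lt : (∅ : Set M).Definable₂ L {p : M × M | p.1 < p.2}
  finite_union : ∀ S : Set M, (univ : Set M).Definable₁ L S →
    ∃ F : Set (Set M), F.Finite ∧ (∀ I ∈ F, IsPointOrInterval I) ∧ S = ⋃₀ F

/-- `M` is an o-minimal expansion of an ordered group (commutativity is not required). -/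
structure IsOMinimalExpansionOfOrderedGroup (L : FirstOrder.Language.{u, v}) (M : Type w) [L.Structure M]
    [LinearOrder M] [AddGroup M] : Prop extends IsOMinimal L M where
  addLeftMono : AddLeftMono M
  addRightMono : AddRightMono M
  definable_add : (∅ : Set M).Definable L {v : Fin 3 → M | v 0 + v 1 = v 2}

/-! ### Dimension -/

open Classical in
/-- The o-minimal dimension of a subset of `M ^ n`: the largest number `k` of coordinates such that
the projection of `X` to some `k` coordinates has non-empty interior in `M ^ k`. The empty set has
dimension `⊥`, that is, `-∞`. -/
noncomputable def omDim {M : Type w} [TopologicalSpace M] {n : ℕ} (X : Set (Fin n → M)) :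
    WithBot ℕ :=
  Finset.univ.sup fun s : Finset (Fin n) =>
    if (interior ((fun (x : Fin n → M) (i : s) => x i) '' X)).Nonempty then
      (s.card : WithBot ℕ) else ⊥

/-! ### Definable abelian groups and their group topology -/

/-- An abelian group whose underlying set is a definable subset of some `M ^ n` and whose addition
has a definable graph. Definable means definable with parameters. -/
structure DefinableAbelianGroup (L : FirstOrder.Language.{u, v}) (M : Type w) [L.Structure M] where
  n : ℕ
  carrier : Set (Fin n → M)
  [addCommGroup : AddCommGroup carrier]
  definable_carrier : (univ : Set M).Definable L carrier
  definable_add : (univ : Set M).Definable L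
    {v : Fin n ⊕ Fin n ⊕ Fin n → M | ∃ x y : carrier,
      v = Sum.elim (x : Fin n → M) (Sum.elim (y : Fin n → M) ((x + y : carrier) : Fin n → M))}

namespace DefinableAbelianGroup

variable {L : FirstOrder.Language.{u, v}} {M : Type w} [L.Structure M]

/-- The type of elements of `G`. It is a separate type so that it does not inherit the subspace
topology of `M ^ n`, which in general is not the group topology. -/
def Point (G : DefinableAbelianGroup L M) : Type w := G.carrier

instance (G : DefinableAbelianGroup L M) : AddCommGroup G.Point := G.addCommGroup

/-- The inclusion of `G` in `M ^ n`. -/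
def coord (G : DefinableAbelianGroup L M) (x : G.Point) : Fin G.n → M := Subtype.val x

variable {G : DefinableAbelianGroup L M}

/-- Definable (with parameters) subsets of `G`. -/
def IsDef (X : Set G.Point) : Prop := (univ : Set M).Definable L (G.coord '' X)

/-- The dimension of a subset of `G`, as a subset of `M ^ n`. -/
noncomputable def dim [TopologicalSpace M] (X : Set G.Point) : WithBot ℕ := omDim (G.coord '' X)

/-- The given topology on `G` is the group topology of `G`: it makes `G` a topological group and
a definable manifold, that is, there is a finite atlas of definable homeomorphisms from open subsets
of `G` onto open subsets of some `M ^ k`. (There is exactly one such topology.) -/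
structure IsGroupTopology (G : DefinableAbelianGroup L M) [TopologicalSpace M]
    [TopologicalSpace G.Point] : Prop where
  isTopologicalAddGroup : IsTopologicalAddGroup G.Point
  exists_atlas : ∃ (k m : ℕ) (φ : Fin m → OpenPartialHomeomorph G.Point (Fin k → M)),
    (⋃ i, (φ i).source) = univ ∧
    ∀ i, (univ : Set M).Definable L
      {v : Fin G.n ⊕ Fin k → M | ∃ x ∈ (φ i).source, v = Sum.elim (G.coord x) (φ i x)}

/-- `A` is a large (definable) subset of `X`: `dim (X \ A) < dim X`. -/
def IsLargeIn [TopologicalSpace M] (A X : Set G.Point) : Prop :=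
  IsDef A ∧ A ⊆ X ∧ dim (X \ A) < dim X

/-- The translate `X - g`. -/
def translate (X : Set G.Point) (g : G.Point) : Set G.Point := (fun x => x - g) '' X

section GroupTopology

variable [TopologicalSpace G.Point]

/-- `X =_a Y`: the sets `X` and `Y` have the same germ at `a`. -/
def SameGermAt (a : G.Point) (X Y : Set G.Point) : Prop :=
  ∃ U : Set G.Point, IsOpen U ∧ a ∈ U ∧ X ∩ U = Y ∩ U

/-- `X` is `G`-linear: it is definable and `X - g =_0 X - h` for all `g, h ∈ X`. -/
def IsGLinear (X : Set G.Point) : Prop :=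
  IsDef X ∧ ∀ g ∈ X, ∀ h ∈ X, SameGermAt 0 (translate X g) (translate X h)

/-- `X` is locally `G`-linear at `g`. -/
def IsLocallyGLinearAt (X : Set G.Point) (g : G.Point) : Prop :=
  ∃ U : Set G.Point, IsOpen U ∧ g ∈ U ∧
    ∀ h ∈ U ∩ X, SameGermAt 0 (translate X g) (translate X h)

/-- `X` and `Y` are `G`-equivalent: `X - g =_0 Y - h` for all `g ∈ X` and `h ∈ Y`. -/
def GEquivalent (X Y : Set G.Point) : Prop :=
  ∀ g ∈ X, ∀ h ∈ Y, SameGermAt 0 (translate X g) (translate Y h)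

/-- `X_lin`, the set of points of `X` at which `X` is locally `G`-linear. -/
def lin (X : Set G.Point) : Set G.Point := {g ∈ X | IsLocallyGLinearAt X g}

/-- `C` is definably connected: it is definable and not the union of two disjoint non-empty
definable relatively open subsets. -/
def IsDefinablyConnected (C : Set G.Point) : Prop :=
  IsDef C ∧ ∀ A B : Set G.Point, IsDef A → IsDef B →
    (∃ U, IsOpen U ∧ A = C ∩ U) → (∃ V, IsOpen V ∧ B = C ∩ V) →
    A ∪ B = C → Disjoint A B → A = ∅ ∨ B = ∅

/-- `C` is a definably connected component of `A`: a maximal non-empty definably connected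
subset of `A`. -/
def IsDefComponent (C A : Set G.Point) : Prop :=
  C.Nonempty ∧ C ⊆ A ∧ IsDefinablyConnected C ∧
    ∀ D : Set G.Point, C ⊆ D → D ⊆ A → IsDefinablyConnected D → D = C

/-- `X_lin^max`, the union of the definably connected components of `X_lin` of maximal dimension. -/
def linMax [TopologicalSpace M] (X : Set G.Point) : Set G.Point :=
  ⋃₀ {C | IsDefComponent C (lin X) ∧ ∀ C', IsDefComponent C' (lin X) → dim C' ≤ dim C}

end GroupTopology

end DefinableAbelianGroup

/-! Call a pair (x, y) in X × Y bad if the germs at 0 of X - x and y - Y differ. If (x, y) is bad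
and z = x + y, then x lies in X ∩ (z - Y) and the germs of X and z - Y at x differ, so x lies in the
frontier (closure minus set) of X \ (z - Y) or of (z - Y) \ X. Frontiers have smaller dimension, so
for each z these x form a set of dimension < d. Since z ranges over X + Y, of dimension d, the bad
pairs have dimension < 2d (`not_hasDimGE_badPairs`).

If (x, y) is good and (x', y) is good for all x' in X near x, then X - x and X - x' both have the
germ of y - Y, so x is in X_lin. For fixed y, the other good x lie in the frontier of the set of bad
x. Hence (X \ X_lin) × Y has dimension < 2d, and X_lin is large in X (`not_hasDimGE_diff_lin`).

The germ of X is constant along each definable component of X_lin. For components C of X_lin and D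
of Y_lin of dimension d, the product C × D is too big to consist of bad pairs, so X - x and -(Y - y)
have the same germ for some x in C, y in D. The sign disappears because the germ of Y along D is
symmetric (`exists_eventually_neg`): on a subset of D of dimension d the equality of germs holds on
one common box, and near a suitable point a of it every u + a in Y is again in that subset, so that
a = -u + (u + a) in Y yields -u + a in Y. This gives `germEq_of_mem_linMax`.

The o-minimal tools are additivity of dimension (`HasDimGE.swap_iff`), the frontier inequality
(`DimGE.of_frontier`) and finiteness of the number of definable clopen subsets
(`finite_defClopens`). They are derived directly from the one-variable axiom, without cell
decomposition. Dimension is built from the quantifiers "there is" and "there are infinitely many",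
and its theory rests on the fact that the latter commutes with itself (`infinite_infinite_swap`). -/

set_option linter.unusedSectionVars false

/-! ### Definable sets and maps between definable spaces -/

/-- A type identified with a definable subset of some `M ^ n`. -/
class DefSpace (L : FirstOrder.Language.{u, v}) (M : Type w) [L.Structure M] (T : Type*) where
  n : ℕ
  e : T → Fin n → M
  inj : Function.Injective e
  definable_range : (univ : Set M).Definable L (range e)

section Definability

variable (L : FirstOrder.Language.{u, v}) (M : Type w) [L.Structure M]
variable {T T' T'' : Type*}

/-- Definable subsets of a definable space. -/
def DSet [DefSpace L M T] (S : Set T) : Prop :=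
  (univ : Set M).Definable L (DefSpace.e (L := L) (M := M) '' S)

noncomputable instance DefSpace.self : DefSpace L M M where
  n := 1
  e x _ := x
  inj x y h := congrFun h 0
  definable_range := by
    convert (univ : Set M).definable_univ (L := L) (α := Fin 1)
    ext v
    simp only [mem_range, mem_univ, iff_true]
    exact ⟨v 0, by ext i; rw [Fin.fin_one_eq_zero i]⟩

noncomputable instance DefSpace.pi (m : ℕ) : DefSpace L M (Fin m → M) where
  n := m
  e x := x
  inj _ _ h := h
  definable_range := by
    convert (univ : Set M).definable_univ (L := L) (α := Fin m)
    ext v; simp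

theorem Fin.append_injective2 {m n : ℕ} {α : Type*} {a a' : Fin m → α} {b b' : Fin n → α} :
    Fin.append a b = Fin.append a' b' ↔ a = a' ∧ b = b' := by
  constructor
  · intro h
    exact ⟨funext fun i => by simpa using congrFun h (Fin.castAdd n i),
      funext fun i => by simpa using congrFun h (Fin.natAdd m i)⟩
  · rintro ⟨rfl, rfl⟩; rfl

noncomputable instance DefSpace.prod [DefSpace L M T] [DefSpace L M T'] :
    DefSpace L M (T × T') where
  n := DefSpace.n L M T + DefSpace.n L M T'
  e p := Fin.append (DefSpace.e (L := L) p.1) (DefSpace.e (L := L) p.2)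
  inj p q h := by
    rw [Fin.append_injective2] at h
    exact Prod.ext (DefSpace.inj h.1) (DefSpace.inj h.2)
  definable_range := by
    convert ((DefSpace.definable_range (L := L) (M := M) (T := T)).preimage_comp
      (Fin.castAdd (DefSpace.n L M T'))).inter
      ((DefSpace.definable_range (L := L) (M := M) (T := T')).preimage_comp
      (Fin.natAdd (DefSpace.n L M T)))
    ext v
    simp only [mem_range, mem_inter_iff, mem_preimage, Prod.exists]
    constructor
    · rintro ⟨a, b, rfl⟩
      exact ⟨⟨a, by ext; simp⟩, ⟨b, by ext; simp⟩⟩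
    · rintro ⟨⟨a, ha⟩, ⟨b, hb⟩⟩
      refine ⟨a, b, ?_⟩
      rw [ha, hb]
      exact Fin.append_castAdd_natAdd

-- Truth values are coded by two distinct elements of M. Predicates thereby become definable maps
-- into `Prop`, and closure under connectives and quantifiers can be proved compositionally by
-- `fun_prop`.
open Classical in
noncomputable instance DefSpace.prop [Nontrivial M] : DefSpace L M Prop where
  n := 1
  e p _ := if p then (exists_pair_ne M).choose else (exists_pair_ne M).choose_spec.choose
  inj p q h := by
    have h0 := congrFun h 0
    have hne := (exists_pair_ne M).choose_spec.choose_spec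
    by_cases hp : p <;> by_cases hq : q <;> simp_all
  definable_range := by
    have key : ∀ c : M, (univ : Set M).Definable L ({fun _ => c} : Set (Fin 1 → M)) := by
      intro c
      have := Set.Definable.singleton_of_mem (L := L) (mem_univ c)
      unfold Set.Definable₁ at this
      convert this using 1
      ext v
      simp [funext_iff]
    convert (key (exists_pair_ne M).choose).union (key (exists_pair_ne M).choose_spec.choose)
    ext v
    simp only [mem_range, mem_union, mem_singleton_iff]
    constructor
    · rintro ⟨p, rfl⟩
      by_cases hp : p <;> simp [hp]
    · rintro (rfl | rfl)
      · exact ⟨True, by simp⟩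
      · exact ⟨False, by simp⟩


variable {M} [DefSpace L M T] [DefSpace L M T'] [DefSpace L M T'']

variable {L}

theorem DSet.inter {S S' : Set T} (h : DSet L M S) (h' : DSet L M S') : DSet L M (S ∩ S') := by
  unfold DSet; rw [image_inter DefSpace.inj]; exact Set.Definable.inter h h'

theorem DSet.union {S S' : Set T} (h : DSet L M S) (h' : DSet L M S') : DSet L M (S ∪ S') := by
  unfold DSet; rw [image_union]; exact Set.Definable.union h h'

theorem DSet.compl {S : Set T} (h : DSet L M S) : DSet L M Sᶜ := by
  unfold DSet
  rw [compl_eq_univ_sdiff, image_sdiff DefSpace.inj, image_univ]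
  exact DefSpace.definable_range.sdiff h

theorem dSet_univ : DSet L M (univ : Set T) := by
  unfold DSet; rw [image_univ]; exact DefSpace.definable_range

variable (L M) in
/-- Maps whose coordinates are among the coordinates of the argument. -/
def CoordMap (c : T → T') : Prop :=
  ∃ σ : Fin (DefSpace.n L M T') → Fin (DefSpace.n L M T),
    ∀ t, DefSpace.e (L := L) (M := M) (c t) = DefSpace.e (L := L) (M := M) t ∘ σ

theorem CoordMap.fst : CoordMap L M (Prod.fst : T × T' → T) :=
  ⟨Fin.castAdd _, fun t => by ext i; exact (Fin.append_left _ _ i).symm⟩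

theorem CoordMap.snd : CoordMap L M (Prod.snd : T × T' → T') :=
  ⟨Fin.natAdd _, fun t => by ext i; exact (Fin.append_right _ _ i).symm⟩

theorem CoordMap.prodMk {f : T → T'} {g : T → T''} (hf : CoordMap L M f) (hg : CoordMap L M g) :
    CoordMap L M fun t => (f t, g t) := by
  obtain ⟨σ, hσ⟩ := hf
  obtain ⟨τ, hτ⟩ := hg
  refine ⟨Fin.append σ τ, fun t => ?_⟩
  change Fin.append (DefSpace.e (L := L) (M := M) (f t)) (DefSpace.e (L := L) (M := M) (g t)) = _
  rw [hσ, hτ]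
  ext i
  refine Fin.addCases (fun i => ?_) (fun i => ?_) i <;> simp

theorem CoordMap.id : CoordMap L M (fun t : T => t) := ⟨fun i => i, fun _ => rfl⟩

theorem CoordMap.comp {g : T' → T''} {f : T → T'} (hg : CoordMap L M g) (hf : CoordMap L M f) :
    CoordMap L M fun t => g (f t) := by
  obtain ⟨σ, hσ⟩ := hf
  obtain ⟨τ, hτ⟩ := hg
  exact ⟨σ ∘ τ, fun t => by rw [hτ, hσ]; rfl⟩

theorem DSet.preimage_coordMap {c : T → T'} (hc : CoordMap L M c) {S : Set T'} (h : DSet L M S) :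
    DSet L M {t | c t ∈ S} := by
  obtain ⟨σ, hσ⟩ := hc
  unfold DSet
  convert (DefSpace.definable_range (L := L) (M := M) (T := T)).inter
    (Set.Definable.preimage_comp σ h)
  ext v
  simp only [mem_image, mem_ofPred_eq, mem_inter_iff, mem_range, mem_preimage]
  constructor
  · rintro ⟨t, ht, rfl⟩
    exact ⟨⟨t, rfl⟩, c t, ht, hσ t⟩
  · rintro ⟨⟨t, rfl⟩, x, hx, hxt⟩
    rw [← hσ] at hxt
    exact ⟨t, DefSpace.inj hxt ▸ hx, rfl⟩

theorem DSet.exists {S : Set (T × T')} (h : DSet L M S) : DSet L M {t | ∃ x, (t, x) ∈ S} := by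
  unfold DSet
  convert Set.Definable.image_comp h (Fin.castAdd (DefSpace.n L M T'))
  ext v
  simp only [mem_image, mem_ofPred_eq, Prod.exists]
  constructor
  · rintro ⟨t, ⟨x, hx⟩, rfl⟩
    exact ⟨_, ⟨t, x, hx, rfl⟩, by ext i; exact Fin.append_left _ _ i⟩
  · rintro ⟨_, ⟨t, x, hx, rfl⟩, rfl⟩
    exact ⟨t, ⟨x, hx⟩, by ext i; exact (Fin.append_left _ _ i).symm⟩

theorem dSet_diag : DSet L M {p : T × T | p.1 = p.2} := by
  unfold DSet
  have h := Set.Definable.image_comp (DefSpace.definable_range (L := L) (M := M) (T := T))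
    (Fin.append (fun i => i) (fun i => i))
  refine (congrArg _ ?_).mp h
  symm
  ext v
  simp only [mem_image, mem_ofPred_eq, Prod.exists, mem_range, exists_exists_eq_and]
  have key : ∀ t : T, DefSpace.e (L := L) (M := M) (t, t) =
      DefSpace.e (L := L) (M := M) t ∘ Fin.append (fun i => i) (fun i => i) := by
    intro t
    ext i
    change Fin.append _ _ i = _
    refine Fin.addCases (fun i => ?_) (fun i => ?_) i
    · simp
    · exact (Fin.append_right _ _ i).trans
        (congrArg (DefSpace.e t) (Fin.append_right (fun i => i) (fun i => i) i).symm)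
  constructor
  · rintro ⟨t, _, rfl, rfl⟩
    exact ⟨t, (key t).symm⟩
  · rintro ⟨t, rfl⟩
    exact ⟨t, t, rfl, key t⟩

variable (L M) in
/-- Maps with definable graph. -/
@[fun_prop]
def DMap (f : T → T') : Prop :=
  DSet L M {p : T × T' | f p.1 = p.2}

theorem DSet.preimage {f : T → T'} (hf : DMap L M f) {S : Set T'} (h : DSet L M S) :
    DSet L M {t | f t ∈ S} := by
  convert (DSet.inter hf (h.preimage_coordMap (CoordMap.snd (T := T)))).exists using 1
  ext t
  simp

theorem CoordMap.dMap {c : T → T'} (hc : CoordMap L M c) : DMap L M c :=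
  DSet.preimage_coordMap (c := fun p : T × T' => (c p.1, p.2))
    ((hc.comp CoordMap.fst).prodMk CoordMap.snd) dSet_diag

@[fun_prop]
theorem DMap.id' : DMap L M (fun t : T => t) := CoordMap.id.dMap

@[fun_prop]
theorem DMap.comp' {g : T' → T''} {f : T → T'} (hg : DMap L M g) (hf : DMap L M f) :
    DMap L M fun t => g (f t) := by
  unfold DMap
  convert ((DSet.preimage_coordMap (c := fun p : (T × T'') × T' => (p.1.1, p.2)) ?_ hf).inter
    (DSet.preimage_coordMap (c := fun p : (T × T'') × T' => (p.2, p.1.2)) ?_ hg)).exists using 1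
  · ext p; simp
  · exact (CoordMap.fst.comp CoordMap.fst).prodMk CoordMap.snd
  · exact CoordMap.snd.prodMk (CoordMap.snd.comp CoordMap.fst)

@[fun_prop]
theorem DMap.prodMk {f : T → T'} {g : T → T''} (hf : DMap L M f) (hg : DMap L M g) :
    DMap L M fun t => (f t, g t) := by
  unfold DMap
  convert (DSet.preimage_coordMap (c := fun p : T × T' × T'' => (p.1, p.2.1)) ?_ hf).inter
    (DSet.preimage_coordMap (c := fun p : T × T' × T'' => (p.1, p.2.2)) ?_ hg) using 1
  · ext p; simp [Prod.ext_iff]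
  · exact CoordMap.fst.prodMk (CoordMap.fst.comp CoordMap.snd)
  · exact CoordMap.fst.prodMk (CoordMap.snd.comp CoordMap.snd)

@[fun_prop]
theorem DMap.fst {f : T → T' × T''} (hf : DMap L M f) : DMap L M fun t => (f t).1 :=
  DMap.comp' (CoordMap.fst.dMap) hf

@[fun_prop]
theorem DMap.snd {f : T → T' × T''} (hf : DMap L M f) : DMap L M fun t => (f t).2 :=
  DMap.comp' (CoordMap.snd.dMap) hf

theorem dSet_singleton (c : T) : DSet L M {c} := by
  unfold DSet
  rw [image_singleton]
  have key : ∀ (i : Fin (DefSpace.n L M T)) (a : M),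
      (univ : Set M).Definable L {v : Fin (DefSpace.n L M T) → M | v i = a} := by
    intro i a
    have := Set.Definable.singleton_of_mem (L := L) (mem_univ a)
    exact Set.Definable.preimage_comp (fun _ : Fin 1 => i) this
  convert definable_iInter_of_finite fun i => key i (DefSpace.e c i)
  ext v; simp [funext_iff]

@[fun_prop]
theorem DMap.const' (c : T') : DMap L M fun _ : T => c := by
  unfold DMap
  convert (dSet_singleton (L := L) (M := M) c).preimage (CoordMap.snd (T := T)).dMap using 1
  ext p
  simp [eq_comm]

section Predicates

variable [Nontrivial M]

theorem dMap_mem_iff {S : Set T} : DMap L M (fun t => t ∈ S) ↔ DSet L M S := by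
  constructor
  · intro h
    convert DSet.preimage_coordMap (CoordMap.id (T := T) (L := L) (M := M))
      (h.inter ((dSet_singleton True).preimage CoordMap.snd.dMap)).exists using 1
    ext t
    simp only [mem_ofPred_eq, mem_inter_iff, mem_singleton_iff]
    exact ⟨fun h => ⟨True, by simpa using h, rfl⟩, by rintro ⟨_, h, rfl⟩; simpa using h⟩
  · intro h
    have h1 := (h.preimage (CoordMap.fst (T := T) (T' := Prop)).dMap).inter
      ((dSet_singleton True).preimage CoordMap.snd.dMap)
    have h2 := (h.compl.preimage (CoordMap.fst (T := T) (T' := Prop)).dMap).inter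
      ((dSet_singleton False).preimage CoordMap.snd.dMap)
    unfold DMap
    convert h1.union h2 using 1
    ext ⟨t, p⟩
    by_cases hp : p <;> simp [hp]

theorem dMap_prop_iff {p : T → Prop} : DMap L M p ↔ DSet L M {t | p t} :=
  dMap_mem_iff (S := {t | p t})

theorem DMap.dSet {p : T → Prop} (h : DMap L M p) : DSet L M {t | p t} := dMap_prop_iff.1 h

@[fun_prop]
theorem DMap.and {p q : T → Prop} (hp : DMap L M p) (hq : DMap L M q) :
    DMap L M fun t => p t ∧ q t := dMap_prop_iff.2 (hp.dSet.inter hq.dSet)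

@[fun_prop]
theorem DMap.or {p q : T → Prop} (hp : DMap L M p) (hq : DMap L M q) :
    DMap L M fun t => p t ∨ q t := dMap_prop_iff.2 (hp.dSet.union hq.dSet)

@[fun_prop]
theorem DMap.not {p : T → Prop} (hp : DMap L M p) : DMap L M fun t => ¬ p t :=
  dMap_prop_iff.2 hp.dSet.compl

@[fun_prop]
theorem DMap.imp {p q : T → Prop} (hp : DMap L M p) (hq : DMap L M q) :
    DMap L M fun t => p t → q t := by
  simp only [imp_iff_not_or]; fun_prop

@[fun_prop]
theorem DMap.iff {p q : T → Prop} (hp : DMap L M p) (hq : DMap L M q) :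
    DMap L M fun t => p t ↔ q t := by
  simp only [iff_iff_and_or_not_and_not]; fun_prop

@[fun_prop]
theorem DMap.exists {p : T → T' → Prop} (hp : DMap L M fun x : T × T' => p x.1 x.2) :
    DMap L M fun t => ∃ x, p t x := dMap_prop_iff.2 hp.dSet.exists

@[fun_prop]
theorem DMap.forall {p : T → T' → Prop} (hp : DMap L M fun x : T × T' => p x.1 x.2) :
    DMap L M fun t => ∀ x, p t x := by
  simp_rw [← not_exists_not (p := p _)]; fun_prop

@[fun_prop]
theorem DMap.eq {f g : T → T'} (hf : DMap L M f) (hg : DMap L M g) :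
    DMap L M fun t => f t = g t :=
  dMap_prop_iff.2 (dSet_diag.preimage (hf.prodMk hg))

@[fun_prop]
theorem DMap.mem {f : T → T'} (hf : DMap L M f) {S : Set T'} (hS : DSet L M S) :
    DMap L M fun t => f t ∈ S := DMap.comp' (dMap_mem_iff.2 hS) hf

end Predicates

end Definability

/-! ### Definability of coordinates, order and group operations -/

section Structure

variable {L : FirstOrder.Language.{u, v}} {M : Type w} [L.Structure M]
variable {T T' : Type*} [DefSpace L M T] [DefSpace L M T']

@[fun_prop]
theorem dMap_apply {m : ℕ} (i : Fin m) : DMap L M fun x : Fin m → M => x i :=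
  CoordMap.dMap ⟨fun _ => i, fun _ => rfl⟩

theorem DMap.apply {m : ℕ} {f : T → Fin m → M} (hf : DMap L M f) (i : Fin m) :
    DMap L M fun t => f t i :=
  DMap.comp' (dMap_apply i) hf

variable [Nontrivial M]

theorem DMap.forall_fin {m : ℕ} {p : T → Fin m → Prop} (hp : ∀ i, DMap L M fun t => p t i) :
    DMap L M fun t => ∀ i, p t i := by
  induction m with
  | zero => simp only [IsEmpty.forall_iff]; fun_prop
  | succ m ih =>
    simp only [Fin.forall_fin_succ]
    exact (hp 0).and (ih fun i => hp i.succ)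

theorem DMap.pi {m : ℕ} {f : T → Fin m → M} (hf : ∀ i, DMap L M fun t => f t i) :
    DMap L M f := by
  have h : DMap L M fun p : T × (Fin m → M) => ∀ i, f p.1 i = p.2 i :=
    DMap.forall_fin fun i => by have := hf i; fun_prop
  have h' := h.dSet
  simp only [← funext_iff] at h'
  exact h'

@[fun_prop]
theorem DMap.snoc {m : ℕ} {f : T → Fin m → M} {g : T → M} (hf : DMap L M f) (hg : DMap L M g) :
    DMap L M fun t => (Fin.snoc (f t) (g t) : Fin (m + 1) → M) := by
  refine DMap.pi fun i => ?_
  refine Fin.lastCases ?_ (fun i => ?_) i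
  · simpa only [Fin.snoc_last] using hg
  · simp only [Fin.snoc_castSucc]; fun_prop

@[fun_prop]
theorem DMap.insertNth {m : ℕ} (j : Fin (m + 1)) {f : T → Fin m → M} {g : T → M}
    (hf : DMap L M f) (hg : DMap L M g) :
    DMap L M fun t => (Fin.insertNth j (g t) (f t) : Fin (m + 1) → M) := by
  refine DMap.pi fun i => ?_
  refine Fin.succAboveCases j ?_ (fun i => ?_) i
  · simpa only [Fin.insertNth_apply_same] using hg
  · simp only [Fin.insertNth_apply_succAbove]; fun_prop

variable [LinearOrder M] [AddGroup M] [hM : Fact (IsOMinimalExpansionOfOrderedGroup L M)]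

@[fun_prop]
theorem DMap.lt {f g : T → M} (hf : DMap L M f) (hg : DMap L M g) :
    DMap L M fun t => f t < g t := by
  have h : DSet L M {p : M × M | p.1 < p.2} := by
    have := hM.out.definable_lt.mono (subset_univ _)
    unfold DSet
    refine (congrArg _ ?_).mp this
    symm
    ext v
    constructor
    · rintro ⟨p, hp, rfl⟩; exact hp
    · intro h
      refine ⟨(v 0, v 1), h, ?_⟩
      ext i
      refine Fin.addCases (fun i => ?_) (fun i => ?_) i
      · rw [Fin.fin_one_eq_zero i]; exact Fin.append_left _ _ _
      · rw [Fin.fin_one_eq_zero i]; exact Fin.append_right _ _ _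
  exact dMap_prop_iff.2 (h.preimage (hf.prodMk hg))

@[fun_prop]
theorem DMap.le {f g : T → M} (hf : DMap L M f) (hg : DMap L M g) :
    DMap L M fun t => f t ≤ g t := by
  simp only [← not_lt]; fun_prop

@[fun_prop]
theorem DMap.add {f g : T → M} (hf : DMap L M f) (hg : DMap L M g) :
    DMap L M fun t => f t + g t := by
  have h : DMap L M fun p : M × M => p.1 + p.2 := by
    have := hM.out.definable_add.mono (subset_univ _)
    unfold DMap DSet
    refine (congrArg _ ?_).mp this
    ext v
    constructor
    · intro h
      refine ⟨((v 0, v 1), v 2), h, ?_⟩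
      ext i
      fin_cases i <;> rfl
    · rintro ⟨p, hp, rfl⟩; exact hp
  exact DMap.comp' h (hf.prodMk hg)

@[fun_prop]
theorem DMap.neg {f : T → M} (hf : DMap L M f) : DMap L M fun t => - f t := by
  have h : DMap L M fun p : T × M => f p.1 + p.2 = 0 := by fun_prop
  have := h.dSet
  simp only [add_eq_zero_iff_neg_eq] at this
  exact this

end Structure

section

open Filter Topology

/-! ### O-minimality in one variable -/

section OMinimal

variable {L : FirstOrder.Language.{u, v}} {M : Type w} [L.Structure M]
variable [LinearOrder M] [AddGroup M] [hM : Fact (IsOMinimalExpansionOfOrderedGroup L M)]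
variable [Nontrivial M] [DenselyOrdered M] [NoMinOrder M] [NoMaxOrder M]
variable [AddLeftMono M] [AddRightMono M]

theorem DSet.finite_union {S : Set M} (hS : DSet L M S) :
    ∃ F : Set (Set M), F.Finite ∧ (∀ I ∈ F, IsPointOrInterval I) ∧ S = ⋃₀ F := by
  refine hM.out.finite_union S ?_
  unfold Set.Definable₁
  refine (congrArg _ ?_).mp hS
  ext v
  constructor
  · rintro ⟨x, hx, rfl⟩; exact hx
  · intro h; exact ⟨v 0, h, by ext i; rw [Fin.fin_one_eq_zero i]; rfl⟩

/-- One of the finitely many pieces of S must be infinite, hence not a point. The right-hand side is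
first-order, so "infinitely many" is a definable quantifier. -/
theorem DSet.infinite_iff {S : Set M} (hS : DSet L M S) :
    S.Infinite ↔ ∃ a b, a < b ∧ Ioo a b ⊆ S := by
  constructor
  · intro h
    obtain ⟨F, hF, hI, rfl⟩ := hS.finite_union
    obtain ⟨I, hIF, hinf⟩ : ∃ I ∈ F, I.Infinite := by
      by_contra! hc
      exact h (hF.sUnion hc)
    obtain ⟨a, b, hab, hs⟩ : ∃ a b, a < b ∧ Ioo a b ⊆ I := by
      rcases hI I hIF with ⟨a, rfl⟩ | ⟨a, b, rfl⟩ | ⟨a, rfl⟩ | ⟨a, rfl⟩ | rfl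
      · exact absurd (finite_singleton a) hinf
      · obtain ⟨x, hx⟩ := hinf.nonempty
        exact ⟨a, b, hx.1.trans hx.2, Subset.rfl⟩
      · obtain ⟨b, hb⟩ := exists_lt a
        exact ⟨b, a, hb, fun x hx => hx.2⟩
      · obtain ⟨b, hb⟩ := exists_gt a
        exact ⟨a, b, hb, fun x hx => hx.1⟩
      · obtain ⟨b, hb⟩ := exists_gt (0 : M)
        exact ⟨0, b, hb, subset_univ _⟩
    exact ⟨a, b, hab, hs.trans (subset_sUnion_of_mem hIF)⟩
  · rintro ⟨a, b, hab, h⟩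
    exact (Ioo_infinite hab).mono h

/-- Definable completeness: suprema are read off from the endpoints of the finitely many pieces. -/
theorem DSet.exists_isLUB {S : Set M} (hS : DSet L M S) (hne : S.Nonempty) (hb : BddAbove S) :
    ∃ c, IsLUB S c := by
  obtain ⟨F, hF, hI, rfl⟩ := hS.finite_union
  clear hS
  induction F, hF using Set.Finite.induction_on with
  | empty => simp at hne
  | @insert I F _ _ ih =>
    rw [sUnion_insert] at hb hne ⊢
    have hb1 : BddAbove I := hb.mono subset_union_left
    have hb2 : BddAbove (⋃₀ F) := hb.mono subset_union_right
    have h1 : I.Nonempty → ∃ c, IsLUB I c := by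
      intro hne
      rcases hI I (mem_insert _ _) with ⟨a, rfl⟩ | ⟨a, b, rfl⟩ | ⟨a, rfl⟩ | ⟨a, rfl⟩ | rfl
      · exact ⟨a, isLUB_singleton⟩
      · obtain ⟨x, hx⟩ := hne
        exact ⟨b, isLUB_Ioo (hx.1.trans hx.2)⟩
      · exact ⟨a, isLUB_Iio⟩
      · exact absurd hb1 (not_bddAbove_Ioi _)
      · exact absurd hb1 not_bddAbove_univ
    have h2 : (⋃₀ F).Nonempty → ∃ c, IsLUB (⋃₀ F) c := fun hne =>
      ih (fun J hJ => hI J (mem_insert_of_mem _ hJ)) hne hb2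
    rcases I.eq_empty_or_nonempty with hI0 | hI1
    · rw [hI0, empty_union] at hne ⊢; exact h2 hne
    · rcases (⋃₀ F).eq_empty_or_nonempty with hF0 | hF1
      · rw [hF0, union_empty]; exact h1 hI1
      · obtain ⟨c, hc⟩ := h1 hI1
        obtain ⟨e, he⟩ := h2 hF1
        exact ⟨_, hc.union he⟩

theorem DSet.exists_isGLB {S : Set M} (hS : DSet L M S) (hne : S.Nonempty) (hb : BddBelow S) :
    ∃ c, IsGLB S c := by
  have hS' : DSet L M {x | -x ∈ S} := DSet.preimage (by fun_prop) hS
  obtain ⟨x, hx⟩ := hne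
  obtain ⟨b, hb⟩ := hb
  obtain ⟨c, hc⟩ := hS'.exists_isLUB ⟨-x, by simpa using hx⟩
    ⟨-b, fun y hy => le_neg_of_le_neg (hb hy)⟩
  refine ⟨-c, fun y hy => neg_le.1 (hc.1 (by simpa using hy)), fun y hy => ?_⟩
  exact le_neg_of_le_neg (hc.2 fun z hz => le_neg_of_le_neg (hy hz))

/-- A definable lower set whose boundary can be crossed at every point is everything. -/
theorem DSet.eq_univ_of_isLowerSet {S : Set M} (hS : DSet L M S) (hne : S.Nonempty)
    (hl : IsLowerSet S) (h : ∀ c, ∃ a < c, ∃ b > c, a ∈ S → b ∈ S) : S = univ := by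
  by_contra hc
  obtain ⟨z, hz⟩ := (ne_univ_iff_exists_notMem S).1 hc
  obtain ⟨c, hc⟩ := hS.exists_isLUB hne
    ⟨z, fun x hx => le_of_not_gt fun hlt => hz (hl hlt.le hx)⟩
  obtain ⟨a, ha, b, hb, hab⟩ := h c
  obtain ⟨s, hs, has⟩ := (lt_isLUB_iff hc).1 ha
  exact hb.not_ge (hc.1 (hab (hl has.le hs)))

variable [TopologicalSpace M] [OrderTopology M]

/-- Induction along the order: the lower set to be shown full consists of the t for which S contains
all s with y ≤ s ≤ t and s ≤ z. At a point c of C the clopenness hypotheses allow it to be crossed,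
either because S continues past c or because S has already failed before c. -/
theorem DSet.mem_of_le_of_clopen {C S : Set M} (hS : DSet L M S)
    (hconv : C.OrdConnected) (h1 : ∀ y ∈ C, y ∈ S → ∀ᶠ z in 𝓝 y, z ∈ C → z ∈ S)
    (h2 : ∀ y ∈ C, y ∉ S → ∀ᶠ z in 𝓝 y, z ∈ C → z ∉ S) {y z : M} (hy : y ∈ C) (hyS : y ∈ S)
    (hz : z ∈ C) (hyz : y ≤ z) : z ∈ S := by
  have hzC : ∀ s, y ≤ s → s ≤ z → s ∈ C := fun s h1 h2 => hconv.out hy hz ⟨h1, h2⟩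
  have hdef : DSet L M {t | ∀ s, y ≤ s → s ≤ t → s ≤ z → s ∈ S} := by
    apply DMap.dSet
    fun_prop
  have := hdef.eq_univ_of_isLowerSet ⟨y, fun s h1 h2 _ => le_antisymm h1 h2 ▸ hyS⟩
    (fun a b hba ha s h1 h2 h3 => ha s h1 (h2.trans hba) h3) (fun c => ?_)
  · exact (this ▸ mem_univ z : z ∈ {t | ∀ s, y ≤ s → s ≤ t → s ≤ z → s ∈ S}) z hyz le_rfl le_rfl
  rcases lt_or_ge c y with hcy | hcy
  · obtain ⟨a, ha⟩ := exists_lt c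
    obtain ⟨b, hcb, hby⟩ := exists_between hcy
    exact ⟨a, ha, b, hcb, fun _ s h1 h2 => absurd (h1.trans h2) hby.not_ge⟩
  rcases lt_or_ge z c with hzc | hcz
  · obtain ⟨b, hb⟩ := exists_gt c
    exact ⟨z, hzc, b, hb, fun ha s h1 _ h3 => ha s h1 h3 h3⟩
  have hcC := hzC c hcy hcz
  by_cases hcS : c ∈ S
  · obtain ⟨a', b', hc', hs⟩ := mem_nhds_iff_exists_Ioo_subset.1 (h1 c hcC hcS)
    obtain ⟨a, ha1, ha2⟩ := exists_between hc'.1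
    obtain ⟨b, hb1, hb2⟩ := exists_between hc'.2
    refine ⟨a, ha2, b, hb1, fun ha s h1 h2 h3 => ?_⟩
    rcases le_or_gt s a with hsa | hsa
    · exact ha s h1 hsa h3
    · exact hs ⟨ha1.trans hsa, h2.trans_lt hb2⟩ (hzC s h1 h3)
  · obtain ⟨a', b', hc', hs⟩ := mem_nhds_iff_exists_Ioo_subset.1 (h2 c hcC hcS)
    have hyc : y < c := lt_of_le_of_ne hcy fun h => hcS (h ▸ hyS)
    obtain ⟨a, ha1, ha2⟩ := exists_between (max_lt hc'.1 hyc)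
    obtain ⟨b, hb⟩ := exists_gt c
    have hya := (le_max_right _ _).trans ha1.le
    have haz := ha2.le.trans hcz
    refine ⟨a, ha2, b, hb, fun ha => ?_⟩
    exact absurd (ha a hya le_rfl haz)
      (hs ⟨(le_max_left _ _).trans_lt ha1, ha2.trans hc'.2⟩ (hzC a hya haz))

/-- A definable convex set is definably connected. -/
theorem DSet.subset_of_clopen {C S : Set M} (hS : DSet L M S)
    (hconv : C.OrdConnected) (h1 : ∀ y ∈ C, y ∈ S → ∀ᶠ z in 𝓝 y, z ∈ C → z ∈ S)
    (h2 : ∀ y ∈ C, y ∉ S → ∀ᶠ z in 𝓝 y, z ∈ C → z ∉ S) {y : M} (hy : y ∈ C) (hyS : y ∈ S) :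
    C ⊆ S := by
  intro z hz
  rcases le_total y z with h | h
  · exact hS.mem_of_le_of_clopen hconv h1 h2 hy hyS hz h
  · by_contra hzS
    exact hS.compl.mem_of_le_of_clopen hconv h2 (by simpa using h1) hz hzS hy h hyS

/-! ### The quantifier "infinitely many" commutes with itself -/

section Exchange

variable {T : Type*} [DefSpace L M T]

@[fun_prop]
theorem DMap.isLUB {S : T → M → Prop} (hS : DMap L M fun p : T × M => S p.1 p.2) {f : T → M}
    (hf : DMap L M f) : DMap L M fun t => IsLUB {c | S t c} (f t) := by
  simp only [IsLUB, IsLeast, upperBounds, lowerBounds, mem_ofPred_eq]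
  fun_prop

@[fun_prop]
theorem DMap.isGLB {S : T → M → Prop} (hS : DMap L M fun p : T × M => S p.1 p.2) {f : T → M}
    (hf : DMap L M f) : DMap L M fun t => IsGLB {c | S t c} (f t) := by
  simp only [IsGLB, IsGreatest, upperBounds, lowerBounds, mem_ofPred_eq]
  fun_prop

@[fun_prop]
theorem DMap.infinite {A : T → M → Prop} (hA : DMap L M fun p : T × M => A p.1 p.2) :
    DMap L M fun t => {y | A t y}.Infinite := by
  have h : ∀ t, {y | A t y}.Infinite ↔ ∃ a b, a < b ∧ ∀ y, a < y → y < b → A t y := by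
    intro t
    have : DSet L M {y | A t y} := DMap.dSet (by fun_prop)
    rw [this.infinite_iff]
    simp only [subset_def, mem_Ioo, and_imp]
    rfl
  simp only [h]
  fun_prop

/-- If `R` relates infinitely many points to some positive element, uniformly downwards closed,
then a single positive element is related to infinitely many points. -/
theorem exists_uniform_of_infinite {X : Set M} (hX : DSet L M X) (hXi : X.Infinite)
    {R : M → M → Prop} (hR : DMap L M fun p : M × M => R p.1 p.2)
    (hdown : ∀ x c c', 0 < c' → c' ≤ c → R x c → R x c') (hex : ∀ x ∈ X, ∃ c > 0, R x c) :
    ∃ c > 0, {x ∈ X | R x c}.Infinite := by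
  by_contra! hfin
  obtain ⟨e, he⟩ := exists_gt (0 : M)
  set Y : Set M := {ε | ∃ x, x ∈ X ∧ IsLUB {c | 0 < c ∧ R x c} ε} with hY
  have hYd : DSet L M Y := DMap.dSet (by fun_prop)
  -- X' keeps the points with a bounded set of admissible c, for which a threshold (the supremum of
  -- that set) exists. Only finitely many points are lost, since the others are all related to e.
  set X' : Set M := {x ∈ X | ∃ c > 0, ¬ R x c} with hX'
  have hX'i : X'.Infinite := by
    intro hX'f
    refine hXi ((hX'f.union (hfin e he)).subset fun x hx => ?_)
    by_cases h : R x e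
    · exact Or.inr ⟨hx, h⟩
    · exact Or.inl ⟨hx, e, he, h⟩
  have hlub : ∀ x ∈ X', ∃ ε ∈ Y, IsLUB {c | 0 < c ∧ R x c} ε := by
    rintro x ⟨hx, b, hb, hbR⟩
    have hd : DSet L M {c | 0 < c ∧ R x c} := DMap.dSet (by fun_prop)
    obtain ⟨ε, hε⟩ := hd.exists_isLUB ((hex x hx).imp fun c hc => hc)
      ⟨b, fun c hc => le_of_not_gt fun h => hbR (hdown x c b hb h.le hc.2)⟩
    exact ⟨ε, ⟨x, hx, hε⟩, hε⟩
  have hpos : ∀ ε ∈ Y, 0 < ε := by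
    rintro ε ⟨x, hx, hε⟩
    obtain ⟨c, hc, hR⟩ := hex x hx
    exact hc.trans_le (hε.1 ⟨hc, hR⟩)
  have hRlt : ∀ x ∈ X, ∀ ε c, IsLUB {c | 0 < c ∧ R x c} ε → 0 < c → c < ε → R x c := by
    intro x _ ε c hε hc hcε
    obtain ⟨c', hc', h⟩ := (lt_isLUB_iff hε).1 hcε
    exact hdown x c' c hc h.le hc'.2
  -- If the thresholds fill an interval (p, q), each threshold in (m, q) comes from its own point
  -- related to m. If there are finitely many thresholds, any c below a threshold is related to the
  -- whole level set, so all level sets, and hence X', are finite.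
  by_cases hYi : Y.Infinite
  · obtain ⟨p, q, hpq, hsub⟩ := hYd.infinite_iff.1 hYi
    obtain ⟨m, hm⟩ := exists_between hpq
    have hm0 := hpos m (hsub hm)
    have : ∀ ε ∈ Ioo m q, ∃ x ∈ {x ∈ X | R x m}, IsLUB {c | 0 < c ∧ R x c} ε := by
      intro ε hε
      obtain ⟨x, hx, hxε⟩ := hsub ⟨hm.1.trans hε.1, hε.2⟩
      exact ⟨x, ⟨hx, hRlt x hx ε m hxε hm0 hε.1⟩, hxε⟩
    choose! f hf hf' using this
    refine (infinite_of_injOn_mapsTo (f := f) (s := Ioo m q) ?_ hf (Ioo_infinite hm.2))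
      (hfin m hm0)
    intro a ha b hb hab
    exact (hf' a ha).unique (hab ▸ hf' b hb)
  · rw [not_infinite] at hYi
    refine hX'i ((hYi.biUnion (t := fun ε => {x ∈ X | IsLUB {c | 0 < c ∧ R x c} ε}) ?_).subset ?_)
    · intro ε hε
      obtain ⟨c, hc⟩ := exists_between (hpos ε hε)
      refine (hfin c hc.1).subset ?_
      rintro x ⟨hx, hxε⟩
      exact ⟨hx, hRlt x hx ε c hxε hc.1 hc.2⟩
    · intro x hx
      obtain ⟨ε, hε, hxε⟩ := hlub x hx
      exact mem_biUnion hε ⟨hx.1, hxε⟩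

/-- Infinitely many fibres contain an interval of one common length c. Let f(x) be the infimum of
the left ends of such intervals; positivity bounds it below. If f takes infinitely many values, they
fill an interval, and a point y inside it lies in (f(x), f(x) + c) for infinitely many x. Otherwise
some level set of f is infinite, and any y in (f, f + c) serves all of it. -/
theorem exists_infinite_fiber_of_pos {A : M → M → Prop}
    (hA : DMap L M fun p : M × M => A p.1 p.2) (hpos : ∀ x y, A x y → 0 < y)
    (h : {x | {y | A x y}.Infinite}.Infinite) : ∃ y, {x | A x y}.Infinite := by
  have hXd : DSet L M {x | {y | A x y}.Infinite} := (DMap.infinite hA).dSet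
  have hR : DMap L M fun p : M × M => ∃ a, ∀ y, a < y → y < a + p.2 → A p.1 y := by
    fun_prop
  have hdown : ∀ x c c' : M, 0 < c' → c' ≤ c → (∃ a, ∀ y, a < y → y < a + c → A x y) →
      ∃ a, ∀ y, a < y → y < a + c' → A x y := by
    rintro x c c' _ hcc ⟨a, ha⟩
    exact ⟨a, fun y h1 h2 => ha y h1 (h2.trans_le (by gcongr))⟩
  have hex : ∀ x ∈ {x | {y | A x y}.Infinite}, ∃ c > 0, ∃ a, ∀ y, a < y → y < a + c → A x y := by
    intro x hx
    have hd : DSet L M {y | A x y} := DMap.dSet (by fun_prop)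
    obtain ⟨a, b, hab, hs⟩ := hd.infinite_iff.1 hx
    refine ⟨-a + b, by rwa [gt_iff_lt, lt_neg_add_iff_add_lt, add_zero], a,
      fun y h1 h2 => hs ⟨h1, ?_⟩⟩
    rwa [add_neg_cancel_left] at h2
  obtain ⟨c, hc, hci⟩ := exists_uniform_of_infinite hXd h
    (R := fun x c => ∃ a, ∀ y, a < y → y < a + c → A x y) hR hdown hex
  set X : Set M := {x | ∃ a, ∀ y, a < y → y < a + c → A x y} with hX
  have hXd : DSet L M X := by
    apply DMap.dSet
    fun_prop
  have hXi : X.Infinite := hci.mono fun x hx => hx.2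
  have hglb : ∀ x ∈ X, ∃ f, IsGLB {a | ∀ y, a < y → y < a + c → A x y} f := by
    intro x hx
    have hd : DSet L M {a | ∀ y, a < y → y < a + c → A x y} := by
      apply DMap.dSet
      fun_prop
    refine hd.exists_isGLB hx ⟨0, fun a ha => le_of_not_gt fun ha0 => ?_⟩
    obtain ⟨y, hy1, hy2⟩ := exists_between (lt_min ha0 (lt_add_of_pos_right a hc))
    exact (hpos x y (ha y hy1 (hy2.trans_le (min_le_right _ _)))).not_gt
      (hy2.trans_le (min_le_left _ _))
  have hsub : ∀ x f, IsGLB {a | ∀ y, a < y → y < a + c → A x y} f →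
      ∀ y, f < y → y < f + c → A x y := by
    intro x f hf y h1 h2
    obtain ⟨a, ha, hay⟩ := (isGLB_lt_iff hf).1 h1
    exact ha y hay (h2.trans_le (by gcongr; exact hf.1 ha))
  set Y : Set M := {f | ∃ x, x ∈ X ∧ IsGLB {a | ∀ y, a < y → y < a + c → A x y} f}
  have hYd : DSet L M Y := by
    apply DMap.dSet
    fun_prop
  by_cases hYi : Y.Infinite
  · obtain ⟨p, q, hpq, hpqY⟩ := hYd.infinite_iff.1 hYi
    obtain ⟨y, hpy, hyq⟩ := exists_between hpq
    refine ⟨y, ?_⟩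
    have hlt : max p (y - c) < y := max_lt hpy (sub_lt_self y hc)
    have : ∀ f ∈ Ioo (max p (y - c)) y, ∃ x ∈ {x | A x y},
        IsGLB {a | ∀ y, a < y → y < a + c → A x y} f := by
      intro f hf
      obtain ⟨x, _, hx⟩ := hpqY ⟨(le_max_left _ _).trans_lt hf.1, hf.2.trans hyq⟩
      exact ⟨x, hsub x f hx y hf.2 (sub_lt_iff_lt_add.1 ((le_max_right _ _).trans_lt hf.1)), hx⟩
    choose! g hg hg' using this
    refine infinite_of_injOn_mapsTo (f := g) ?_ hg (Ioo_infinite hlt)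
    intro a ha b hb hab
    exact (hg' a ha).unique (hab ▸ hg' b hb)
  · rw [not_infinite] at hYi
    by_contra! hfin
    refine hXi ((hYi.biUnion (t := fun f =>
      {x | IsGLB {a | ∀ y, a < y → y < a + c → A x y} f}) ?_).subset ?_)
    · intro f _
      obtain ⟨y, hy1, hy2⟩ := exists_between (lt_add_of_pos_right f hc)
      exact (hfin y).subset fun x hx => hsub x f hx y hy1 hy2
    · intro x hx
      obtain ⟨f, hf⟩ := hglb x hx
      exact mem_biUnion (x := f) ⟨x, hx, hf⟩ hf

theorem exists_infinite_fiber {A : M → M → Prop}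
    (hA : DMap L M fun p : M × M => A p.1 p.2)
    (h : {x | {y | A x y}.Infinite}.Infinite) : ∃ y, {x | A x y}.Infinite := by
  have hcases : {x | {y | A x y}.Infinite} ⊆
      {x | {y | A x y ∧ 0 < y}.Infinite} ∪ {x | {y | A x (-y) ∧ 0 < y}.Infinite} := by
    intro x hx
    by_contra hc
    simp only [mem_union, mem_ofPred_eq, not_or, not_infinite] at hc
    refine hx (((hc.1.union (hc.2.image fun y => -y)).union (finite_singleton 0)).subset ?_)
    intro y hy
    rcases lt_trichotomy y 0 with h0 | h0 | h0
    · exact Or.inl (Or.inr ⟨-y, ⟨by simpa using hy, by simpa using h0⟩, by simp⟩)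
    · exact Or.inr h0
    · exact Or.inl (Or.inl ⟨hy, h0⟩)
  rcases infinite_union.1 (h.mono hcases) with h' | h'
  · obtain ⟨y, hy⟩ := exists_infinite_fiber_of_pos (A := fun x y => A x y ∧ 0 < y)
      (by fun_prop) (fun _ _ h => h.2) h'
    exact ⟨y, hy.mono fun x hx => hx.1⟩
  · obtain ⟨y, hy⟩ := exists_infinite_fiber_of_pos (A := fun x y => A x (-y) ∧ 0 < y)
      (by fun_prop) (fun _ _ h => h.2) h'
    exact ⟨-y, hy.mono fun x hx => hx.1⟩

/-- The quantifier `there are infinitely many` commutes with itself. -/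
theorem infinite_infinite_swap {A : M → M → Prop}
    (hA : DMap L M fun p : M × M => A p.1 p.2)
    (h : {x | {y | A x y}.Infinite}.Infinite) : {y | {x | A x y}.Infinite}.Infinite := by
  intro hfin
  have hYd : DSet L M {y | {x | A x y}.Infinite} :=
    (DMap.infinite (A := fun y x => A x y) (by fun_prop)).dSet
  -- Deleting the supposedly finite set of y with infinite fibre leaves the fibres over x infinite,
  -- yet produces a further y with infinite fibre.
  obtain ⟨y, hy⟩ := exists_infinite_fiber
    (A := fun x y => A x y ∧ ¬ y ∈ {y | {x | A x y}.Infinite}) (by fun_prop) (h.mono fun x hx => by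
      exact (hx.sdiff hfin).mono fun y hy => hy)
  obtain ⟨x, hx⟩ := hy.nonempty
  exact hx.2 (hy.mono fun x hx => hx.1)

end Exchange

end OMinimal

/-! ### Dimension by elimination of coordinates -/

section Dimension

/-- `A ⊆ M ^ n` has dimension at least `k`, computed by eliminating one coordinate at a time. -/
def DimGE {M : Type w} : (n : ℕ) → ℕ → Set (Fin n → M) → Prop
  | 0, k, A => A.Nonempty ∧ k = 0
  | n + 1, k, A => DimGE n k {x | ∃ y, (Fin.snoc x y : Fin (n + 1) → M) ∈ A} ∨
      ∃ j, k = j + 1 ∧ DimGE n j {x | {y | (Fin.snoc x y : Fin (n + 1) → M) ∈ A}.Infinite}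

namespace DimGE

variable {M : Type w}

theorem mono {n k : ℕ} {A B : Set (Fin n → M)} (hAB : A ⊆ B) (h : DimGE n k A) : DimGE n k B := by
  induction n generalizing k with
  | zero => exact ⟨h.1.mono hAB, h.2⟩
  | succ n ih =>
    rcases h with h | ⟨j, hj, h⟩
    · exact Or.inl (ih (by rintro x ⟨y, hy⟩; exact ⟨y, hAB hy⟩) h)
    · exact Or.inr ⟨j, hj, ih (fun x hx => Set.Infinite.mono (fun y hy => hAB hy) hx) h⟩

theorem nonempty {n k : ℕ} {A : Set (Fin n → M)} (h : DimGE n k A) : A.Nonempty := by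
  induction n generalizing k with
  | zero => exact h.1
  | succ n ih =>
    rcases h with h | ⟨j, hj, h⟩
    · obtain ⟨x, y, hy⟩ := ih h; exact ⟨_, hy⟩
    · obtain ⟨x, hx⟩ := ih h
      obtain ⟨y, hy⟩ := Set.Infinite.nonempty hx
      exact ⟨_, hy⟩

theorem zero_iff {n : ℕ} {A : Set (Fin n → M)} : DimGE n 0 A ↔ A.Nonempty := by
  refine ⟨nonempty, fun h => ?_⟩
  induction n with
  | zero => exact ⟨h, rfl⟩
  | succ n ih =>
    obtain ⟨x, hx⟩ := h
    exact Or.inl (ih ⟨Fin.init x, x (Fin.last n), by rwa [Fin.snoc_init_self]⟩)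

theorem le {n k : ℕ} {A : Set (Fin n → M)} (h : DimGE n k A) : k ≤ n := by
  induction n generalizing k with
  | zero => exact h.2.le
  | succ n ih =>
    rcases h with h | ⟨j, rfl, h⟩
    · exact (ih h).trans n.le_succ
    · exact Nat.succ_le_succ (ih h)

theorem of_succ {n k : ℕ} {A : Set (Fin n → M)} (h : DimGE n (k + 1) A) : DimGE n k A := by
  induction n generalizing k with
  | zero => exact absurd h.2 k.succ_ne_zero
  | succ n ih =>
    rcases h with h | ⟨j, hj, h⟩
    · exact Or.inl (ih h)
    · obtain rfl := Nat.succ_injective hj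
      exact Or.inl (mono (fun x hx => Set.Infinite.nonempty hx) h)

theorem antitone {n k l : ℕ} {A : Set (Fin n → M)} (hkl : k ≤ l) (h : DimGE n l A) :
    DimGE n k A := by
  induction l, hkl using Nat.le_induction with
  | base => exact h
  | succ l _ ih => exact ih h.of_succ

theorem union_iff {n k : ℕ} {A B : Set (Fin n → M)} :
    DimGE n k (A ∪ B) ↔ DimGE n k A ∨ DimGE n k B := by
  refine ⟨fun h => ?_, fun h => h.elim (mono subset_union_left) (mono subset_union_right)⟩
  induction n generalizing k with
  | zero =>
    obtain ⟨h, rfl⟩ := h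
    exact (union_nonempty.1 h).imp (fun h => ⟨h, rfl⟩) (fun h => ⟨h, rfl⟩)
  | succ n ih =>
    rcases h with h | ⟨j, hj, h⟩
    · refine (ih (mono ?_ h)).imp Or.inl Or.inl
      rintro x ⟨y, hy | hy⟩
      exacts [Or.inl ⟨y, hy⟩, Or.inr ⟨y, hy⟩]
    · refine (ih (mono ?_ h)).imp (fun h => Or.inr ⟨j, hj, h⟩) (fun h => Or.inr ⟨j, hj, h⟩)
      intro x hx
      exact infinite_union.1 hx

theorem eq_zero_of_finite {n k : ℕ} {A : Set (Fin n → M)} (hA : A.Finite) (h : DimGE n k A) :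
    k = 0 := by
  induction n generalizing k with
  | zero => exact h.2
  | succ n ih =>
    rcases h with h | ⟨j, hj, h⟩
    · refine ih ((hA.image Fin.init).subset ?_) h
      rintro x ⟨y, hy⟩
      exact ⟨_, hy, Fin.init_snoc _ _⟩
    · obtain ⟨x, hx⟩ := h.nonempty
      refine absurd (hA.preimage (f := fun y => (Fin.snoc x y : Fin (n + 1) → M)) ?_) hx
      intro y _ z _ hyz
      simpa using congrFun hyz (Fin.last n)

theorem one_of_infinite {n : ℕ} {A : Set (Fin n → M)} (hA : A.Infinite) : DimGE n 1 A := by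
  induction n with
  | zero => exact absurd A.toFinite hA
  | succ n ih =>
    by_cases h : {x | ∃ y, (Fin.snoc x y : Fin (n + 1) → M) ∈ A}.Infinite
    · exact Or.inl (ih h)
    · refine Or.inr ⟨0, rfl, zero_iff.2 ?_⟩
      rw [not_infinite] at h
      by_contra hne
      refine hA ((h.biUnion (t := fun x => (fun y => (Fin.snoc x y : Fin (n + 1) → M)) ''
        {y | (Fin.snoc x y : Fin (n + 1) → M) ∈ A}) fun x _ => ?_).subset fun z hz => ?_)
      · refine Finite.image _ ?_
        by_contra hx
        exact hne ⟨x, hx⟩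
      · have hz' : Fin.snoc (Fin.init z) (z (Fin.last n)) ∈ A := by rwa [Fin.snoc_init_self]
        exact mem_biUnion (x := Fin.init z) ⟨_, hz'⟩ ⟨_, hz', Fin.snoc_init_self z⟩

/-- The definition eliminates the last coordinate, so splitting off a final block is an unfolding
and needs no definability. Only the interchange of blocks, `comm`, does. -/
theorem append_iff {m n k : ℕ} {A : Set (Fin (m + n) → M)} :
    DimGE (m + n) k A ↔ ∃ i j, i + j = k ∧ DimGE m i {x | DimGE n j {y | Fin.append x y ∈ A}} := by
  induction n generalizing k with
  | zero =>
    have h : ∀ (x : Fin m → M) (y : Fin 0 → M), Fin.append x y = x := fun x y => by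
      rw [Subsingleton.elim y Fin.elim0, Fin.append_elim0]; rfl
    constructor
    · intro hA
      exact ⟨k, 0, rfl, mono (fun x hx => ⟨⟨Fin.elim0, by simpa [h] using hx⟩, rfl⟩) hA⟩
    · rintro ⟨i, j, rfl, hA⟩
      obtain ⟨x, hx⟩ := hA.nonempty
      obtain rfl := hx.2
      refine mono ?_ hA
      rintro x ⟨⟨y, hy⟩, -⟩
      simpa [h] using hy
  | succ n ih =>
    have hdef : DimGE (m + (n + 1)) k A ↔
        DimGE (m + n) k {x | ∃ y, (Fin.snoc x y : Fin (m + n + 1) → M) ∈ A} ∨ ∃ j, k = j + 1 ∧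
        DimGE (m + n) j {x | {y | (Fin.snoc x y : Fin (m + n + 1) → M) ∈ A}.Infinite} := Iff.rfl
    have hs : ∀ (x : Fin m → M) (y : Fin n → M) z,
        (Fin.snoc (Fin.append x y) z : Fin (m + n + 1) → M) = Fin.append x (Fin.snoc y z) :=
      fun x y z => (Fin.append_snoc x y z).symm
    simp only [hdef, ih, mem_ofPred_eq, hs]
    constructor
    · rintro (⟨i, j, rfl, h⟩ | ⟨_, rfl, i, j, rfl, h⟩)
      · exact ⟨i, j, rfl, mono (fun x hx => Or.inl hx) h⟩
      · exact ⟨i, j + 1, rfl, mono (fun x hx => Or.inr ⟨j, rfl, hx⟩) h⟩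
    · rintro ⟨i, j, rfl, h⟩
      have h' : DimGE m i ({x | DimGE n j {y | ∃ z, Fin.append x (Fin.snoc y z) ∈ A}} ∪
          {x | ∃ l, j = l + 1 ∧
            DimGE n l {y | {z | Fin.append x (Fin.snoc y z) ∈ A}.Infinite}}) := h
      rcases union_iff.1 h' with h | h
      · exact Or.inl ⟨i, j, rfl, h⟩
      · obtain ⟨x, l, rfl, -⟩ := h.nonempty
        refine Or.inr ⟨i + l, rfl, i, l, rfl, mono ?_ h⟩
        rintro x ⟨l', hl, hx⟩
        obtain rfl := Nat.succ_injective hl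
        exact hx

end DimGE

/-- Both sides say that B is infinite as a set of pairs, a symmetric condition. -/
theorem infinite_exists_or_of_infinite {α β : Type*} {B : α → β → Prop}
    (h : {x | ∃ y, B x y}.Infinite ∨ ∃ x, {y | B x y}.Infinite) :
    {y | ∃ x, B x y}.Infinite ∨ ∃ y, {x | B x y}.Infinite := by
  by_contra! hc
  obtain ⟨h1, h2⟩ := hc
  rcases h with h | ⟨x, h⟩
  · refine h ((h1.biUnion fun y _ => h2 y).subset ?_)
    rintro x ⟨y, hy⟩
    exact mem_biUnion (x := y) ⟨x, hy⟩ hy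
  · exact h (h1.subset fun y hy => ⟨x, hy⟩)

theorem infinite_exists_or_iff {α β : Type*} {B : α → β → Prop} :
    ({x | ∃ y, B x y}.Infinite ∨ ∃ x, {y | B x y}.Infinite) ↔
    ({y | ∃ x, B x y}.Infinite ∨ ∃ y, {x | B x y}.Infinite) :=
  ⟨infinite_exists_or_of_infinite, infinite_exists_or_of_infinite (B := fun y x => B x y)⟩

section

variable {L : FirstOrder.Language.{u, v}} {M : Type w} [L.Structure M]
variable [LinearOrder M] [AddGroup M] [hM : Fact (IsOMinimalExpansionOfOrderedGroup L M)]
variable [Nontrivial M] [DenselyOrdered M] [NoMinOrder M] [NoMaxOrder M]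
variable [AddLeftMono M] [AddRightMono M] [TopologicalSpace M] [OrderTopology M]
variable {T : Type*} [DefSpace L M T]

theorem infinite_infinite_comm {A : M → M → Prop} (hA : DMap L M fun p : M × M => A p.1 p.2) :
    {x | {y | A x y}.Infinite}.Infinite ↔ {y | {x | A x y}.Infinite}.Infinite :=
  ⟨infinite_infinite_swap hA, infinite_infinite_swap (A := fun y x => A x y) (by fun_prop)⟩

namespace DimGE

/-- Induction on m, peeling off the last coordinate z of the block. The pairs of quantifiers on z
and y are of three kinds: two existentials commute, two "infinitely many" commute by o-minimality,
and the two mixed pairs commute only when taken together. -/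
theorem comm_one {m i : ℕ} {S : (Fin m → M) → M → Prop}
    (hS : DMap L M fun p : (Fin m → M) × M => S p.1 p.2) :
    (DimGE m i {x | ∃ y, S x y} ∨ ∃ j, i = j + 1 ∧ DimGE m j {x | {y | S x y}.Infinite}) ↔
    ((∃ y, DimGE m i {x | S x y}) ∨ ∃ j, i = j + 1 ∧ {y | DimGE m j {x | S x y}}.Infinite) := by
  induction m generalizing i with
  | zero =>
    have h : ∀ P : (Fin 0 → M) → Prop, {x | P x}.Nonempty ↔ P Fin.elim0 := fun P =>
      ⟨fun ⟨x, hx⟩ => Subsingleton.elim x Fin.elim0 ▸ hx, fun h => ⟨_, h⟩⟩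
    simp only [DimGE, h]
    refine or_congr exists_and_right.symm (exists_congr fun j => and_congr_right fun _ => ?_)
    by_cases hj : j = 0 <;> simp [hj]
  | succ m ih =>
    have hE : ∀ i, _ := fun i => ih (i := i)
      (S := fun x y => ∃ z, S (Fin.snoc x z) y) (by fun_prop)
    have hQ : ∀ i, _ := fun i => ih (i := i)
      (S := fun x y => {z | S (Fin.snoc x z) y}.Infinite) (by fun_prop)
    have hex : {x : Fin m → M | ∃ z y, S (Fin.snoc x z) y} = {x | ∃ y z, S (Fin.snoc x z) y} := by
      ext x; exact exists_comm
    -- Neither mixed alternative can be exchanged alone; their disjunction can.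
    have hmix : {x : Fin m → M | {z | ∃ y, S (Fin.snoc x z) y}.Infinite} ∪
        {x | ∃ z, {y | S (Fin.snoc x z) y}.Infinite} =
        {x : Fin m → M | {y | ∃ z, S (Fin.snoc x z) y}.Infinite} ∪
        {x | ∃ y, {z | S (Fin.snoc x z) y}.Infinite} := by
      ext x; exact infinite_exists_or_iff (B := fun z y => S (Fin.snoc x z) y)
    have hinf : {x : Fin m → M | {z | {y | S (Fin.snoc x z) y}.Infinite}.Infinite} =
        {x | {y | {z | S (Fin.snoc x z) y}.Infinite}.Infinite} := by
      ext x; exact infinite_infinite_comm (L := L) (A := fun z y => S (Fin.snoc x z) y)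
        (by fun_prop)
    simp only [DimGE, mem_ofPred_eq, hex, hinf]
    rcases i with _ | i
    · have : ∀ j, ¬ (0 = j + 1) := fun j h => by omega
      simpa [this] using hE 0
    · have h1 := hE (i + 1)
      have h2 := hQ i
      have h3 := (union_iff (n := m) (k := i)).symm.trans
        ((iff_of_eq (congrArg (DimGE m i) hmix)).trans union_iff)
      have h4 : {y | DimGE m i {x | ∃ z, S (Fin.snoc x z) y} ∨ ∃ j, i = j + 1 ∧
          DimGE m j {x | {z | S (Fin.snoc x z) y}.Infinite}}.Infinite ↔
          {y | DimGE m i {x | ∃ z, S (Fin.snoc x z) y}}.Infinite ∨ ∃ j, i = j + 1 ∧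
          {y | DimGE m j {x | {z | S (Fin.snoc x z) y}.Infinite}}.Infinite := by
        have : {y | DimGE m i {x | ∃ z, S (Fin.snoc x z) y} ∨ ∃ j, i = j + 1 ∧
          DimGE m j {x | {z | S (Fin.snoc x z) y}.Infinite}} =
          {y | DimGE m i {x | ∃ z, S (Fin.snoc x z) y}} ∪ {y | ∃ j, i = j + 1 ∧
          DimGE m j {x | {z | S (Fin.snoc x z) y}.Infinite}} := rfl
        rw [this, infinite_union]
        refine or_congr Iff.rfl ?_
        rcases i with _ | i
        · simp
        · simp
      have h5 : ∀ P : ℕ → Prop, (∃ j, i + 1 = j + 1 ∧ P j) ↔ P i := fun P => by simp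
      simp only [h5] at h1 ⊢
      clear hE hQ ih hinf hmix hex h5
      rw [h4, exists_or]
      clear h4
      have regroup : ∀ {a b c d e f g h x y : Prop}, (a ∨ x ↔ e ∨ g) → (y ∨ d ↔ f ∨ h) →
          (b ∨ c ↔ x ∨ y) → ((a ∨ b) ∨ c ∨ d ↔ (e ∨ f) ∨ g ∨ h) := by
        intro a b c d e f g h x y h1 h2 h3
        rw [show ((a ∨ b) ∨ c ∨ d) ↔ a ∨ (b ∨ c) ∨ d by simp only [or_assoc], h3,
          show (a ∨ (x ∨ y) ∨ d) ↔ (a ∨ x) ∨ (y ∨ d) by simp only [or_assoc], h1, h2]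
        exact or_or_or_comm
      exact regroup h1 h2 h3

/-- Induction on n: the last coordinate of the second block is moved past the first block by
`comm_one`. The exchange may shift one unit of dimension between i and j, so only the sum i + j is
controlled. -/
theorem comm {m n k : ℕ} {S : (Fin m → M) → (Fin n → M) → Prop}
    (hS : DMap L M fun p : (Fin m → M) × (Fin n → M) => S p.1 p.2) :
    (∃ i j, i + j = k ∧ DimGE m i {x | DimGE n j {y | S x y}}) ↔
    (∃ i j, i + j = k ∧ DimGE n j {y | DimGE m i {x | S x y}}) := by
  induction n generalizing k with
  | zero =>
    have h : ∀ P : (Fin 0 → M) → Prop, {x | P x}.Nonempty ↔ P Fin.elim0 := fun P =>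
      ⟨fun ⟨x, hx⟩ => Subsingleton.elim x Fin.elim0 ▸ hx, fun h => ⟨_, h⟩⟩
    simp only [DimGE, h]
    refine exists_congr fun i => exists_congr fun j => and_congr_right fun _ => ?_
    by_cases hj : j = 0
    · simp [hj]
    · simp only [hj, and_false, iff_false]
      intro h
      simpa using h.nonempty
  | succ n ih =>
    have hE : ∀ k, _ := fun k => ih (k := k)
      (S := fun x y => ∃ z, S x (Fin.snoc y z)) (by fun_prop)
    have hQ : ∀ k, _ := fun k => ih (k := k)
      (S := fun x y => {z | S x (Fin.snoc y z)}.Infinite) (by fun_prop)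
    have hone : ∀ i, {y | DimGE m i {x | ∃ z, S x (Fin.snoc y z)}} ∪
        {y | ∃ l, i = l + 1 ∧ DimGE m l {x | {z | S x (Fin.snoc y z)}.Infinite}} =
        {y : Fin n → M | ∃ z, DimGE m i {x | S x (Fin.snoc y z)}} ∪
        {y | ∃ l, i = l + 1 ∧ {z | DimGE m l {x | S x (Fin.snoc y z)}}.Infinite} := by
      intro i
      ext y
      exact comm_one (S := fun x z => S x (Fin.snoc y z)) (by fun_prop)
    have expand : ∀ {m n : ℕ} (i j : ℕ) (P : (Fin m → M) → Set (Fin (n + 1) → M)),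
        DimGE m i {x | DimGE (n + 1) j (P x)} ↔
          DimGE m i {x | DimGE n j {y | ∃ z, (Fin.snoc y z : Fin (n + 1) → M) ∈ P x}} ∨
          ∃ l, j = l + 1 ∧
            DimGE m i {x | DimGE n l {y | {z | (Fin.snoc y z : Fin (n + 1) → M) ∈ P x}.Infinite}} := by
      intro m n i j P
      have : {x | DimGE (n + 1) j (P x)} =
          {x | DimGE n j {y | ∃ z, (Fin.snoc y z : Fin (n + 1) → M) ∈ P x}} ∪
          {x | ∃ l, j = l + 1 ∧
            DimGE n l {y | {z | (Fin.snoc y z : Fin (n + 1) → M) ∈ P x}.Infinite}} := rfl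
      rw [this, union_iff]
      refine or_congr Iff.rfl ?_
      rcases j with _ | j
      · have h0 : ∀ l, ¬ (0 = l + 1) := fun l h => by omega
        simp only [h0, false_and, exists_const, iff_false]
        intro h
        simpa using h.nonempty
      · simp
    have hL : (∃ i j, i + j = k ∧ DimGE m i {x | DimGE (n + 1) j {y | S x y}}) ↔
        (∃ i j, i + j = k ∧ DimGE m i {x | DimGE n j {y | ∃ z, S x (Fin.snoc y z)}}) ∨
        ∃ k', k = k' + 1 ∧ ∃ i j, i + j = k' ∧
          DimGE m i {x | DimGE n j {y | {z | S x (Fin.snoc y z)}.Infinite}} := by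
      simp only [expand, mem_ofPred_eq]
      constructor
      · rintro ⟨i, j, rfl, h | ⟨l, rfl, h⟩⟩
        · exact Or.inl ⟨i, j, rfl, h⟩
        · exact Or.inr ⟨i + l, rfl, i, l, rfl, h⟩
      · rintro (⟨i, j, rfl, h⟩ | ⟨_, rfl, i, l, rfl, h⟩)
        · exact ⟨i, j, rfl, Or.inl h⟩
        · exact ⟨i, l + 1, rfl, Or.inr ⟨l, rfl, h⟩⟩
    rw [hL, hE]
    simp only [hQ]
    constructor
    · rintro (⟨i, j, rfl, h⟩ | ⟨_, rfl, i, j, rfl, h⟩)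
      · have h' := union_iff.1 (hone i ▸ mono subset_union_left h)
        rcases h' with h' | h'
        · exact ⟨i, j, rfl, Or.inl h'⟩
        · obtain ⟨y, l, rfl, -⟩ := h'.nonempty
          refine ⟨l, j + 1, by omega, Or.inr ⟨j, rfl, mono ?_ h'⟩⟩
          rintro y ⟨l', hl, hy⟩
          obtain rfl := Nat.succ_injective hl
          exact hy
      · have h0 : DimGE n j {y | ∃ l, i + 1 = l + 1 ∧
            DimGE m l {x | {z | S x (Fin.snoc y z)}.Infinite}} :=
          mono (fun y hy => ⟨i, rfl, hy⟩) h
        have h' := union_iff.1 (hone (i + 1) ▸ mono subset_union_right h0)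
        rcases h' with h' | h'
        · exact ⟨i + 1, j, by omega, Or.inl h'⟩
        · refine ⟨i, j + 1, by omega, Or.inr ⟨j, rfl, mono ?_ h'⟩⟩
          rintro y ⟨l', hl, hy⟩
          obtain rfl := Nat.succ_injective hl
          exact hy
    · rintro ⟨i, j, rfl, h | ⟨l, rfl, h⟩⟩
      · have h' := union_iff.1 ((hone i).symm ▸ mono subset_union_left h)
        rcases h' with h' | h'
        · exact Or.inl ⟨i, j, rfl, h'⟩
        · obtain ⟨y, l, rfl, -⟩ := h'.nonempty
          refine Or.inr ⟨l + j, by omega, l, j, rfl, mono ?_ h'⟩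
          rintro y ⟨l', hl, hy⟩
          obtain rfl := Nat.succ_injective hl
          exact hy
      · have h0 : DimGE n l {y | ∃ l', i + 1 = l' + 1 ∧
            {z | DimGE m l' {x | S x (Fin.snoc y z)}}.Infinite} :=
          mono (fun y hy => ⟨i, rfl, hy⟩) h
        have h' := union_iff.1 ((hone (i + 1)).symm ▸ mono subset_union_right h0)
        rcases h' with h' | h'
        · exact Or.inl ⟨i + 1, l, by omega, h'⟩
        · refine Or.inr ⟨i + l, by omega, i, l, rfl, mono ?_ h'⟩
          rintro y ⟨l', hl, hy⟩
          obtain rfl := Nat.succ_injective hl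
          exact hy

end DimGE

end

end Dimension

/-! ### Dimension in definable spaces, and boxes -/

section DimensionSpaces

variable {L : FirstOrder.Language.{u, v}} {M : Type w} [L.Structure M]
variable {T T' : Type*} [DefSpace L M T] [DefSpace L M T']

variable (L M) in
/-- The subset `A` of a definable space has dimension at least `k`. -/
def HasDimGE (k : ℕ) (A : Set T) : Prop :=
  DimGE (DefSpace.n L M T) k (DefSpace.e (L := L) (M := M) '' A)

namespace HasDimGE

theorem mono {k : ℕ} {A B : Set T} (hAB : A ⊆ B) (h : HasDimGE L M k A) : HasDimGE L M k B :=
  DimGE.mono (image_mono hAB) h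

theorem nonempty {k : ℕ} {A : Set T} (h : HasDimGE L M k A) : A.Nonempty :=
  image_nonempty.1 (DimGE.nonempty h)

theorem zero_iff {A : Set T} : HasDimGE L M 0 A ↔ A.Nonempty :=
  DimGE.zero_iff.trans image_nonempty

theorem antitone {k l : ℕ} {A : Set T} (hkl : k ≤ l) (h : HasDimGE L M l A) : HasDimGE L M k A :=
  DimGE.antitone hkl h

theorem union_iff {k : ℕ} {A B : Set T} :
    HasDimGE L M k (A ∪ B) ↔ HasDimGE L M k A ∨ HasDimGE L M k B := by
  unfold HasDimGE; rw [image_union]; exact DimGE.union_iff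

theorem exists_of_iUnion {k : ℕ} {ι : Type*} [Finite ι] {A : ι → Set T}
    (h : HasDimGE L M k (⋃ i, A i)) : ∃ i, HasDimGE L M k (A i) := by
  have key : ∀ s : Set ι, s.Finite → HasDimGE L M k (⋃ i ∈ s, A i) → ∃ i, HasDimGE L M k (A i) := by
    intro s hs
    induction s, hs using Set.Finite.induction_on with
    | empty => intro h; simpa using h.nonempty
    | insert _ _ ih =>
      rw [biUnion_insert, union_iff]
      rintro (h | h)
      exacts [⟨_, h⟩, ih h]
  exact key univ finite_univ (by simpa using h)

theorem eq_zero_of_finite {k : ℕ} {A : Set T} (hA : A.Finite) (h : HasDimGE L M k A) : k = 0 :=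
  DimGE.eq_zero_of_finite (hA.image _) h

theorem one_of_infinite {A : Set T} (hA : A.Infinite) : HasDimGE L M 1 A :=
  DimGE.one_of_infinite (hA.image DefSpace.inj.injOn)

theorem pi_iff {n k : ℕ} {A : Set (Fin n → M)} : HasDimGE L M k A ↔ DimGE n k A := by
  unfold HasDimGE
  rw [show (DefSpace.e (L := L) (M := M) '' A) = A from image_id A]
  rfl

theorem prod_iff {k : ℕ} {A : Set (T × T')} :
    HasDimGE L M k A ↔ ∃ i j, i + j = k ∧ HasDimGE L M i {t | HasDimGE L M j {t' | (t, t') ∈ A}} := by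
  refine DimGE.append_iff.trans (exists_congr fun i => exists_congr fun j => and_congr_right fun _ =>
    iff_of_eq (congrArg _ ?_))
  have h : ∀ t : T, {y | Fin.append (DefSpace.e (L := L) (M := M) t) y ∈
      DefSpace.e (L := L) (M := M) '' A} =
      DefSpace.e (L := L) (M := M) '' {t' | (t, t') ∈ A} := by
    intro t
    ext y
    constructor
    · rintro ⟨⟨s, s'⟩, hA, hs⟩
      obtain ⟨h1, h2⟩ := Fin.append_injective2.1 hs
      obtain rfl := DefSpace.inj h1
      exact ⟨s', hA, h2⟩
    · rintro ⟨t', ht, rfl⟩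
      exact ⟨(t, t'), ht, rfl⟩
  ext x
  constructor
  · intro hx
    obtain ⟨y, ⟨t, t'⟩, -, ht⟩ := DimGE.nonempty hx
    obtain ⟨h1, -⟩ := Fin.append_injective2.1 ht
    refine ⟨t, ?_, h1⟩
    rw [mem_ofPred_eq, ← h1, h] at hx
    exact hx
  · rintro ⟨t, ht, rfl⟩
    rw [mem_ofPred_eq, h]
    exact ht

theorem le_n {k : ℕ} {A : Set T} (h : HasDimGE L M k A) : k ≤ DefSpace.n L M T := DimGE.le h

theorem prod {i j : ℕ} {A : Set T} {B : Set T'} (hA : HasDimGE L M i A) (hB : HasDimGE L M j B) :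
    HasDimGE L M (i + j) (A ×ˢ B) :=
  prod_iff.2 ⟨i, j, rfl, hA.mono fun _ ht => hB.mono fun _ hs => ⟨ht, hs⟩⟩

end HasDimGE

theorem dMap_e : DMap L M (DefSpace.e (L := L) (M := M) : T → _) :=
  CoordMap.dMap ⟨fun i => i, fun _ => rfl⟩

variable [LinearOrder M] [AddGroup M] [hM : Fact (IsOMinimalExpansionOfOrderedGroup L M)]
variable [Nontrivial M] [DenselyOrdered M] [NoMinOrder M] [NoMaxOrder M]
variable [AddLeftMono M] [AddRightMono M] [TopologicalSpace M] [OrderTopology M]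

namespace HasDimGE

/-- Passing to coordinates is harmless because an empty fibre has no dimension, so points outside
the range of the embedding never qualify. -/
theorem image_hasDimGE_fiber (B : Set (T × T')) (j : ℕ) :
    DefSpace.e (L := L) (M := M) '' {t | HasDimGE L M j {t' | (t, t') ∈ B}} =
      {x | DimGE (DefSpace.n L M T') j
        {y | ∃ t t', (t, t') ∈ B ∧ DefSpace.e (L := L) (M := M) t = x ∧
          DefSpace.e (L := L) (M := M) t' = y}} := by
  have h : ∀ t : T, {y | ∃ s t', (s, t') ∈ B ∧ DefSpace.e (L := L) (M := M) s =
        DefSpace.e (L := L) (M := M) t ∧ DefSpace.e (L := L) (M := M) t' = y} =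
        DefSpace.e (L := L) (M := M) '' {t' | (t, t') ∈ B} := by
    intro t
    ext y
    constructor
    · rintro ⟨s, t', hB, hs, rfl⟩
      obtain rfl := DefSpace.inj hs
      exact ⟨t', hB, rfl⟩
    · rintro ⟨t', hB, rfl⟩
      exact ⟨t, t', hB, rfl, rfl⟩
  ext x
  constructor
  · rintro ⟨t, ht, rfl⟩
    rw [mem_ofPred_eq, h]; exact ht
  · intro hx
    obtain ⟨y, t, t', -, rfl, -⟩ := DimGE.nonempty hx
    rw [mem_ofPred_eq, h] at hx
    exact ⟨t, hx, rfl⟩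

/-- Additivity of dimension with the roles of base and fibre exchanged; all later dimension counts
go through it. -/
theorem swap_iff {k : ℕ} {A : Set (T × T')} (hA : DSet L M A) :
    HasDimGE L M k A ↔ ∃ i j, i + j = k ∧ HasDimGE L M i {t' | HasDimGE L M j {t | (t, t') ∈ A}} := by
  have he := dMap_e (L := L) (M := M) (T := T)
  have he' := dMap_e (L := L) (M := M) (T := T')
  rw [prod_iff]
  have hL : ∀ i j, HasDimGE L M i {t | HasDimGE L M j {t' | (t, t') ∈ A}} ↔ _ :=
    fun i j => iff_of_eq (congrArg (DimGE (DefSpace.n L M T) i) (image_hasDimGE_fiber A j))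
  have hR : ∀ i j, HasDimGE L M i {t' | HasDimGE L M j {t | (t, t') ∈ A}} ↔ _ :=
    fun i j => iff_of_eq (congrArg (DimGE (DefSpace.n L M T') i) (image_hasDimGE_fiber (Prod.swap ⁻¹' A) j))
  simp only [hL, hR]
  rw [DimGE.comm (L := L) (by fun_prop)]
  constructor
  · rintro ⟨i, j, rfl, h⟩
    refine ⟨j, i, add_comm _ _, h.mono ?_⟩
    intro y hy
    refine DimGE.mono ?_ hy
    rintro x ⟨t, t', hA, rfl, rfl⟩
    exact ⟨t', t, hA, rfl, rfl⟩
  · rintro ⟨j, i, rfl, h⟩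
    refine ⟨i, j, add_comm _ _, h.mono ?_⟩
    intro y hy
    refine DimGE.mono ?_ hy
    rintro x ⟨t, t', hA, rfl, rfl⟩
    exact ⟨t', t, hA, rfl, rfl⟩

theorem graph_iff {k : ℕ} {A : Set T} {f : T → T'} :
    HasDimGE L M k {p : T × T' | p.1 ∈ A ∧ f p.1 = p.2} ↔ HasDimGE L M k A := by
  rw [prod_iff]
  constructor
  · rintro ⟨i, j, rfl, h⟩
    obtain ⟨t, ht⟩ := h.nonempty
    obtain rfl : j = 0 := ht.eq_zero_of_finite
      ((finite_singleton (f t)).subset fun t' h => h.2.symm)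
    exact h.mono fun t ht => ht.nonempty.choose_spec.1
  · intro h
    exact ⟨k, 0, rfl, h.mono fun t ht => zero_iff.2 ⟨f t, ht, rfl⟩⟩

/-- The graph over A has the dimension of A. Projected to the target, its fibres over f '' A are
non-empty, so it has at least the dimension of f '' A. For injective f the fibres have at most one
point, which gives the converse `image`. -/
theorem of_image {k : ℕ} {A : Set T} {f : T → T'} (hf : DMap L M f) (hA : DSet L M A)
    (h : HasDimGE L M k (f '' A)) : HasDimGE L M k A := by
  rw [← graph_iff (f := f), swap_iff (DMap.dSet (by fun_prop))]
  refine ⟨k, 0, rfl, h.mono ?_⟩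
  rintro _ ⟨t, ht, rfl⟩
  exact zero_iff.2 ⟨t, ht, rfl⟩

theorem image {k : ℕ} {A : Set T} {f : T → T'} (hf : DMap L M f) (hA : DSet L M A)
    (hinj : InjOn f A) (h : HasDimGE L M k A) : HasDimGE L M k (f '' A) := by
  rw [← graph_iff (f := f), swap_iff (DMap.dSet (by fun_prop))] at h
  obtain ⟨i, j, rfl, h⟩ := h
  obtain ⟨y, hy⟩ := h.nonempty
  have : {t | t ∈ A ∧ f t = y}.Subsingleton := fun a ha b hb => hinj ha.1 hb.1 (ha.2.trans hb.2.symm)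
  obtain rfl : j = 0 := hy.eq_zero_of_finite this.finite
  refine h.mono fun y hy => ?_
  obtain ⟨t, ht, hty⟩ := hy.nonempty
  exact ⟨t, ht, hty⟩

theorem image_iff {k : ℕ} {A : Set T} {f : T → T'} (hf : DMap L M f) (hA : DSet L M A)
    (hinj : InjOn f A) : HasDimGE L M k (f '' A) ↔ HasDimGE L M k A :=
  ⟨of_image hf hA, image hf hA hinj⟩

/-- Dimension in terms of the slices along one coordinate. -/
theorem slice_iff {n k : ℕ} (i : Fin (n + 1)) {A : Set (Fin (n + 1) → M)} (hA : DSet L M A) :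
    DimGE (n + 1) k A ↔ (∃ t, DimGE n k {x | i.insertNth t x ∈ A}) ∨
      ∃ j, k = j + 1 ∧ {t | DimGE n j {x | i.insertNth t x ∈ A}}.Infinite := by
  have hA' : DSet L M {p : M × (Fin n → M) | i.insertNth p.1 p.2 ∈ A} := DMap.dSet (by fun_prop)
  have him : (fun p : M × (Fin n → M) => (i.insertNth p.1 p.2 : Fin (n + 1) → M)) ''
      {p : M × (Fin n → M) | i.insertNth p.1 p.2 ∈ A} = A := by
    ext x
    constructor
    · rintro ⟨p, hp, rfl⟩; exact hp
    · intro hx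
      exact ⟨(x i, i.removeNth x), by simpa using hx, by simp⟩
  rw [← pi_iff (L := L), ← him, image_iff (by fun_prop) hA', him, prod_iff]
  swap
  · intro p _ q _ hpq
    obtain ⟨h1, h2⟩ := (Fin.insertNth_injective2 (α := fun _ => M) (p := i)) hpq
    exact Prod.ext h1 h2
  simp only [mem_ofPred_eq, pi_iff]
  constructor
  · rintro ⟨a, j, rfl, h⟩
    have ha : a ≤ 1 := h.le_n
    interval_cases a
    · obtain ⟨t, ht⟩ := h.nonempty
      exact Or.inl ⟨t, by simpa using ht⟩
    · refine Or.inr ⟨j, add_comm _ _, fun hfin => ?_⟩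
      simpa using h.eq_zero_of_finite hfin
  · rintro (⟨t, ht⟩ | ⟨j, rfl, h⟩)
    · exact ⟨0, k, zero_add k, zero_iff.2 ⟨t, ht⟩⟩
    · exact ⟨1, j, add_comm _ _, one_of_infinite h⟩

end HasDimGE

/-- `x` lies in the open box with corners `a` and `b`. -/
def InBox {n : ℕ} (a b x : Fin n → M) : Prop := ∀ i, a i < x i ∧ x i < b i

@[fun_prop]
theorem DMap.inBox {n : ℕ} {a b x : T → Fin n → M} (ha : DMap L M a) (hb : DMap L M b)
    (hx : DMap L M x) : DMap L M fun t => InBox (a t) (b t) (x t) :=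
  DMap.forall_fin fun i => (DMap.lt (ha.apply i) (hx.apply i)).and (DMap.lt (hx.apply i) (hb.apply i))

theorem isOpen_inBox {n : ℕ} (a b : Fin n → M) : IsOpen {x | InBox a b x} := by
  have : {x | InBox a b x} = Set.pi univ fun i => Ioo (a i) (b i) := by
    ext x; simp [InBox]
  rw [this]
  exact isOpen_set_pi finite_univ fun i _ => isOpen_Ioo

theorem eventually_nhds_iff_inBox {n : ℕ} {x : Fin n → M} {P : (Fin n → M) → Prop} :
    (∀ᶠ y in 𝓝 x, P y) ↔ ∃ a b, InBox a b x ∧ ∀ y, InBox a b y → P y := by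
  constructor
  · intro h
    rw [nhds_pi, Filter.Eventually, Filter.mem_pi] at h
    obtain ⟨I, -, t, ht, hs⟩ := h
    choose a b hab hsub using fun i => mem_nhds_iff_exists_Ioo_subset.1 (ht i)
    exact ⟨a, b, fun i => hab i, fun y hy => hs fun i _ => hsub i (hy i)⟩
  · rintro ⟨a, b, hx, h⟩
    exact Filter.eventually_of_mem ((isOpen_inBox a b).mem_nhds hx) h

@[fun_prop]
theorem DMap.eventually_nhds_pi {n : ℕ} {f : T → Fin n → M} (hf : DMap L M f)
    {P : T → (Fin n → M) → Prop} (hP : DMap L M fun p : T × (Fin n → M) => P p.1 p.2) :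
    DMap L M fun t => ∀ᶠ x in 𝓝 (f t), P t x := by
  simp only [eventually_nhds_iff_inBox]
  fun_prop

theorem DMap.mem_closure_pi {n : ℕ} {f : T → Fin n → M} (hf : DMap L M f)
    {P : T → (Fin n → M) → Prop} (hP : DMap L M fun p : T × (Fin n → M) => P p.1 p.2) :
    DMap L M fun t => f t ∈ closure {x | P t x} := by
  simp only [mem_closure_iff_frequently, Filter.Frequently, mem_ofPred_eq]
  fun_prop

theorem DSet.closure_pi {n : ℕ} {A : Set (Fin n → M)} (hA : DSet L M A) : DSet L M (closure A) :=
  DMap.dSet (p := fun x => x ∈ closure {x | x ∈ A})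
    (DMap.mem_closure_pi (P := fun _ x => x ∈ A) (by fun_prop) (by fun_prop))

theorem inBox_snoc {n : ℕ} {a b x : Fin n → M} {c d y : M} :
    InBox (Fin.snoc a c : Fin (n + 1) → M) (Fin.snoc b d) (Fin.snoc x y) ↔
      InBox a b x ∧ c < y ∧ y < d := by
  simp [InBox, Fin.forall_fin_succ']

theorem InBox.exists {n : ℕ} {a b : Fin n → M} (h : ∀ i, a i < b i) : ∃ x, InBox a b x := by
  choose x hx using fun i => exists_between (h i)
  exact ⟨x, hx⟩

namespace DimGE

theorem of_inBox {n : ℕ} {A : Set (Fin n → M)} {a b : Fin n → M} (hab : ∀ i, a i < b i)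
    (h : ∀ x, InBox a b x → x ∈ A) : DimGE n n A := by
  induction n with
  | zero => exact zero_iff.2 ⟨_, h Fin.elim0 fun i => i.elim0⟩
  | succ n ih =>
    refine Or.inr ⟨n, rfl, ih (a := Fin.init a) (b := Fin.init b) (fun i => hab _) fun x hx => ?_⟩
    refine (Ioo_infinite (hab (Fin.last n))).mono fun y hy => h _ ?_
    rw [← Fin.snoc_init_self a, ← Fin.snoc_init_self b, inBox_snoc]
    exact ⟨hx, hy⟩

/-- For a full-dimensional set of x the fibre contains an interval, hence infinitely many c each
with infinitely many d such that (c, d) lies in the fibre. Exchanging quantifiers fixes first c and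
then d for a full-dimensional set of x, to which induction applies. -/
theorem exists_inBox {n : ℕ} {A : Set (Fin n → M)} (hA : DSet L M A) (h : DimGE n n A) :
    ∃ a b : Fin n → M, (∀ i, a i < b i) ∧ ∀ x, InBox a b x → x ∈ A := by
  induction n with
  | zero =>
    obtain ⟨x, hx⟩ := h.nonempty
    exact ⟨x, x, fun i => i.elim0, fun y _ => Subsingleton.elim x y ▸ hx⟩
  | succ n ih =>
    rcases h with h | ⟨j, hj, h⟩
    · exact absurd h.le (by omega)
    obtain rfl := Nat.succ_injective hj
    have hW : DMap L M fun p : ((Fin n → M) × M) × M =>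
        p.1.2 < p.2 ∧ ∀ y, p.1.2 < y → y < p.2 → (Fin.snoc p.1.1 y : Fin (n + 1) → M) ∈ A := by
      fun_prop
    have h1 : DimGE n n {x | {c | {d | c < d ∧ ∀ y, c < y → y < d →
        (Fin.snoc x y : Fin (n + 1) → M) ∈ A}.Infinite}.Infinite} := by
      refine h.mono fun x hx => ?_
      have hd : DSet L M {y | (Fin.snoc x y : Fin (n + 1) → M) ∈ A} := DMap.dSet (by fun_prop)
      obtain ⟨p, q, hpq, hs⟩ := hd.infinite_iff.1 hx
      refine (Ioo_infinite hpq).mono fun c hc => (Ioo_infinite hc.2).mono fun d hd => ?_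
      exact ⟨hd.1, fun y h1 h2 => hs ⟨hc.1.trans h1, h2.trans hd.2⟩⟩
    -- The other alternative of `comm_one` would put dimension n + 1 inside M ^ n.
    have key : ∀ {S : (Fin n → M) → M → Prop}, (DMap L M fun p : (Fin n → M) × M => S p.1 p.2) →
        DimGE n n {x | {y | S x y}.Infinite} → ∃ y, DimGE n n {x | S x y} := by
      intro S hS h
      rcases (comm_one (i := n + 1) hS).1 (Or.inr ⟨n, rfl, h⟩) with ⟨y, hy⟩ | ⟨j, hj, hy⟩
      · exact absurd hy.le (by omega)
      · obtain rfl := Nat.succ_injective hj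
        exact hy.nonempty
    obtain ⟨c, hc⟩ := key (S := fun x c => {d | c < d ∧ ∀ y, c < y → y < d →
        (Fin.snoc x y : Fin (n + 1) → M) ∈ A}.Infinite) (by fun_prop) h1
    obtain ⟨d, hd⟩ := key (S := fun x d => c < d ∧ ∀ y, c < y → y < d →
        (Fin.snoc x y : Fin (n + 1) → M) ∈ A) (by fun_prop) hc
    obtain ⟨_, hcd, -⟩ := hd.nonempty
    obtain ⟨a, b, hab, hs⟩ := ih (DMap.dSet (by fun_prop)) hd
    refine ⟨Fin.snoc a c, Fin.snoc b d, fun i => ?_, fun x hx => ?_⟩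
    · refine Fin.lastCases ?_ (fun i => ?_) i
      · simpa using hcd
      · simpa using hab i
    · rw [← Fin.snoc_init_self x, inBox_snoc] at hx
      rw [← Fin.snoc_init_self x]
      exact (hs _ hx.1).2 _ hx.2.1 hx.2.2

theorem iff_interior_nonempty {n : ℕ} {A : Set (Fin n → M)} (hA : DSet L M A) :
    DimGE n n A ↔ (interior A).Nonempty := by
  constructor
  · intro h
    obtain ⟨a, b, hab, hs⟩ := exists_inBox hA h
    obtain ⟨x, hx⟩ := InBox.exists hab
    exact ⟨x, mem_interior.2 ⟨_, hs, isOpen_inBox a b, hx⟩⟩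
  · rintro ⟨x, hx⟩
    obtain ⟨a, b, hx, hs⟩ := eventually_nhds_iff_inBox.1 (mem_interior_iff_mem_nhds.1 hx)
    exact of_inBox (fun i => (hx i).1.trans (hx i).2) hs

end DimGE

end DimensionSpaces

/-! ### Comparison with topological dimension, and the frontier inequality -/

section Frontier

variable {L : FirstOrder.Language.{u, v}} {M : Type w} [L.Structure M]
variable {T T' : Type*} [DefSpace L M T] [DefSpace L M T']
variable [LinearOrder M] [AddGroup M] [hM : Fact (IsOMinimalExpansionOfOrderedGroup L M)]
variable [Nontrivial M] [DenselyOrdered M] [NoMinOrder M] [NoMaxOrder M]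
variable [AddLeftMono M] [AddRightMono M] [TopologicalSpace M] [OrderTopology M]

theorem DSet.image {f : T → T'} (hf : DMap L M f) {A : Set T} (hA : DSet L M A) :
    DSet L M (f '' A) :=
  DMap.dSet (p := fun y => ∃ x, x ∈ A ∧ f x = y) (by fun_prop)

/-- The coordinates to keep are those eliminated by the "infinitely many" clause. -/
theorem DimGE.exists_projection {n k : ℕ} {A : Set (Fin n → M)} (hA : DSet L M A)
    (h : DimGE n k A) : ∃ σ : Fin k → Fin n, Function.Injective σ ∧
      DimGE k k ((fun x => x ∘ σ) '' A) := by
  induction n generalizing k with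
  | zero =>
    obtain ⟨h, rfl⟩ := h
    exact ⟨Fin.elim0, fun i => i.elim0, zero_iff.2 (h.image _)⟩
  | succ n ih =>
    rcases h with h | ⟨j, rfl, h⟩
    · obtain ⟨σ, hσ, hs⟩ := ih (DMap.dSet (by fun_prop)) h
      refine ⟨Fin.castSucc ∘ σ, (Fin.castSucc_injective n).comp hσ, hs.mono ?_⟩
      rintro _ ⟨x, ⟨y, hy⟩, rfl⟩
      exact ⟨_, hy, by ext i; simp⟩
    · obtain ⟨σ, hσ, hs⟩ := ih (DMap.dSet (by fun_prop)) h
      refine ⟨Fin.snoc (Fin.castSucc ∘ σ) (Fin.last n), ?_, Or.inr ⟨j, rfl, hs.mono ?_⟩⟩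
      · rw [Fin.snoc_injective_iff]
        refine ⟨(Fin.castSucc_injective n).comp hσ, ?_⟩
        rintro ⟨i, hi⟩
        exact (Fin.castSucc_lt_last _).ne hi
      · rintro _ ⟨x, hx, rfl⟩
        refine Set.Infinite.mono (fun y hy => ⟨_, hy, ?_⟩) hx
        ext i
        refine Fin.lastCases ?_ (fun i => ?_) i <;> simp

theorem dMap_comp_left {n k : ℕ} (σ : Fin k → Fin n) :
    DMap L M fun x : Fin n → M => (x ∘ σ : Fin k → M) :=
  CoordMap.dMap ⟨σ, fun _ => rfl⟩

theorem interior_restrict_nonempty_iff {n k : ℕ} {A : Set (Fin n → M)} (hA : DSet L M A)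
    {s : Finset (Fin n)} {σ : Fin k → Fin n} (e : Fin k ≃ s) (he : ∀ i, (e i : Fin n) = σ i) :
    (interior ((fun (x : Fin n → M) (i : s) => x i) '' A)).Nonempty ↔
      DimGE k k ((fun x => x ∘ σ) '' A) := by
  have hd : DSet L M ((fun x : Fin n → M => (x ∘ σ : Fin k → M)) '' A) :=
    hA.image (dMap_comp_left σ)
  rw [DimGE.iff_interior_nonempty hd]
  let h : (s → M) ≃ₜ (Fin k → M) := Homeomorph.piCongrLeft (Y := fun _ => M) e.symm
  have : (fun x : Fin n → M => (x ∘ σ : Fin k → M)) '' A =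
      h '' ((fun (x : Fin n → M) (i : s) => x i) '' A) := by
    rw [image_image]
    refine image_congr fun x _ => ?_
    ext i
    obtain ⟨j, rfl⟩ := e.symm.surjective i
    exact (congrArg x (by simp [← he])).trans
      (Equiv.piCongrLeft_apply_apply (fun _ => M) e.symm (fun i : s => x i) j).symm
  rw [this, ← h.image_interior, image_nonempty]

theorem le_omDim_iff {n k : ℕ} {A : Set (Fin n → M)} (hA : DSet L M A) :
    (k : WithBot ℕ) ≤ omDim A ↔ DimGE n k A := by
  unfold omDim
  have hbot : (⊥ : WithBot ℕ) < (k : WithBot ℕ) := WithBot.bot_lt_coe k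
  rw [Finset.le_sup_iff hbot]
  constructor
  · rintro ⟨s, -, hs⟩
    split_ifs at hs with hint
    · have hk : k ≤ s.card := by exact_mod_cast hs
      have := (interior_restrict_nonempty_iff hA (σ := fun i => (s.equivFin.symm i : Fin n))
        s.equivFin.symm fun _ => rfl).1 hint
      have h := (HasDimGE.pi_iff (L := L)).2 this
      exact HasDimGE.pi_iff.1 (((HasDimGE.of_image (dMap_comp_left _) hA h)).antitone hk)
    · exact absurd hs (by simp)
  · intro h
    obtain ⟨σ, hσ, h⟩ := h.exists_projection hA
    refine ⟨Finset.univ.image σ, Finset.mem_univ _, ?_⟩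
    let e : Fin k ≃ (Finset.univ.image σ : Finset (Fin n)) :=
      (Equiv.ofInjective σ hσ).trans (Equiv.subtypeEquivRight fun x => by simp)
    have := (interior_restrict_nonempty_iff hA (σ := σ) e fun _ => rfl).2 h
    rw [if_pos this, Finset.card_image_of_injective _ hσ]
    simp

theorem inBox_insertNth {n : ℕ} (i : Fin (n + 1)) {a b x : Fin n → M} {c d y : M} :
    InBox (i.insertNth c a : Fin (n + 1) → M) (i.insertNth d b) (i.insertNth y x) ↔
      (c < y ∧ y < d) ∧ InBox a b x := by
  simp [InBox, Fin.forall_iff_succAbove i]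

/-- At a bad t some box (a, b) meets the slice of the closure but misses the slice of A. The corners
can be moved towards a point x of the slice of the closure, so each bad t has a 2n-dimensional
family of boxes. If infinitely many t were bad, a dimension count would give one box good for
infinitely many t, hence for an interval (p, q). Then (p, q) × (a, b) meets the closure of A and
misses A. -/
theorem finite_closure_slice_ne {n : ℕ} (i : Fin (n + 1)) {A : Set (Fin (n + 1) → M)}
    (hA : DSet L M A) : {t | ∃ x, i.insertNth t x ∈ closure A ∧
      x ∉ closure {x | (i.insertNth t x : Fin (n + 1) → M) ∈ A}}.Finite := by
  by_contra hinf
  have hcl := hA.closure_pi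
  set W : M → (Fin n → M) × (Fin n → M) → Prop := fun t p =>
    (∃ x, InBox p.1 p.2 x ∧ i.insertNth t x ∈ closure A) ∧
      ∀ x, InBox p.1 p.2 x → ¬ (i.insertNth t x : Fin (n + 1) → M) ∈ A with hW
  have hWd : DMap L M fun p : M × (Fin n → M) × (Fin n → M) => W p.1 p.2 := by
    simp only [hW]; fun_prop
  have h1 : HasDimGE L M (1 + (n + n)) {p : M × (Fin n → M) × (Fin n → M) | W p.1 p.2} := by
    refine HasDimGE.prod_iff.2 ⟨1, n + n, rfl, (HasDimGE.one_of_infinite hinf).mono ?_⟩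
    rintro t ⟨x, hx, hx'⟩
    rw [mem_closure_iff_frequently, not_frequently, eventually_nhds_iff_inBox] at hx'
    obtain ⟨a, b, hab, hs⟩ := hx'
    refine ((HasDimGE.pi_iff.2 (DimGE.of_inBox (fun i => (hab i).1) fun a' h => h)).prod
      (HasDimGE.pi_iff.2 (DimGE.of_inBox (fun i => (hab i).2) fun b' h => h))).mono ?_
    rintro ⟨a', b'⟩ ⟨ha', hb'⟩
    exact ⟨⟨x, fun i => ⟨(ha' i).2, (hb' i).1⟩, hx⟩,
      fun y hy => hs y fun i => ⟨(ha' i).1.trans (hy i).1, (hy i).2.trans (hb' i).2⟩⟩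
  rw [HasDimGE.swap_iff hWd.dSet] at h1
  obtain ⟨k, j, hkj, h1⟩ := h1
  have hk : k ≤ n + n := h1.le_n
  obtain ⟨⟨a, b⟩, hab⟩ := h1.nonempty
  have hj : 1 ≤ j := by omega
  have hinf' : {t | W t (a, b)}.Infinite := fun hfin => by
    have := hab.eq_zero_of_finite hfin
    omega
  have hd : DSet L M {t | W t (a, b)} := DMap.dSet (by fun_prop)
  obtain ⟨p, q, hpq, hs⟩ := hd.infinite_iff.1 hinf'
  obtain ⟨t, ht⟩ := exists_between hpq
  obtain ⟨⟨x, hx, hxA⟩, -⟩ := hs ht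
  obtain ⟨z, hz, hzA⟩ := mem_closure_iff.1 hxA _ (isOpen_inBox (i.insertNth p a) (i.insertNth q b))
    ((inBox_insertNth i).2 ⟨ht, hx⟩)
  rw [← Fin.insertNth_self_removeNth i z] at hz hzA
  obtain ⟨hz1, hz2⟩ := (inBox_insertNth i).1 hz
  exact (hs hz1).2 _ hz2 hzA

/-- The dimension of the frontier of a definable set is smaller than that of the set. -/
theorem DimGE.of_frontier {n k : ℕ} {A : Set (Fin n → M)} (hA : DSet L M A)
    (h : DimGE n k (closure A \ A)) : DimGE n (k + 1) A := by
  induction n generalizing k with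
  | zero =>
    obtain ⟨x, hx, hxA⟩ := h.nonempty
    obtain ⟨y, hy⟩ := closure_nonempty_iff.1 ⟨x, hx⟩
    exact absurd (Subsingleton.elim y x ▸ hy) hxA
  | succ n ih =>
    have hsl : ∀ (i : Fin (n + 1)) t, DSet L M {x | (i.insertNth t x : Fin (n + 1) → M) ∈ A} :=
      fun i t => DMap.dSet (by fun_prop)
    set C : Fin (n + 1) → Set (Fin (n + 1) → M) := fun i =>
      {z | i.removeNth z ∈ closure {x | (i.insertNth (z i) x : Fin (n + 1) → M) ∈ A}} with hC
    -- C i collects the points that are limits of A within their own slice at coordinate i. A point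
    -- of the closure in no C i has all its coordinates in finite exceptional sets.
    have hfin : (closure A \ ⋃ i, C i).Finite := by
      refine (Finite.pi' fun i => finite_closure_slice_ne i hA).subset ?_
      rintro z ⟨hz, hzC⟩ i
      refine ⟨i.removeNth z, by simpa using hz, fun h => hzC (mem_iUnion.2 ⟨i, h⟩)⟩
    have hsub : closure A \ A ⊆ (closure A \ ⋃ i, C i) ∪ ⋃ i, (C i \ A) := by
      rintro z ⟨hz, hzA⟩
      by_cases h : z ∈ ⋃ i, C i
      · obtain ⟨i, hi⟩ := mem_iUnion.1 h
        exact Or.inr (mem_iUnion.2 ⟨i, hi, hzA⟩)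
      · exact Or.inl ⟨hz, h⟩
    rcases union_iff.1 (h.mono hsub) with h' | h'
    · obtain rfl := eq_zero_of_finite hfin h'
      refine one_of_infinite fun hAf => ?_
      obtain ⟨z, hz, hzA⟩ := h.nonempty
      exact hzA (hAf.isClosed.closure_eq ▸ hz)
    · obtain ⟨i, hi⟩ := HasDimGE.exists_of_iUnion (L := L) (HasDimGE.pi_iff.2 h')
      rw [HasDimGE.pi_iff] at hi
      have hrem : DMap L M fun z : Fin (n + 1) → M => i.removeNth z :=
        DMap.pi fun j => dMap_apply (i.succAbove j)
      have hCi := DMap.mem_closure_pi (P := fun (z : Fin (n + 1) → M) x =>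
        (i.insertNth (z i) x : Fin (n + 1) → M) ∈ A) hrem (by fun_prop)
      have hCd : DSet L M (C i \ A) := hCi.dSet.inter hA.compl
      have hslice : ∀ t, {x | (i.insertNth t x : Fin (n + 1) → M) ∈ C i \ A} =
          closure {x | (i.insertNth t x : Fin (n + 1) → M) ∈ A} \
            {x | (i.insertNth t x : Fin (n + 1) → M) ∈ A} := by
        intro t; ext x; simp [hC]
      rw [HasDimGE.slice_iff i hCd] at hi
      rw [HasDimGE.slice_iff i hA]
      simp only [hslice] at hi
      rcases hi with ⟨t, ht⟩ | ⟨j, rfl, hj⟩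
      · exact Or.inl ⟨t, ih (hsl i t) ht⟩
      · exact Or.inr ⟨j + 1, rfl, hj.mono fun t ht => ih (hsl i t) ht⟩

end Frontier

/-! ### Definable relatively clopen subsets -/

section Clopens

variable {L : FirstOrder.Language.{u, v}} {M : Type w} [L.Structure M]
variable {T T' : Type*} [DefSpace L M T] [DefSpace L M T']
variable [TopologicalSpace T] [TopologicalSpace T']

variable (L M) in
/-- The definable relatively clopen subsets of `A`. -/
def DefClopens (A : Set T) : Set (Set T) :=
  {W | W ⊆ A ∧ DSet L M W ∧ (∀ x ∈ W, ∀ᶠ y in 𝓝 x, y ∈ A → y ∈ W) ∧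
    ∀ x ∈ A, x ∉ W → ∀ᶠ y in 𝓝 x, y ∈ A → y ∉ W}

namespace DefClopens

theorem self {A : Set T} (hA : DSet L M A) : A ∈ DefClopens L M A :=
  ⟨Subset.rfl, hA, fun _ _ => .of_forall fun _ h => h, fun _ h h' => absurd h h'⟩

theorem diff {A W W' : Set T} (h : W ∈ DefClopens L M A) (h' : W' ∈ DefClopens L M A) :
    W \ W' ∈ DefClopens L M A := by
  refine ⟨sdiff_subset.trans h.1, h.2.1.inter h'.2.1.compl, fun x hx => ?_, fun x hx hxW => ?_⟩
  · filter_upwards [h.2.2.1 x hx.1, h'.2.2.2 x (h.1 hx.1) hx.2] with y h1 h2 hy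
    exact ⟨h1 hy, h2 hy⟩
  · by_cases hW : x ∈ W
    · have hW' : x ∈ W' := by_contra fun h => hxW ⟨hW, h⟩
      filter_upwards [h'.2.2.1 x hW'] with y h1 hy h2 using h2.2 (h1 hy)
    · filter_upwards [h.2.2.2 x hx hW] with y h1 hy h2 using h1 hy h2.1

theorem inter {A W W' : Set T} (h : W ∈ DefClopens L M A) (h' : W' ∈ DefClopens L M A) :
    W ∩ W' ∈ DefClopens L M A := by
  have := diff h (diff h h')
  rwa [sdiff_sdiff_right_self] at this

theorem restrict {A A' W : Set T} (h : W ∈ DefClopens L M A) (hA' : DSet L M A') (hs : A' ⊆ A) :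
    W ∩ A' ∈ DefClopens L M A' := by
  refine ⟨inter_subset_right, h.2.1.inter hA', fun x hx => ?_, fun x hx hxW => ?_⟩
  · filter_upwards [h.2.2.1 x hx.1] with y h1 hy using ⟨h1 (hs hy), hy⟩
  · filter_upwards [h.2.2.2 x (hs hx) fun h => hxW ⟨h, hx⟩] with y h1 hy h2 using h1 (hs hy) h2.1

/-- A subset of the union is determined by its traces on the pieces, which are again clopen. Hence
finiteness may be proved piecewise on any finite definable cover, with no condition on how the
pieces meet. -/
theorem finite_iUnion {ι : Type*} [Finite ι] {A : ι → Set T} (hA : ∀ i, DSet L M (A i))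
    (h : ∀ i, (DefClopens L M (A i)).Finite) : (DefClopens L M (⋃ i, A i)).Finite := by
  refine Finite.of_injOn (f := fun W i => W ∩ A i) (t := {g | ∀ i, g i ∈ DefClopens L M (A i)})
    (fun W hW i => restrict hW (hA i) (subset_iUnion A i)) ?_ (Finite.pi' h)
  intro W hW W' hW' heq
  have key : ∀ i x, x ∈ A i → (x ∈ W ↔ x ∈ W') := fun i x hx => by
    have := Set.ext_iff.1 (congrFun heq i) x
    simpa [hx] using this
  ext x
  constructor
  · intro hx
    obtain ⟨i, hi⟩ := mem_iUnion.1 (hW.1 hx)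
    exact (key i x hi).1 hx
  · intro hx
    obtain ⟨i, hi⟩ := mem_iUnion.1 (hW'.1 hx)
    exact (key i x hi).2 hx

theorem finite_union {A B : Set T} (hA : DSet L M A) (hB : DSet L M B)
    (h : (DefClopens L M A).Finite) (h' : (DefClopens L M B).Finite) :
    (DefClopens L M (A ∪ B)).Finite := by
  rw [union_eq_iUnion]
  exact finite_iUnion (fun i => by cases i <;> assumption) (fun i => by cases i <;> assumption)

theorem finite_image {A : Set T} (hA : DSet L M A) {f : T → T'} (hf : DMap L M f)
    (hc : ContinuousOn f A) (h : (DefClopens L M A).Finite) :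
    (DefClopens L M (f '' A)).Finite := by
  refine Finite.of_injOn (f := fun W => A ∩ f ⁻¹' W) (t := DefClopens L M A) ?_ ?_ h
  · intro W hW
    refine ⟨inter_subset_left, hA.inter (hW.2.1.preimage hf), fun x hx => ?_, fun x hx hxW => ?_⟩
    · have := (hc x hx.1).eventually (hW.2.2.1 (f x) hx.2)
      filter_upwards [eventually_nhdsWithin_iff.1 this] with y h1 hy
      exact ⟨hy, h1 hy ⟨y, hy, rfl⟩⟩
    · have := (hc x hx).eventually (hW.2.2.2 (f x) ⟨x, hx, rfl⟩ fun h => hxW ⟨hx, h⟩)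
      filter_upwards [eventually_nhdsWithin_iff.1 this] with y h1 hy h2
      exact h1 hy ⟨y, hy, rfl⟩ h2.2
  · have key : ∀ W ∈ DefClopens L M (f '' A), f '' (A ∩ f ⁻¹' W) = W := fun W hW => by
      rw [image_inter_preimage, inter_eq_right.2 hW.1]
    intro W hW W' hW' heq
    have heq' : A ∩ f ⁻¹' W = A ∩ f ⁻¹' W' := heq
    rw [← key W hW, ← key W' hW', heq']

end DefClopens

end Clopens

/-! ### Generic semicontinuity of fibres -/

section Fibers

variable {L : FirstOrder.Language.{u, v}} {M : Type w} [L.Structure M]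
variable {T T' : Type*} [DefSpace L M T] [DefSpace L M T']
variable [LinearOrder M] [AddGroup M] [hM : Fact (IsOMinimalExpansionOfOrderedGroup L M)]
variable [Nontrivial M] [DenselyOrdered M] [NoMinOrder M] [NoMaxOrder M]
variable [AddLeftMono M] [AddRightMono M] [TopologicalSpace M] [OrderTopology M]

@[fun_prop]
theorem dMap_init {n : ℕ} : DMap L M fun x : Fin (n + 1) → M => (Fin.init x : Fin n → M) :=
  dMap_comp_left Fin.castSucc

/-- A definable property that holds on a definable family generically holds nearby. -/
theorem not_dimGE_of_mem_closure {m k : ℕ} {B S : Set (Fin m → M)} (hB : DSet L M B)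
    (hBk : ¬ DimGE m (k + 1) B) (hSB : S ⊆ B) {V : (Fin m → M) → T → Prop}
    (hV : DMap L M fun p : (Fin m → M) × T => V p.1 p.2)
    (h : ∀ x ∈ S, HasDimGE L M (DefSpace.n L M T)
      {p | V x p ∧ x ∈ closure {x' | x' ∈ B ∧ ¬ V x' p}}) : ¬ DimGE m k S := by
  intro hS
  have hcl := DMap.mem_closure_pi (L := L) (T := (Fin m → M) × T) (f := fun p => p.1)
    (P := fun p x' => x' ∈ B ∧ ¬ V x' p.2) (by fun_prop) (by fun_prop)
  have hR : DSet L M {p : (Fin m → M) × T | p.1 ∈ B ∧ V p.1 p.2 ∧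
      p.1 ∈ closure {x' | x' ∈ B ∧ ¬ V x' p.2}} :=
    hB.preimage DMap.id'.fst |>.inter (hV.dSet.inter hcl.dSet)
  have h1 : HasDimGE L M (k + DefSpace.n L M T) {p : (Fin m → M) × T | p.1 ∈ B ∧ V p.1 p.2 ∧
      p.1 ∈ closure {x' | x' ∈ B ∧ ¬ V x' p.2}} := by
    refine HasDimGE.prod_iff.2 ⟨k, _, rfl, HasDimGE.mono ?_ (HasDimGE.pi_iff.2 hS)⟩
    intro x hx
    exact (h x hx).mono fun p hp => ⟨hSB hx, hp⟩
  -- The parameters account for at most `DefSpace.n L M T` dimensions. So a single p leaves a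
  -- k-dimensional set of x in the frontier of {x' ∈ B | ¬ V x' p}, against the frontier inequality.
  rw [HasDimGE.swap_iff hR] at h1
  obtain ⟨i, j, hij, h1⟩ := h1
  have hi := h1.le_n
  obtain ⟨p, hp⟩ := h1.nonempty
  have hpk := HasDimGE.pi_iff.1 (hp.antitone (show k ≤ j by omega))
  have hQ : DSet L M {x' | x' ∈ B ∧ ¬ V x' p} := DMap.dSet (by fun_prop)
  refine hBk ((DimGE.of_frontier hQ (hpk.mono ?_)).mono fun x hx => hx.1)
  rintro x ⟨-, hV, hx⟩
  exact ⟨hx, fun h => h.2 hV⟩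

theorem eventually_nhds_snoc_iff {m : ℕ} {x : Fin m → M} {y : M} {P : (Fin (m + 1) → M) → Prop} :
    (∀ᶠ z in 𝓝 (Fin.snoc x y : Fin (m + 1) → M), P z) ↔
      ∃ c d, c < y ∧ y < d ∧ ∀ᶠ x' in 𝓝 x, ∀ y', c < y' → y' < d → P (Fin.snoc x' y') := by
  simp only [eventually_nhds_iff_inBox]
  constructor
  · rintro ⟨a, b, hab, h⟩
    rw [← Fin.snoc_init_self a, ← Fin.snoc_init_self b, inBox_snoc] at hab
    refine ⟨_, _, hab.2.1, hab.2.2, _, _, hab.1, fun x' hx' y' h1 h2 => h _ ?_⟩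
    rw [← Fin.snoc_init_self a, ← Fin.snoc_init_self b, inBox_snoc]
    exact ⟨hx', h1, h2⟩
  · rintro ⟨c, d, hc, hd, a, b, hab, h⟩
    refine ⟨Fin.snoc a c, Fin.snoc b d, inBox_snoc.2 ⟨hab, hc, hd⟩, fun z hz => ?_⟩
    rw [← Fin.snoc_init_self z] at hz ⊢
    rw [inBox_snoc] at hz
    exact h _ hz.1 _ hz.2.1 hz.2.2

variable {m : ℕ}

/-- Points of the fibre of `F` over `x` survive in the fibres over nearby points of `B`. -/
def FiberLSC (B : Set (Fin m → M)) (F : Set (Fin (m + 1) → M)) (x : Fin m → M) : Prop :=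
  ∀ a b, (∃ y, a < y ∧ y < b ∧ (Fin.snoc x y : Fin (m + 1) → M) ∈ F) →
    ∀ᶠ x' in 𝓝 x, x' ∈ B → ∃ y, a < y ∧ y < b ∧ (Fin.snoc x' y : Fin (m + 1) → M) ∈ F

/-- A closed interval disjoint from the fibre of `F` over `x` is disjoint from nearby fibres. -/
def FiberUSC (B : Set (Fin m → M)) (F : Set (Fin (m + 1) → M)) (x : Fin m → M) : Prop :=
  ∀ a b, (∀ y, a ≤ y → y ≤ b → (Fin.snoc x y : Fin (m + 1) → M) ∉ F) →
    ∀ᶠ x' in 𝓝 x, x' ∈ B → ∀ y, a ≤ y → y ≤ b → (Fin.snoc x' y : Fin (m + 1) → M) ∉ F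

/-- A bounded fibre of `F` over `x` stays uniformly bounded nearby. -/
def FiberBounded (B : Set (Fin m → M)) (F : Set (Fin (m + 1) → M)) (x : Fin m → M) : Prop :=
  (∀ a, (∀ y, a ≤ y → (Fin.snoc x y : Fin (m + 1) → M) ∉ F) →
    ∀ᶠ x' in 𝓝 x, x' ∈ B → ∀ y, a ≤ y → (Fin.snoc x' y : Fin (m + 1) → M) ∉ F) ∧
  ∀ a, (∀ y, y ≤ a → (Fin.snoc x y : Fin (m + 1) → M) ∉ F) →
    ∀ᶠ x' in 𝓝 x, x' ∈ B → ∀ y, y ≤ a → (Fin.snoc x' y : Fin (m + 1) → M) ∉ F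

variable {B : Set (Fin m → M)} {F : Set (Fin (m + 1) → M)}

theorem dMap_fiberLSC (hB : DSet L M B) (hF : DSet L M F) : DMap L M (FiberLSC B F) := by
  unfold FiberLSC; fun_prop

theorem dMap_fiberUSC (hB : DSet L M B) (hF : DSet L M F) : DMap L M (FiberUSC B F) := by
  unfold FiberUSC; fun_prop

theorem dMap_fiberBounded (hB : DSet L M B) (hF : DSet L M F) : DMap L M (FiberBounded B F) := by
  unfold FiberBounded; fun_prop

/-- A failure at x for the interval (a, b) persists for every smaller interval still containing the
witness y. These intervals form the full-dimensional family of parameters that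
`not_dimGE_of_mem_closure` requires. -/
theorem not_dimGE_not_fiberLSC {k : ℕ} (hB : DSet L M B) (hF : DSet L M F)
    (hBk : ¬ DimGE m (k + 1) B) : ¬ DimGE m k {x | x ∈ B ∧ ¬ FiberLSC B F x} := by
  refine not_dimGE_of_mem_closure (L := L) (T := M × M) hB hBk (fun x hx => hx.1)
    (V := fun x p => ∃ y, p.1 < y ∧ y < p.2 ∧ (Fin.snoc x y : Fin (m + 1) → M) ∈ F)
    (by fun_prop) ?_
  rintro x ⟨-, hx⟩
  simp only [FiberLSC, not_forall, not_eventually] at hx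
  obtain ⟨a, b, ⟨y, hay, hyb, hy⟩, hx⟩ := hx
  refine ((HasDimGE.one_of_infinite (Ioo_infinite hay)).prod
    (HasDimGE.one_of_infinite (Ioo_infinite hyb))).mono ?_
  rintro ⟨a', b'⟩ ⟨ha, hb⟩
  refine ⟨⟨y, ha.2, hb.1, hy⟩, mem_closure_iff_frequently.2 (hx.mono fun x' hx' => ?_)⟩
  obtain ⟨hB', hx'⟩ := hx'
  exact ⟨hB', fun ⟨z, h1, h2, h3⟩ => hx' ⟨z, ha.1.trans h1, h2.trans hb.2, h3⟩⟩

theorem exists_Ioo_of_finite_fiber {x : Fin m → M}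
    (hfin : {y | (Fin.snoc x y : Fin (m + 1) → M) ∈ F}.Finite) {y : M}
    (hy : (Fin.snoc x y : Fin (m + 1) → M) ∉ F) :
    ∃ c d, c < y ∧ y < d ∧ ∀ z, c < z → z < d → (Fin.snoc x z : Fin (m + 1) → M) ∉ F := by
  obtain ⟨c, d, h, hs⟩ := mem_nhds_iff_exists_Ioo_subset.1 (hfin.isClosed.isOpen_compl.mem_nhds hy)
  exact ⟨c, d, h.1, h.2, fun z h1 h2 => hs ⟨h1, h2⟩⟩

/-- Here the interval is enlarged: the fibre is finite, so a closed interval missing it can be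
lengthened a little at both ends. -/
theorem not_dimGE_not_fiberUSC {k : ℕ} (hB : DSet L M B) (hF : DSet L M F)
    (hfin : ∀ x, {y | (Fin.snoc x y : Fin (m + 1) → M) ∈ F}.Finite)
    (hBk : ¬ DimGE m (k + 1) B) : ¬ DimGE m k {x | x ∈ B ∧ ¬ FiberUSC B F x} := by
  refine not_dimGE_of_mem_closure (L := L) (T := M × M) hB hBk (fun x hx => hx.1)
    (V := fun x p => ∀ y, p.1 ≤ y → y ≤ p.2 → ¬ (Fin.snoc x y : Fin (m + 1) → M) ∈ F)
    (by fun_prop) ?_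
  rintro x ⟨-, hx⟩
  simp only [FiberUSC, not_forall, not_eventually] at hx
  obtain ⟨a, b, hab, hx⟩ := hx
  have hle : a ≤ b := by
    obtain ⟨x', _, y, h1, h2, -⟩ := hx.exists
    exact h1.trans h2
  obtain ⟨c, d, hca, had, h1⟩ := exists_Ioo_of_finite_fiber (hfin x) (hab a le_rfl hle)
  obtain ⟨c', d', hcb, hbd, h2⟩ := exists_Ioo_of_finite_fiber (hfin x) (hab b hle le_rfl)
  refine ((HasDimGE.one_of_infinite (Ioo_infinite hca)).prod
    (HasDimGE.one_of_infinite (Ioo_infinite hbd))).mono ?_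
  rintro ⟨a', b'⟩ ⟨ha, hb⟩
  refine ⟨fun y hy1 hy2 => ?_, mem_closure_iff_frequently.2 (hx.mono fun x' hx' => ?_)⟩
  · rcases lt_or_ge y a with h | h
    · exact h1 y (ha.1.trans_le hy1) (h.trans had)
    · rcases lt_or_ge b y with h' | h'
      · exact h2 y (hcb.trans h') (hy2.trans_lt hb.2)
      · exact hab y h h'
  · obtain ⟨hB', y, h1, h2, h3⟩ := hx'
    exact ⟨hB', fun h => h y (ha.2.le.trans h1) (h2.trans hb.1.le) (not_not.1 h3)⟩

theorem not_dimGE_not_fiberBounded {k : ℕ} (hB : DSet L M B) (hF : DSet L M F)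
    (hfin : ∀ x, {y | (Fin.snoc x y : Fin (m + 1) → M) ∈ F}.Finite)
    (hBk : ¬ DimGE m (k + 1) B) : ¬ DimGE m k {x | x ∈ B ∧ ¬ FiberBounded B F x} := by
  have h1 : ¬ DimGE m k {x | x ∈ B ∧ ¬ ∀ a, (∀ y, a ≤ y → (Fin.snoc x y : Fin (m + 1) → M) ∉ F) →
      ∀ᶠ x' in 𝓝 x, x' ∈ B → ∀ y, a ≤ y → (Fin.snoc x' y : Fin (m + 1) → M) ∉ F} := by
    refine not_dimGE_of_mem_closure (L := L) (T := M) hB hBk (fun x hx => hx.1)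
      (V := fun x p => ∀ y, p ≤ y → ¬ (Fin.snoc x y : Fin (m + 1) → M) ∈ F) (by fun_prop) ?_
    rintro x ⟨-, hx⟩
    simp only [not_forall, not_eventually] at hx
    obtain ⟨a, ha, hx⟩ := hx
    obtain ⟨c, d, hca, had, h1⟩ := exists_Ioo_of_finite_fiber (hfin x) (ha a le_rfl)
    refine (HasDimGE.one_of_infinite (Ioo_infinite hca)).mono ?_
    intro a' ha'
    refine ⟨fun y hy => ?_, mem_closure_iff_frequently.2 (hx.mono fun x' hx' => ?_)⟩
    · rcases lt_or_ge y a with h | h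
      exacts [h1 y (ha'.1.trans_le hy) (h.trans had), ha y h]
    · obtain ⟨hB', y, h1, h3⟩ := hx'
      exact ⟨hB', fun h => h y (ha'.2.le.trans h1) (not_not.1 h3)⟩
  have h2 : ¬ DimGE m k {x | x ∈ B ∧ ¬ ∀ a, (∀ y, y ≤ a → (Fin.snoc x y : Fin (m + 1) → M) ∉ F) →
      ∀ᶠ x' in 𝓝 x, x' ∈ B → ∀ y, y ≤ a → (Fin.snoc x' y : Fin (m + 1) → M) ∉ F} := by
    refine not_dimGE_of_mem_closure (L := L) (T := M) hB hBk (fun x hx => hx.1)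
      (V := fun x p => ∀ y, y ≤ p → ¬ (Fin.snoc x y : Fin (m + 1) → M) ∈ F) (by fun_prop) ?_
    rintro x ⟨-, hx⟩
    simp only [not_forall, not_eventually] at hx
    obtain ⟨a, ha, hx⟩ := hx
    obtain ⟨c, d, hca, had, h1⟩ := exists_Ioo_of_finite_fiber (hfin x) (ha a le_rfl)
    refine (HasDimGE.one_of_infinite (Ioo_infinite had)).mono ?_
    intro a' ha'
    refine ⟨fun y hy => ?_, mem_closure_iff_frequently.2 (hx.mono fun x' hx' => ?_)⟩
    · rcases lt_or_ge a y with h | h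
      exacts [h1 y (hca.trans h) (hy.trans_lt ha'.2), ha y h]
    · obtain ⟨hB', y, h1, h3⟩ := hx'
      exact ⟨hB', fun h => h y (h1.trans ha'.1.le) (not_not.1 h3)⟩
  intro h
  refine (DimGE.union_iff.1 (h.mono ?_)).elim h1 h2
  rintro x ⟨hx, hx'⟩
  rcases not_and_or.1 hx' with h | h
  exacts [Or.inl ⟨hx, h⟩, Or.inr ⟨hx, h⟩]

end Fibers

/-! ### Finiteness of the number of definable clopen subsets -/

section FiniteClopens

variable {L : FirstOrder.Language.{u, v}} {M : Type w} [L.Structure M]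
variable [LinearOrder M] [AddGroup M] [hM : Fact (IsOMinimalExpansionOfOrderedGroup L M)]
variable [Nontrivial M] [DenselyOrdered M] [NoMinOrder M] [NoMaxOrder M]
variable [AddLeftMono M] [AddRightMono M] [TopologicalSpace M] [OrderTopology M]
variable {m : ℕ} {B : Set (Fin m → M)} {F : Set (Fin (m + 1) → M)}

theorem eventually_mem_projection (hl : ∀ x ∈ B, FiberLSC B F x)
    {W : Set (Fin (m + 1) → M)} (hW : W ∈ DefClopens L M {z | z ∈ F ∧ Fin.init z ∈ B})
    {x : Fin m → M} {y : M} (hxy : (Fin.snoc x y : Fin (m + 1) → M) ∈ W) :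
    ∀ᶠ x' in 𝓝 x, x' ∈ B → ∃ y', (Fin.snoc x' y' : Fin (m + 1) → M) ∈ W := by
  obtain ⟨c, d, hc, hd, h⟩ := eventually_nhds_snoc_iff.1 (hW.2.2.1 _ hxy)
  obtain ⟨hF, hB⟩ := hW.1 hxy
  rw [Fin.init_snoc] at hB
  filter_upwards [h, hl x hB c d ⟨y, hc, hd, hF⟩] with x' h1 h2 hx'
  obtain ⟨y', h3, h4, h5⟩ := h2 hx'
  exact ⟨y', h1 y' h3 h4 ⟨h5, by rwa [Fin.init_snoc]⟩⟩

/-- Convex fibres are definably connected, so a clopen set is a union of whole fibres and is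
determined by its projection. Lower semicontinuity makes the projection clopen in B. -/
theorem finite_defClopens_of_convex_fibers (hB : DSet L M B) (hF : DSet L M F)
    (hl : ∀ x ∈ B, FiberLSC B F x) (hBc : (DefClopens L M B).Finite)
    (hne : ∀ x ∈ B, ∃ y, (Fin.snoc x y : Fin (m + 1) → M) ∈ F)
    (hconv : ∀ x ∈ B, {y | (Fin.snoc x y : Fin (m + 1) → M) ∈ F}.OrdConnected) :
    (DefClopens L M {z | z ∈ F ∧ Fin.init z ∈ B}).Finite := by
  have hfib : ∀ W ∈ DefClopens L M {z | z ∈ F ∧ Fin.init z ∈ B}, ∀ x y y',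
      (Fin.snoc x y : Fin (m + 1) → M) ∈ W → (Fin.snoc x y' : Fin (m + 1) → M) ∈ F →
      (Fin.snoc x y' : Fin (m + 1) → M) ∈ W := by
    intro W hW x y y' hy hy'
    have hd := hW.2.1
    have hxB : x ∈ B := by have := (hW.1 hy).2; rwa [Fin.init_snoc] at this
    have hev : ∀ y {P : (Fin (m + 1) → M) → Prop},
        (∀ᶠ z in 𝓝 (Fin.snoc x y : Fin (m + 1) → M), P z) → ∀ᶠ z in 𝓝 y, P (Fin.snoc x z) := by
      intro y P h
      obtain ⟨c, d, hc, hd, h⟩ := eventually_nhds_snoc_iff.1 h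
      filter_upwards [Ioo_mem_nhds hc hd] with z hz using h.self_of_nhds z hz.1 hz.2
    refine DSet.subset_of_clopen (L := L) (C := {y | (Fin.snoc x y : Fin (m + 1) → M) ∈ F})
      (S := {y | (Fin.snoc x y : Fin (m + 1) → M) ∈ W}) (DMap.dSet (by fun_prop)) (hconv x hxB)
      ?_ ?_ (hW.1 hy).1 hy hy'
    · intro t _ ht
      filter_upwards [hev t (hW.2.2.1 _ ht)] with z h1 hz
      exact h1 ⟨hz, by rwa [Fin.init_snoc]⟩
    · intro t htF ht
      filter_upwards [hev t (hW.2.2.2 _ ⟨htF, by rwa [Fin.init_snoc]⟩ ht)] with z h1 hz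
      exact h1 ⟨hz, by rwa [Fin.init_snoc]⟩
  have hFB : DSet L M {z | z ∈ F ∧ Fin.init z ∈ B} := DMap.dSet (by fun_prop)
  refine Finite.of_injOn (f := fun W => {x | ∃ y, (Fin.snoc x y : Fin (m + 1) → M) ∈ W})
    (t := DefClopens L M B) ?_ ?_ hBc
  · intro W hW
    have hd := hW.2.1
    refine ⟨?_, DMap.dSet (by fun_prop), ?_, ?_⟩
    · rintro x ⟨y, hy⟩
      have := (hW.1 hy).2
      rwa [Fin.init_snoc] at this
    · rintro x ⟨y, hy⟩
      exact eventually_mem_projection hl hW hy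
    · intro x hx hxW
      obtain ⟨y, hy⟩ := hne x hx
      have hy' : (Fin.snoc x y : Fin (m + 1) → M) ∈ {z | z ∈ F ∧ Fin.init z ∈ B} \ W :=
        ⟨⟨hy, by rwa [Fin.init_snoc]⟩, fun h => hxW ⟨y, h⟩⟩
      filter_upwards [eventually_mem_projection hl
        (DefClopens.diff (DefClopens.self hFB) hW) hy'] with x' h1 hx'
      obtain ⟨t, ht⟩ := h1 hx'
      rintro ⟨s, hs⟩
      exact ht.2 (hfib W hW x' s t hs ht.1.1)
  · have key : ∀ W ∈ DefClopens L M {z | z ∈ F ∧ Fin.init z ∈ B}, ∀ z, z ∈ W ↔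
        z ∈ F ∧ Fin.init z ∈ {x | ∃ y, (Fin.snoc x y : Fin (m + 1) → M) ∈ W} := by
      intro W hW z
      constructor
      · intro hz
        exact ⟨(hW.1 hz).1, z (Fin.last m), by rwa [Fin.snoc_init_self]⟩
      · rintro ⟨hz, y, hy⟩
        rw [← Fin.snoc_init_self z] at hz ⊢
        exact hfib W hW _ _ _ hy hz
    intro W hW W' hW' heq
    ext z
    rw [key W hW, key W' hW']
    exact and_congr_right fun _ => Set.ext_iff.1 heq _

/-- Semicontinuity and boundedness make projections of clopen sets clopen in B. Applied to
differences, this shows that a clopen set is determined by its trace on the fibres over finitely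
many points. -/
theorem finite_defClopens_of_finite_fibers (hB : DSet L M B)
    (hl : ∀ x ∈ B, FiberLSC B F x) (hu : ∀ x ∈ B, FiberUSC B F x)
    (hb : ∀ x ∈ B, FiberBounded B F x) (hBc : (DefClopens L M B).Finite)
    (hfin : ∀ x, {y | (Fin.snoc x y : Fin (m + 1) → M) ∈ F}.Finite) :
    (DefClopens L M {z | z ∈ F ∧ Fin.init z ∈ B}).Finite := by
  have hproj : ∀ W ∈ DefClopens L M {z | z ∈ F ∧ Fin.init z ∈ B},
      {x | ∃ y, (Fin.snoc x y : Fin (m + 1) → M) ∈ W} ∈ DefClopens L M B := by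
    intro W hW
    have hd := hW.2.1
    refine ⟨?_, DMap.dSet (by fun_prop), ?_, ?_⟩
    · rintro x ⟨y, hy⟩
      have := (hW.1 hy).2
      rwa [Fin.init_snoc] at this
    · rintro x ⟨y, hy⟩
      exact eventually_mem_projection hl hW hy
    intro x hx hxW
    have hWF : ∀ {z}, z ∉ F → z ∉ W := fun hz hzW => hz (hW.1 hzW).1
    -- Sweep upwards over the heights c such that W has no point of height ≤ c near x. The sweep
    -- starts by boundedness. It passes a height in the fibre of F because that point is outside the
    -- clopen W, and any other height by `FiberUSC`.
    have hSd : DSet L M {c | ∀ᶠ x' in 𝓝 x, x' ∈ B → ∀ y, y ≤ c →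
        ¬ (Fin.snoc x' y : Fin (m + 1) → M) ∈ W} := DMap.dSet (by fun_prop)
    obtain ⟨lo, hlo⟩ := (hfin x).bddBelow
    obtain ⟨lo', hlo'⟩ := exists_lt lo
    obtain ⟨up, hup⟩ := (hfin x).bddAbove
    obtain ⟨up', hup'⟩ := exists_gt up
    have hne : lo' ∈ {c | ∀ᶠ x' in 𝓝 x, x' ∈ B → ∀ y, y ≤ c →
        ¬ (Fin.snoc x' y : Fin (m + 1) → M) ∈ W} := by
      refine ((hb x hx).2 lo' fun y hy h => ?_).mono fun x' h1 hx' y hy => hWF (h1 hx' y hy)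
      exact (hy.trans_lt hlo').not_ge (hlo h)
    have huniv := hSd.eq_univ_of_isLowerSet ⟨_, hne⟩
      (fun a b hba ha => ha.mono fun x' h1 hx' y hy => h1 hx' y (hy.trans hba)) ?_
    · have h1 : up' ∈ {c | ∀ᶠ x' in 𝓝 x, x' ∈ B → ∀ y, y ≤ c →
        ¬ (Fin.snoc x' y : Fin (m + 1) → M) ∈ W} := huniv ▸ mem_univ _
      have h2 := (hb x hx).1 up' fun y hy h => (hup'.trans_le hy).not_ge (hup h)
      filter_upwards [h1, h2] with x' h1 h2 hx'
      rintro ⟨y, hy⟩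
      rcases le_total y up' with h | h
      exacts [h1 hx' y h hy, hWF (h2 hx' y h) hy]
    intro c
    by_cases hc : (Fin.snoc x c : Fin (m + 1) → M) ∈ F
    · obtain ⟨p, q, hp, hq, h⟩ := eventually_nhds_snoc_iff.1
        (hW.2.2.2 _ ⟨hc, by rwa [Fin.init_snoc]⟩ fun h => hxW ⟨c, h⟩)
      obtain ⟨a, ha⟩ := exists_between hp
      obtain ⟨b, hb⟩ := exists_between hq
      refine ⟨a, ha.2, b, hb.1, fun hS => ?_⟩
      filter_upwards [hS, h] with x' h1 h2 hx' y hy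
      rcases le_or_gt y a with h | h
      · exact h1 hx' y h
      · intro hyW
        exact h2 y (ha.1.trans h) (hy.trans_lt hb.2) (hW.1 hyW) hyW
    · obtain ⟨p, q, hp, hq, h⟩ := exists_Ioo_of_finite_fiber (hfin x) hc
      obtain ⟨a, ha⟩ := exists_between hp
      obtain ⟨b, hb⟩ := exists_between hq
      refine ⟨a, ha.2, b, hb.1, fun hS => ?_⟩
      filter_upwards [hS, hu x hx a b fun y h1 h2 => h y (ha.1.trans_le h1) (h2.trans_lt hb.2)]
        with x' h1 h2 hx' y hy
      rcases le_total y a with h | h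
      exacts [h1 hx' y h, hWF (h2 hx' y h hy)]
  -- One point is chosen in each non-empty clopen subset of B, and Z is the finite union of the
  -- fibres of F over the chosen points. If W is not inside W', the projection of W \ W' contains a
  -- chosen point, so the difference is visible on Z.
  have hpt : ∀ W ∈ DefClopens L M B, ∃ x, W.Nonempty → x ∈ W := by
    intro W _
    by_cases h : W.Nonempty
    · exact ⟨h.choose, fun _ => h.choose_spec⟩
    · obtain ⟨y⟩ : Nonempty (Fin m → M) := inferInstance
      exact ⟨y, fun h' => absurd h' h⟩
  choose! pt hpt using hpt
  have hPfin : (pt '' DefClopens L M B).Finite := hBc.image _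
  set Z : Set (Fin (m + 1) → M) := ⋃ x ∈ pt '' DefClopens L M B,
    (fun y => (Fin.snoc x y : Fin (m + 1) → M)) ''
      {y | (Fin.snoc x y : Fin (m + 1) → M) ∈ F} with hZ
  have hZfin : Z.Finite := hPfin.biUnion fun x _ => (hfin x).image _
  refine Finite.of_injOn (f := fun W => W ∩ Z) (fun W _ => inter_subset_right) ?_
    hZfin.finite_subsets
  have key : ∀ W ∈ DefClopens L M {z | z ∈ F ∧ Fin.init z ∈ B},
      ∀ W' ∈ DefClopens L M {z | z ∈ F ∧ Fin.init z ∈ B}, W ∩ Z = W' ∩ Z → W ⊆ W' := by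
    intro W hW W' hW' heq z hz
    by_contra hzW'
    have hD := hproj _ (DefClopens.diff hW hW')
    have hz' : (Fin.snoc (Fin.init z) (z (Fin.last m)) : Fin (m + 1) → M) ∈ W \ W' := by
      rw [Fin.snoc_init_self]; exact ⟨hz, hzW'⟩
    obtain ⟨y, hy⟩ := hpt _ hD ⟨Fin.init z, _, hz'⟩
    have hyZ : (Fin.snoc (pt {x | ∃ y, (Fin.snoc x y : Fin (m + 1) → M) ∈ W \ W'}) y :
        Fin (m + 1) → M) ∈ Z :=
      mem_biUnion (mem_image_of_mem pt hD) ⟨y, (hW.1 hy.1).1, rfl⟩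
    exact hy.2 (heq ▸ mem_inter hy.1 hyZ : _ ∈ W' ∩ Z).1
  intro W hW W' hW' heq
  exact (key W hW W' hW' heq).antisymm (key W' hW' W hW heq.symm)

/-- Induction on the dimension of the base: the points where semicontinuity fails form a base of
smaller dimension, and on the remaining points it still holds, since it only concerns nearby points
of the base. -/
theorem finite_defClopens_of_subset_convex_fibers {E : Set (Fin m → M)}
    (hE : ∀ B ⊆ E, DSet L M B → (DefClopens L M B).Finite) {F : Set (Fin (m + 1) → M)}
    (hF : DSet L M F) (hFE : ∀ z ∈ F, Fin.init z ∈ E)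
    (hconv : ∀ x, {y | (Fin.snoc x y : Fin (m + 1) → M) ∈ F}.OrdConnected) :
    (DefClopens L M F).Finite := by
  have key : ∀ k, ∀ B ⊆ E, DSet L M B → (∀ x ∈ B, ∃ y, (Fin.snoc x y : Fin (m + 1) → M) ∈ F) →
      ¬ DimGE m k B → (DefClopens L M {z | z ∈ F ∧ Fin.init z ∈ B}).Finite := by
    intro k
    induction k with
    | zero =>
      intro B _ hB _ h
      rw [DimGE.zero_iff, not_nonempty_iff_eq_empty] at h
      subst h
      refine (finite_singleton ∅).subset fun W hW => ?_
      exact subset_empty_iff.1 (hW.1.trans fun z hz => hz.2)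
    | succ k ih =>
      intro B hBE hB hne hk
      have hl := dMap_fiberLSC hB hF
      have hbad : DSet L M {x | x ∈ B ∧ ¬ FiberLSC B F x} := DMap.dSet (by fun_prop)
      have hgood : DSet L M {x | x ∈ B ∧ FiberLSC B F x} := DMap.dSet (by fun_prop)
      have h1 := ih _ (fun x hx => hBE hx.1) hbad (fun x hx => hne x hx.1)
        (not_dimGE_not_fiberLSC hB hF hk)
      have h2 := finite_defClopens_of_convex_fibers hgood hF
        (fun x hx a b hab => (hx.2 a b hab).mono fun x' h hx' => h hx'.1)
        (hE _ (fun x hx => hBE hx.1) hgood) (fun x hx => hne x hx.1) (fun x _ => hconv x)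
      have hun : {z | z ∈ F ∧ Fin.init z ∈ B} =
          {z | z ∈ F ∧ Fin.init z ∈ {x | x ∈ B ∧ ¬ FiberLSC B F x}} ∪
          {z | z ∈ F ∧ Fin.init z ∈ {x | x ∈ B ∧ FiberLSC B F x}} := by
        ext z
        simp only [mem_union, mem_ofPred_eq]
        rw [← and_or_left, ← and_or_left, or_comm, and_iff_left (em _)]
      rw [hun]
      exact DefClopens.finite_union (DMap.dSet (by fun_prop)) (DMap.dSet (by fun_prop)) h1 h2
  have := key (m + 1) {x | ∃ y, (Fin.snoc x y : Fin (m + 1) → M) ∈ F} ?_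
    (DMap.dSet (by fun_prop)) (fun x hx => hx) (fun h => absurd h.le (by omega))
  · convert this using 2
    ext z
    refine ⟨fun hz => ⟨hz, z (Fin.last m), by rwa [Fin.snoc_init_self]⟩, fun hz => hz.1⟩
  · rintro x ⟨y, hy⟩
    have := hFE _ hy
    rwa [Fin.init_snoc] at this

theorem finite_defClopens_of_forall_finite_fiber
    (hE : ∀ B : Set (Fin m → M), DSet L M B → (DefClopens L M B).Finite)
    {F : Set (Fin (m + 1) → M)} (hF : DSet L M F)
    (hfin : ∀ x, {y | (Fin.snoc x y : Fin (m + 1) → M) ∈ F}.Finite) :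
    (DefClopens L M F).Finite := by
  have key : ∀ k, ∀ B, DSet L M B → ¬ DimGE m k B →
      (DefClopens L M {z | z ∈ F ∧ Fin.init z ∈ B}).Finite := by
    intro k
    induction k with
    | zero =>
      intro B hB h
      rw [DimGE.zero_iff, not_nonempty_iff_eq_empty] at h
      subst h
      refine (finite_singleton ∅).subset fun W hW => ?_
      exact subset_empty_iff.1 (hW.1.trans fun z hz => hz.2)
    | succ k ih =>
      intro B hB hk
      have hl := dMap_fiberLSC hB hF
      have hu := dMap_fiberUSC hB hF
      have hb := dMap_fiberBounded hB hF
      have hgood : DSet L M {x | x ∈ B ∧ FiberLSC B F x ∧ FiberUSC B F x ∧ FiberBounded B F x} :=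
        DMap.dSet (by fun_prop)
      have hbad : DSet L M {x | x ∈ B ∧
          ¬ (FiberLSC B F x ∧ FiberUSC B F x ∧ FiberBounded B F x)} := DMap.dSet (by fun_prop)
      have h1 := ih _ hbad (fun h => by
        have hsub : {x | x ∈ B ∧ ¬ (FiberLSC B F x ∧ FiberUSC B F x ∧ FiberBounded B F x)} ⊆
            {x | x ∈ B ∧ ¬ FiberLSC B F x} ∪ ({x | x ∈ B ∧ ¬ FiberUSC B F x} ∪
            {x | x ∈ B ∧ ¬ FiberBounded B F x}) := by
          intro x hx
          simp only [mem_union, mem_ofPred_eq] at hx ⊢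
          tauto
        rcases DimGE.union_iff.1 (h.mono hsub) with h | h
        · exact not_dimGE_not_fiberLSC hB hF hk h
        rcases DimGE.union_iff.1 h with h | h
        · exact not_dimGE_not_fiberUSC hB hF hfin hk h
        · exact not_dimGE_not_fiberBounded hB hF hfin hk h)
      have h2 := finite_defClopens_of_finite_fibers hgood
        (fun x hx a b hab => (hx.2.1 a b hab).mono fun x' h hx' => h hx'.1)
        (fun x hx a b hab => (hx.2.2.1 a b hab).mono fun x' h hx' => h hx'.1)
        (fun x hx => ⟨fun a hab => (hx.2.2.2.1 a hab).mono fun x' h hx' => h hx'.1,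
          fun a hab => (hx.2.2.2.2 a hab).mono fun x' h hx' => h hx'.1⟩) (hE _ hgood) hfin
      have hun : {z | z ∈ F ∧ Fin.init z ∈ B} =
          {z | z ∈ F ∧ Fin.init z ∈ {x | x ∈ B ∧
            ¬ (FiberLSC B F x ∧ FiberUSC B F x ∧ FiberBounded B F x)}} ∪
          {z | z ∈ F ∧ Fin.init z ∈ {x | x ∈ B ∧
            FiberLSC B F x ∧ FiberUSC B F x ∧ FiberBounded B F x}} := by
        ext z
        simp only [mem_union, mem_ofPred_eq]
        rw [← and_or_left, ← and_or_left, or_comm, and_iff_left (em _)]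
      rw [hun]
      exact DefClopens.finite_union (DMap.dSet (by fun_prop)) (DMap.dSet (by fun_prop)) h1 h2
  have := key (m + 1) univ dSet_univ (fun h => absurd h.le (by omega))
  simpa using this

/-- A boundary point of a definable subset of `M` is isolated. -/
theorem finite_boundary {A : Set M} (hA : DSet L M A) :
    {f | ∀ a b, a < f → f < b → (∃ y, a < y ∧ y < b ∧ y ∈ A) ∧
      ∃ y, a < y ∧ y < b ∧ ¬ y ∈ A}.Finite := by
  by_contra hinf
  have hd : DSet L M {f | ∀ a b, a < f → f < b → (∃ y, a < y ∧ y < b ∧ y ∈ A) ∧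
      ∃ y, a < y ∧ y < b ∧ ¬ y ∈ A} := DMap.dSet (by fun_prop)
  obtain ⟨p, q, hpq, hs⟩ := hd.infinite_iff.1 hinf
  have hP : DSet L M {y | y ∈ A ∧ p < y ∧ y < q} := DMap.dSet (by fun_prop)
  have hQ : DSet L M {y | ¬ y ∈ A ∧ p < y ∧ y < q} := DMap.dSet (by fun_prop)
  have hcov : Ioo p q ⊆ {y | y ∈ A ∧ p < y ∧ y < q} ∪ {y | ¬ y ∈ A ∧ p < y ∧ y < q} := by
    intro y hy
    by_cases h : y ∈ A
    exacts [Or.inl ⟨h, hy⟩, Or.inr ⟨h, hy⟩]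
  rcases infinite_union.1 ((Ioo_infinite hpq).mono hcov) with h | h
  · obtain ⟨c, d, hcd, hs'⟩ := hP.infinite_iff.1 h
    obtain ⟨f, hf⟩ := exists_between hcd
    obtain ⟨y, h1, h2, h3⟩ := (hs (hs' hf).2 c d hf.1 hf.2).2
    exact h3 (hs' ⟨h1, h2⟩).1
  · obtain ⟨c, d, hcd, hs'⟩ := hQ.infinite_iff.1 h
    obtain ⟨f, hf⟩ := exists_between hcd
    obtain ⟨y, h1, h2, h3⟩ := (hs (hs' hf).2 c d hf.1 hf.2).1
    exact (hs' ⟨h1, h2⟩).1 h3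

theorem exists_boundary_below {A : Set M} (hA : DSet L M A) {y y₀ : M} (hy : y ∈ A) (h₀ : y₀ ∉ A)
    (hlt : y₀ ≤ y) : ∃ f, (∀ a b, a < f → f < b → (∃ y, a < y ∧ y < b ∧ y ∈ A) ∧
      ∃ y, a < y ∧ y < b ∧ ¬ y ∈ A) ∧ f ≤ y ∧ ∀ y', f < y' → y' ≤ y → y' ∈ A := by
  have hd : DSet L M {f | f ≤ y ∧ ∀ y', f ≤ y' → y' ≤ y → y' ∈ A} := DMap.dSet (by fun_prop)
  have hyS : y ∈ {f | f ≤ y ∧ ∀ y', f ≤ y' → y' ≤ y → y' ∈ A} :=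
    ⟨le_rfl, fun y' h1 h2 => le_antisymm h1 h2 ▸ hy⟩
  obtain ⟨c, hc⟩ := hd.exists_isGLB ⟨y, hyS⟩
    ⟨y₀, fun f hf => le_of_not_ge fun h => h₀ (hf.2 _ h hlt)⟩
  have hcy : c ≤ y := hc.1 hyS
  have hIoc : ∀ y', c < y' → y' ≤ y → y' ∈ A := by
    intro y' h1 h2
    obtain ⟨f, hf, hfy⟩ := (isGLB_lt_iff hc).1 h1
    exact hf.2 y' hfy.le h2
  refine ⟨c, fun a b hac hcb => ⟨?_, ?_⟩, hcy, hIoc⟩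
  · rcases hcy.lt_or_eq with h | rfl
    · obtain ⟨z, hz1, hz2⟩ := exists_between (lt_min hcb h)
      exact ⟨z, hac.trans hz1, hz2.trans_le (min_le_left _ _),
        hIoc z hz1 (hz2.le.trans (min_le_right _ _))⟩
    · exact ⟨c, hac, hcb, hy⟩
  · by_contra! h
    obtain ⟨f, hf1, hf2⟩ := exists_between hac
    refine hf2.not_ge (hc.1 ⟨hf2.le.trans hcy, fun y' h1 h2 => ?_⟩)
    rcases lt_or_ge y' b with hb | hb
    · exact h y' (hf1.trans_le h1) hb
    · exact hIoc y' (hcb.trans_le hb) h2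

/-- A definable set has finitely many definable relatively clopen subsets. -/
theorem finite_defClopens {n : ℕ} {A : Set (Fin n → M)} (hA : DSet L M A) :
    (DefClopens L M A).Finite := by
  induction n with
  | zero => exact toFinite _
  | succ n ih =>
    -- A₁ consists of the points below which the whole vertical ray lies in A. Any other point of A
    -- has a boundary point f of its fibre at or below it, with everything strictly above f up to
    -- the point contained in A.
    set A₁ : Set (Fin (n + 1) → M) :=
      {z | ∀ y, y ≤ z (Fin.last n) → (Fin.snoc (Fin.init z) y : Fin (n + 1) → M) ∈ A} with hA₁
    have hA₁d : DSet L M A₁ := DMap.dSet (by fun_prop)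
    have h1 : (DefClopens L M A₁).Finite := by
      refine finite_defClopens_of_subset_convex_fibers (E := univ) (fun B _ hB => ih hB) hA₁d
        (fun _ _ => mem_univ _) fun x => ⟨fun y₁ _ y₂ h2 y hy => ?_⟩
      simp only [hA₁, mem_ofPred_eq, Fin.snoc_last, Fin.init_snoc] at h2 ⊢
      exact fun y' hy' => h2 y' (hy'.trans hy.2)
    set F : Set (Fin (n + 1) → M) := {z | ∀ a b, a < z (Fin.last n) → z (Fin.last n) < b →
      (∃ y, a < y ∧ y < b ∧ (Fin.snoc (Fin.init z) y : Fin (n + 1) → M) ∈ A) ∧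
      ∃ y, a < y ∧ y < b ∧ ¬ (Fin.snoc (Fin.init z) y : Fin (n + 1) → M) ∈ A} with hF
    have hslice : ∀ x : Fin n → M, DSet L M {y | (Fin.snoc x y : Fin (n + 1) → M) ∈ A} :=
      fun x => DMap.dSet (by fun_prop)
    have hFd : DSet L M F := DMap.dSet (by fun_prop)
    have hFfin : ∀ x, {y | (Fin.snoc x y : Fin (n + 1) → M) ∈ F}.Finite := by
      intro x
      simpa [hF] using finite_boundary (hslice x)
    -- Recording f as an additional coordinate makes the fibres convex over F, and F has finite
    -- fibres over M ^ n. Forgetting f again is a continuous map, and its image with A₁ covers A.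
    set A₂ : Set (Fin (n + 1 + 1) → M) := {w | Fin.init w ∈ F ∧
      (Fin.init w : Fin (n + 1) → M) (Fin.last n) ≤ w (Fin.last (n + 1)) ∧
      (Fin.snoc (Fin.init (Fin.init w)) (w (Fin.last (n + 1))) : Fin (n + 1) → M) ∈ A ∧
      ∀ y, (Fin.init w : Fin (n + 1) → M) (Fin.last n) < y → y ≤ w (Fin.last (n + 1)) →
        (Fin.snoc (Fin.init (Fin.init w)) y : Fin (n + 1) → M) ∈ A} with hA₂
    have hA₂d : DSet L M A₂ := DMap.dSet (by fun_prop)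
    have h2 : (DefClopens L M A₂).Finite := by
      refine finite_defClopens_of_subset_convex_fibers (E := F) (fun B hBF hB =>
        finite_defClopens_of_forall_finite_fiber (fun B hB => ih hB) hB fun x =>
          (hFfin x).subset fun y hy => hBF hy) hA₂d (fun _ h => h.1)
        fun x => ⟨fun y₁ h1 y₂ h2 y hy => ?_⟩
      simp only [hA₂, mem_ofPred_eq, Fin.snoc_last, Fin.init_snoc] at h1 h2 ⊢
      refine ⟨h1.1, h1.2.1.trans hy.1, ?_, fun y' h3 h4 => h2.2.2.2 y' h3 (h4.trans hy.2)⟩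
      rcases (h1.2.1.trans hy.1).lt_or_eq with h | h
      · exact h2.2.2.2 y h hy.2
      · have : y₁ = y := le_antisymm hy.1 (h ▸ h1.2.1)
        exact this ▸ h1.2.2.1
    have hf : DMap L M fun w : Fin (n + 1 + 1) → M =>
        (Fin.snoc (Fin.init (Fin.init w)) (w (Fin.last (n + 1))) : Fin (n + 1) → M) := by fun_prop
    have hfc : Continuous fun w : Fin (n + 1 + 1) → M =>
        (Fin.snoc (Fin.init (Fin.init w)) (w (Fin.last (n + 1))) : Fin (n + 1) → M) := by
      refine continuous_pi fun i => ?_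
      refine Fin.lastCases ?_ (fun i => ?_) i
      · simp only [Fin.snoc_last]; exact continuous_apply _
      · simp only [Fin.snoc_castSucc]; exact continuous_apply _
    have h3 := DefClopens.finite_image hA₂d hf hfc.continuousOn h2
    have hcov : A = A₁ ∪ (fun w : Fin (n + 1 + 1) → M =>
        (Fin.snoc (Fin.init (Fin.init w)) (w (Fin.last (n + 1))) : Fin (n + 1) → M)) '' A₂ := by
      ext z
      constructor
      · intro hz
        by_cases h : z ∈ A₁
        · exact Or.inl h
        · simp only [hA₁, mem_ofPred_eq, not_forall] at h
          obtain ⟨y₀, hle, h₀⟩ := h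
          have hz' : z (Fin.last n) ∈
              {y | (Fin.snoc (Fin.init z) y : Fin (n + 1) → M) ∈ A} := by
            rwa [mem_ofPred_eq, Fin.snoc_init_self]
          obtain ⟨f, hf, hfz, hfA⟩ := exists_boundary_below (hslice _) hz' h₀ hle
          refine Or.inr ⟨Fin.snoc (Fin.snoc (Fin.init z) f) (z (Fin.last n)), ?_, ?_⟩
          · simp only [hA₂, hF, mem_ofPred_eq, Fin.snoc_last, Fin.init_snoc]
            exact ⟨hf, hfz, hz', hfA⟩
          · simp
      · rintro (h | ⟨w, hw, rfl⟩)
        · have := h _ le_rfl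
          rwa [Fin.snoc_init_self] at this
        · exact hw.2.2.1
    rw [hcov]
    exact DefClopens.finite_union hA₁d (hA₂d.image hf) h1 h3

end FiniteClopens

/-! ### Definability, charts and topology of G -/

namespace DefinableAbelianGroup

section Definability

variable {L : FirstOrder.Language.{u, v}} {M : Type w} [L.Structure M]
variable {G : DefinableAbelianGroup L M} {T : Type*} [DefSpace L M T]

instance : DefSpace L M G.Point where
  n := G.n
  e := G.coord
  inj := Subtype.val_injective
  definable_range := by
    convert G.definable_carrier
    exact Subtype.range_val

/-- Definability of a subset of a product in terms of a sum of index types. -/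
theorem dSet_of_definable_sum {T T' : Type*} [DefSpace L M T] [DefSpace L M T'] {A : Set (T × T')}
    (h : (univ : Set M).Definable L {v | ∃ p ∈ A, v = Sum.elim
      (DefSpace.e (L := L) (M := M) p.1) (DefSpace.e (L := L) (M := M) p.2)}) : DSet L M A := by
  unfold DSet
  refine (congrArg _ ?_).mp (Set.Definable.preimage_comp
    (Sum.elim (Fin.castAdd _) (Fin.natAdd _)) h)
  ext v
  constructor
  · rintro ⟨p, hp, hv⟩
    refine ⟨p, hp, ?_⟩
    ext i
    refine Fin.addCases (fun i => ?_) (fun i => ?_) i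
    · exact (Fin.append_left _ _ i).trans (congrFun hv (Sum.inl i)).symm
    · exact (Fin.append_right _ _ i).trans (congrFun hv (Sum.inr i)).symm
  · rintro ⟨p, hp, rfl⟩
    refine ⟨p, hp, ?_⟩
    ext i
    rcases i with i | i
    · exact Fin.append_left _ _ i
    · exact Fin.append_right _ _ i

theorem dMap_add_aux : DMap L M fun p : G.Point × G.Point => p.1 + p.2 := by
  have h : DSet L M {p : G.Point × G.Point × G.Point | p.1 + p.2.1 = p.2.2} := by
    unfold DSet
    refine (congrArg _ ?_).mp (Set.Definable.preimage_comp
      (Sum.elim (Fin.castAdd _) (Sum.elim (fun i => Fin.natAdd _ (Fin.castAdd _ i))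
        fun i => Fin.natAdd _ (Fin.natAdd _ i))) G.definable_add)
    have he : ∀ x y z : G.Point, ∀ i, DefSpace.e (L := L) (M := M) (x, y, z) i =
        Fin.append (G.coord x) (Fin.append (G.coord y) (G.coord z)) i := fun _ _ _ _ => rfl
    ext v
    constructor
    · rintro ⟨x, y, hv⟩
      let x' : G.Point := x
      let y' : G.Point := y
      refine ⟨(x', y', x' + y'), rfl, ?_⟩
      ext i
      rw [he]
      refine Fin.addCases (fun i => ?_) (fun i => ?_) i
      · exact (Fin.append_left _ _ i).trans (congrFun hv (Sum.inl i)).symm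
      · refine (Fin.append_right _ _ _).trans ?_
        refine Fin.addCases (fun i => ?_) (fun i => ?_) i
        · exact (Fin.append_left _ _ i).trans (congrFun hv (Sum.inr (Sum.inl i))).symm
        · exact (Fin.append_right _ _ i).trans (congrFun hv (Sum.inr (Sum.inr i))).symm
    · rintro ⟨⟨x, y, z⟩, hz, rfl⟩
      obtain rfl : x + y = z := hz
      refine ⟨x, y, ?_⟩
      ext i
      rcases i with i | i | i
      · exact Fin.append_left _ _ i
      · exact (Fin.append_right _ _ _).trans (Fin.append_left _ _ i)
      · exact (Fin.append_right _ _ _).trans (Fin.append_right _ _ i)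
  have h2 : DMap L M fun p : (G.Point × G.Point) × G.Point => (p.1.1, p.1.2, p.2) := by fun_prop
  exact h.preimage h2

@[fun_prop]
theorem dMap_add {f g : T → G.Point} (hf : DMap L M f) (hg : DMap L M g) :
    DMap L M fun t => f t + g t :=
  DMap.comp' dMap_add_aux (hf.prodMk hg)

variable [Nontrivial M]

@[fun_prop]
theorem dMap_neg {f : T → G.Point} (hf : DMap L M f) : DMap L M fun t => - f t := by
  have h : DMap L M fun p : T × G.Point => f p.1 + p.2 = 0 := by fun_prop
  have := h.dSet
  simp only [add_eq_zero_iff_neg_eq] at this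
  exact this

@[fun_prop]
theorem dMap_sub {f g : T → G.Point} (hf : DMap L M f) (hg : DMap L M g) :
    DMap L M fun t => f t - g t := by
  simp only [sub_eq_add_neg]; fun_prop

end Definability

section Charts

variable {L : FirstOrder.Language.{u, v}} {M : Type w} [L.Structure M]
variable {G : DefinableAbelianGroup L M} {T : Type*} [DefSpace L M T] [Nontrivial M]
variable [TopologicalSpace M] [TopologicalSpace G.Point]

/-- A definable homeomorphism between an open subset `U` of `G` and an open subset of `M ^ k`. -/
structure IsChart {k : ℕ} (U : Set G.Point) (f : G.Point → Fin k → M) (g : (Fin k → M) → G.Point) :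
    Prop where
  isOpen : IsOpen U
  dSet : DSet L M U
  dMap : DMap L M f
  dMap_symm : DMap L M g
  leftInv : ∀ x ∈ U, g (f x) = x
  continuousOn : ContinuousOn f U
  continuousOn_symm : ContinuousOn g (f '' U)
  isOpen_image : IsOpen (f '' U)

open Classical in
theorem IsGroupTopology.exists_charts (hG : G.IsGroupTopology) :
    ∃ (k m : ℕ) (U : Fin m → Set G.Point) (f : Fin m → G.Point → Fin k → M)
      (g : Fin m → (Fin k → M) → G.Point), (⋃ i, U i) = univ ∧ ∀ i, IsChart (U i) (f i) (g i) := by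
  obtain ⟨k, m, φ, hcov, hdef⟩ := hG.exists_atlas
  obtain ⟨c⟩ : Nonempty (Fin k → M) := inferInstance
  -- Charts are extended by the constant c and their inverses by 0, to be total maps with definable
  -- graphs.
  refine ⟨k, m, fun i => (φ i).source, fun i x => if x ∈ (φ i).source then φ i x else c,
    fun i y => if y ∈ (φ i).target then (φ i).symm y else 0, hcov, fun i => ?_⟩
  have hgr : DSet L M {p : G.Point × (Fin k → M) | p.1 ∈ (φ i).source ∧ φ i p.1 = p.2} := by
    refine dSet_of_definable_sum ?_
    refine (congrArg _ ?_).mp (hdef i)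
    ext v
    constructor
    · rintro ⟨x, hx, rfl⟩; exact ⟨(x, φ i x), ⟨hx, rfl⟩, rfl⟩
    · rintro ⟨⟨x, y⟩, ⟨hx, hy⟩, rfl⟩
      obtain rfl : φ i x = y := hy
      exact ⟨x, hx, rfl⟩
  have hS : DSet L M (φ i).source := by
    refine (congrArg _ ?_).mp (DMap.dSet (p := fun x => ∃ y : Fin k → M,
      (x, y) ∈ {p : G.Point × (Fin k → M) | p.1 ∈ (φ i).source ∧ φ i p.1 = p.2}) (by fun_prop))
    ext x; simp
  have hT : DSet L M (φ i).target := by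
    refine (congrArg _ ?_).mp (DMap.dSet (p := fun y => ∃ x : G.Point,
      (x, y) ∈ {p : G.Point × (Fin k → M) | p.1 ∈ (φ i).source ∧ φ i p.1 = p.2}) (by fun_prop))
    ext y
    constructor
    · rintro ⟨x, hx, hy⟩
      obtain rfl : φ i x = y := hy
      exact (φ i).map_source hx
    · intro hy; exact ⟨(φ i).symm y, (φ i).map_target hy, (φ i).right_inv hy⟩
  have him : (fun x => if x ∈ (φ i).source then φ i x else c) '' (φ i).source = (φ i).target := by
    rw [← (φ i).image_source_eq_target]
    exact image_congr fun x hx => if_pos hx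
  refine ⟨(φ i).open_source, hS, ?_, ?_, ?_, ?_, ?_, ?_⟩
  · unfold DMap
    refine (congrArg _ ?_).mp (DMap.dSet (p := fun p : G.Point × (Fin k → M) =>
      p ∈ {p : G.Point × (Fin k → M) | p.1 ∈ (φ i).source ∧ φ i p.1 = p.2} ∨
      (¬ p.1 ∈ (φ i).source ∧ c = p.2)) (by fun_prop))
    ext p
    by_cases h : p.1 ∈ (φ i).source <;> simp [h]
  · unfold DMap
    refine (congrArg _ ?_).mp (DMap.dSet (p := fun p : (Fin k → M) × G.Point =>
      (p.2, p.1) ∈ {p : G.Point × (Fin k → M) | p.1 ∈ (φ i).source ∧ φ i p.1 = p.2} ∨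
      (¬ p.1 ∈ (φ i).target ∧ 0 = p.2)) (by fun_prop))
    ext p
    by_cases h : p.1 ∈ (φ i).target
    · simp only [h, mem_ofPred_eq, not_true, false_and, or_false, if_true]
      exact ⟨fun h' => h'.2 ▸ (φ i).left_inv h'.1, fun h' => h' ▸
        ⟨(φ i).map_target h, (φ i).right_inv h⟩⟩
    · simp only [h, mem_ofPred_eq, not_false_eq_true, true_and, if_false, or_iff_right_iff_imp]
      exact fun h' => absurd (h'.2 ▸ (φ i).map_source h'.1) h
  · intro x hx
    simp only [if_pos hx, if_pos ((φ i).map_source hx), (φ i).left_inv hx]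
  · exact (φ i).continuousOn.congr fun x hx => if_pos hx
  · rw [him]
    exact (φ i).continuousOn_symm.congr fun x hx => if_pos hx
  · rw [him]; exact (φ i).open_target

theorem IsChart.injOn {k : ℕ} {U : Set G.Point} {f : G.Point → Fin k → M}
    {g : (Fin k → M) → G.Point} (h : IsChart U f g) : InjOn f U :=
  LeftInvOn.injOn h.leftInv

end Charts

section Topology

variable {L : FirstOrder.Language.{u, v}} {M : Type w} [L.Structure M]
variable [LinearOrder M] [AddGroup M] [hM : Fact (IsOMinimalExpansionOfOrderedGroup L M)]
variable [Nontrivial M] [DenselyOrdered M] [NoMinOrder M] [NoMaxOrder M]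
variable [AddLeftMono M] [AddRightMono M] [TopologicalSpace M] [OrderTopology M]
variable {G : DefinableAbelianGroup L M} {T : Type*} [DefSpace L M T]
variable [TopologicalSpace G.Point]

/-- Boxes in the chart form a neighbourhood base, which turns statements about neighbourhoods into
first-order ones. -/
theorem IsChart.eventually_nhds_iff {k : ℕ} {U : Set G.Point} {f : G.Point → Fin k → M}
    {g : (Fin k → M) → G.Point} (h : IsChart U f g) {x : G.Point} (hx : x ∈ U)
    {P : G.Point → Prop} :
    (∀ᶠ y in 𝓝 x, P y) ↔ ∃ a b, InBox a b (f x) ∧ ∀ y ∈ U, InBox a b (f y) → P y := by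
  constructor
  · intro hP
    have hg : ContinuousAt g (f x) :=
      h.continuousOn_symm.continuousAt (h.isOpen_image.mem_nhds ⟨x, hx, rfl⟩)
    rw [ContinuousAt, h.leftInv x hx] at hg
    obtain ⟨a, b, hab, hs⟩ := eventually_nhds_iff_inBox.1 (hg.eventually hP)
    exact ⟨a, b, hab, fun y hy hyb => h.leftInv y hy ▸ hs _ hyb⟩
  · rintro ⟨a, b, hab, hs⟩
    have hf := h.continuousOn.continuousAt (h.isOpen.mem_nhds hx)
    filter_upwards [h.isOpen.mem_nhds hx, hf.eventually
      (eventually_nhds_iff_inBox.2 ⟨a, b, hab, fun _ h => h⟩)] with y hy hyb using hs y hy hyb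

variable [hG : Fact G.IsGroupTopology]

instance : IsTopologicalAddGroup G.Point := hG.out.isTopologicalAddGroup

theorem exists_chart_zero : ∃ (k : ℕ) (U : Set G.Point) (f : G.Point → Fin k → M)
    (g : (Fin k → M) → G.Point), IsChart U f g ∧ 0 ∈ U := by
  obtain ⟨k, m, U, f, g, hcov, h⟩ := hG.out.exists_charts
  obtain ⟨i, hi⟩ := mem_iUnion.1 (hcov ▸ mem_univ (0 : G.Point))
  exact ⟨k, U i, f i, g i, h i, hi⟩

theorem eventually_nhds_iff_zero {x : G.Point} {P : G.Point → Prop} :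
    (∀ᶠ y in 𝓝 x, P y) ↔ ∀ᶠ u in 𝓝 0, P (u + x) := by
  rw [← map_add_right_nhds_zero, eventually_map]

-- Translation to 0 lets a single chart around 0 describe the neighbourhoods of all points
-- uniformly.
@[fun_prop]
theorem dMap_eventually_nhds {f : T → G.Point} (hf : DMap L M f) {P : T → G.Point → Prop}
    (hP : DMap L M fun p : T × G.Point => P p.1 p.2) :
    DMap L M fun t => ∀ᶠ x in 𝓝 (f t), P t x := by
  obtain ⟨k, U, φ, ψ, h, h0⟩ := exists_chart_zero (G := G)
  have hφ := h.dMap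
  have hU := h.dSet
  simp only [eventually_nhds_iff_zero (x := f _), h.eventually_nhds_iff h0]
  fun_prop

theorem dSet_closure {A : Set G.Point} (hA : DSet L M A) : DSet L M (closure A) := by
  refine (congrArg _ ?_).mp (DMap.dSet (p := fun x : G.Point => ¬ ∀ᶠ y in 𝓝 x, ¬ y ∈ A)
    (by fun_prop))
  ext x
  exact mem_closure_iff_frequently.symm

/-- The frontier of a definable subset of `G` has smaller dimension than the set. -/
theorem hasDimGE_of_frontier {k : ℕ} {A : Set G.Point} (hA : DSet L M A)
    (h : HasDimGE L M k (closure A \ A)) : HasDimGE L M (k + 1) A := by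
  obtain ⟨l, m, U, f, g, hcov, hc⟩ := hG.out.exists_charts
  have hFd : DSet L M (closure A \ A) := (dSet_closure hA).inter hA.compl
  have h' : HasDimGE L M k (⋃ i, (closure A \ A) ∩ U i) := by
    rwa [← inter_iUnion, hcov, inter_univ]
  obtain ⟨i, hi⟩ := h'.exists_of_iUnion
  have hAU : DSet L M (A ∩ U i) := hA.inter (hc i).dSet
  have h1 := hi.image (hc i).dMap (hFd.inter (hc i).dSet) ((hc i).injOn.mono inter_subset_right)
  rw [HasDimGE.pi_iff] at h1
  have h2 := DimGE.of_frontier (hAU.image (hc i).dMap) (h1.mono ?_)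
  · exact (HasDimGE.of_image (hc i).dMap hAU (HasDimGE.pi_iff.2 h2)).mono inter_subset_left
  rintro _ ⟨x, ⟨⟨hx, hxA⟩, hxU⟩, rfl⟩
  refine ⟨?_, ?_⟩
  · have hx' : x ∈ closure (A ∩ U i) := by
      rw [inter_comm]
      exact (hc i).isOpen.inter_closure ⟨hxU, hx⟩
    have hf := (hc i).continuousOn.continuousAt ((hc i).isOpen.mem_nhds hxU)
    exact mem_closure_image hf hx'
  · rintro ⟨y, ⟨hy, hyU⟩, hxy⟩
    exact hxA ((hc i).injOn hyU hxU hxy ▸ hy)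

theorem finite_defClopens {A : Set G.Point} (hA : DSet L M A) : (DefClopens L M A).Finite := by
  obtain ⟨l, m, U, f, g, hcov, hc⟩ := hG.out.exists_charts
  have hA' : A = ⋃ i, A ∩ U i := by rw [← inter_iUnion, hcov, inter_univ]
  rw [hA']
  refine DefClopens.finite_iUnion (fun i => hA.inter (hc i).dSet) fun i => ?_
  have hd := (hA.inter (hc i).dSet).image (hc i).dMap
  have := DefClopens.finite_image hd (hc i).dMap_symm
    ((hc i).continuousOn_symm.mono (image_mono inter_subset_right)) (_root_.finite_defClopens hd)
  rw [image_image] at this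
  convert this
  rw [image_congr fun x hx => (hc i).leftInv x hx.2, image_id']

end Topology

end DefinableAbelianGroup

section Fibers

variable {L : FirstOrder.Language.{u, v}} {M : Type w} [L.Structure M]
variable [LinearOrder M] [AddGroup M] [hM : Fact (IsOMinimalExpansionOfOrderedGroup L M)]
variable [Nontrivial M] [DenselyOrdered M] [NoMinOrder M] [NoMaxOrder M]
variable [AddLeftMono M] [AddRightMono M] [TopologicalSpace M] [OrderTopology M]
variable {T T' : Type*} [DefSpace L M T] [DefSpace L M T']

/-- A subset of `T × B` of dimension at least `d + k`, where `dim B ≤ d`, has a fiber of dimension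
at least `k`. -/
theorem HasDimGE.exists_fiber {d k : ℕ} {A : Set (T × T')} (hA : DSet L M A) {B : Set T'}
    (hB : ¬ HasDimGE L M (d + 1) B) (hAB : ∀ p ∈ A, p.2 ∈ B) (h : HasDimGE L M (d + k) A) :
    ∃ t', HasDimGE L M k {t | (t, t') ∈ A} := by
  obtain ⟨i, j, hij, h⟩ := (HasDimGE.swap_iff hA).1 h
  by_cases hi : d + 1 ≤ i
  · refine absurd ((h.antitone hi).mono fun t' ht' => ?_) hB
    obtain ⟨t, ht⟩ := ht'.nonempty
    exact hAB _ ht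
  · obtain ⟨t', ht'⟩ := h.nonempty
    exact ⟨t', ht'.antitone (by omega)⟩

end Fibers

namespace DefClopens

variable {L : FirstOrder.Language.{u, v}} {M : Type w} [L.Structure M]
variable {T : Type*} [DefSpace L M T] [TopologicalSpace T]

theorem union {A W W' : Set T} (hA : DSet L M A) (h : W ∈ DefClopens L M A)
    (h' : W' ∈ DefClopens L M A) : W ∪ W' ∈ DefClopens L M A := by
  have := diff (self hA) (inter (diff (self hA) h) (diff (self hA) h'))
  convert this using 1
  ext x
  have := @h.1 x
  have := @h'.1 x
  simp only [mem_union, Set.mem_sdiff, mem_inter_iff]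
  tauto

theorem sUnion {A : Set T} (hA : DSet L M A) {F : Set (Set T)} (hF : F.Finite)
    (h : F ⊆ DefClopens L M A) : ⋃₀ F ∈ DefClopens L M A := by
  induction F, hF using Set.Finite.induction_on with
  | empty =>
    rw [sUnion_empty, ← Set.sdiff_self (s := A)]
    exact diff (self hA) (self hA)
  | insert _ _ ih =>
    rw [sUnion_insert]
    exact union hA (h (mem_insert _ _)) (ih fun W hW => h (mem_insert_of_mem _ hW))

end DefClopens

namespace DefinableAbelianGroup

variable {L : FirstOrder.Language.{u, v}} {M : Type w} [L.Structure M]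
variable [LinearOrder M] [AddGroup M] [hM : Fact (IsOMinimalExpansionOfOrderedGroup L M)]
variable [Nontrivial M] [DenselyOrdered M] [NoMinOrder M] [NoMaxOrder M]
variable [AddLeftMono M] [AddRightMono M] [TopologicalSpace M] [OrderTopology M]
variable {G : DefinableAbelianGroup L M} [TopologicalSpace G.Point] [hG : Fact G.IsGroupTopology]

/-! ### Definably connected components -/

section Components

variable {A C : Set G.Point}

theorem IsDefinablyConnected.subset_of_mem (hC : IsDefinablyConnected C) (hCA : C ⊆ A)
    {W : Set G.Point} (hW : W ∈ DefClopens L M A) {g : G.Point} (hg : g ∈ C) (hgW : g ∈ W) :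
    C ⊆ W := by
  have hCd : DSet L M C := hC.1
  have hrel : ∀ P : Set G.Point, (∀ x ∈ C, x ∈ P → ∀ᶠ y in 𝓝 x, y ∈ A → y ∈ P) →
      ∃ U, IsOpen U ∧ C ∩ P = C ∩ U := by
    intro P hP
    refine ⟨interior {y | y ∈ A → y ∈ P}, isOpen_interior, ?_⟩
    ext x
    refine and_congr_right fun hx => ⟨fun hxP => mem_interior_iff_mem_nhds.2 (hP x hx hxP),
      fun h => interior_subset h (hCA hx)⟩
  rcases hC.2 (C ∩ W) (C ∩ Wᶜ) (hCd.inter hW.2.1) (hCd.inter hW.2.1.compl)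
    (hrel W fun x _ hx => hW.2.2.1 x hx) (hrel Wᶜ fun x hx hxW => hW.2.2.2 x (hCA hx) hxW)
    (inter_union_compl C W)
    (disjoint_compl_right.mono inter_subset_right inter_subset_right) with h | h
  · exact absurd (show g ∈ C ∩ W from ⟨hg, hgW⟩) (h ▸ notMem_empty g)
  · intro x hx
    by_contra hxW
    exact absurd (show x ∈ C ∩ Wᶜ from ⟨hx, hxW⟩) (h ▸ notMem_empty x)

/-- The intersection of the definable relatively clopen subsets of `A` containing `g ∈ A`. -/
def atom (A : Set G.Point) (g : G.Point) : Set G.Point := A \ ⋃₀ {W ∈ DefClopens L M A | g ∉ W}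

theorem atom_mem (hA : DSet L M A) (g : G.Point) : atom A g ∈ DefClopens L M A :=
  DefClopens.diff (DefClopens.self hA) (DefClopens.sUnion hA ((finite_defClopens hA).subset fun _ h => h.1)
    fun _ h => h.1)

theorem mem_atom {g : G.Point} (hg : g ∈ A) : g ∈ atom A g :=
  ⟨hg, fun ⟨_, hW, hgW⟩ => hW.2 hgW⟩

theorem atom_subset (hA : DSet L M A) {W : Set G.Point} (hW : W ∈ DefClopens L M A) {g : G.Point}
    (hg : g ∈ W) : atom A g ⊆ W := by
  intro x hx
  by_contra hxW
  exact hx.2 ⟨A \ W, ⟨DefClopens.diff (DefClopens.self hA) hW, fun h => h.2 hg⟩, hx.1, hxW⟩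

theorem defClopens_of_isOpen_inter {W P Q : Set G.Point} (hW : W ∈ DefClopens L M A)
    (hP : DSet L M P) (hPU : ∃ U, IsOpen U ∧ P = W ∩ U) (hQU : ∃ U, IsOpen U ∧ Q = W ∩ U)
    (hPQ : P ∪ Q = W) (hd : Disjoint P Q) : P ∈ DefClopens L M A := by
  obtain ⟨U, hU, rfl⟩ := hPU
  obtain ⟨V, hV, rfl⟩ := hQU
  refine ⟨inter_subset_left.trans hW.1, hP, fun x hx => ?_, fun x hx hxP => ?_⟩
  · filter_upwards [hW.2.2.1 x hx.1, hU.mem_nhds hx.2] with y h1 h2 h3 using ⟨h1 h3, h2⟩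
  · by_cases hxW : x ∈ W
    · have hxV : x ∈ W ∩ V := (hPQ.symm.subset hxW).resolve_left hxP
      filter_upwards [hV.mem_nhds hxV.2] with y h1 _ h3
      exact disjoint_left.1 hd h3 ⟨h3.1, h1⟩
    · filter_upwards [hW.2.2.2 x hx hxW] with y h1 h2 h3 using h1 h2 h3.1

/-- Both parts of a splitting would be clopen in A, and the part containing g would already contain
the whole atom by minimality. -/
theorem isDefinablyConnected_atom (hA : DSet L M A) {g : G.Point} (hg : g ∈ A) :
    IsDefinablyConnected (atom A g) := by
  refine ⟨(atom_mem hA g).2.1, fun P Q hP hQ hPU hQU hPQ hd => ?_⟩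
  have hP' := defClopens_of_isOpen_inter (atom_mem hA g) hP hPU hQU hPQ hd
  have hQ' := defClopens_of_isOpen_inter (atom_mem hA g) hQ hQU hPU
    (union_comm P Q ▸ hPQ) hd.symm
  have hPs : P ⊆ atom A g := hPQ ▸ subset_union_left
  have hQs : Q ⊆ atom A g := hPQ ▸ subset_union_right
  rcases (hPQ ▸ mem_atom hg : g ∈ P ∪ Q) with h | h
  · exact Or.inr (hd.eq_bot_of_ge (hQs.trans (atom_subset hA hP' h)))
  · exact Or.inl (hd.eq_bot_of_le (hPs.trans (atom_subset hA hQ' h)))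

theorem isDefComponent_atom (hA : DSet L M A) {g : G.Point} (hg : g ∈ A) :
    IsDefComponent (atom A g) A :=
  ⟨⟨g, mem_atom hg⟩, sdiff_subset, isDefinablyConnected_atom hA hg, fun _ h h' hD =>
    (hD.subset_of_mem h' (atom_mem hA g) (h (mem_atom hg)) (mem_atom hg)).antisymm h⟩

theorem IsDefComponent.eq_atom (hA : DSet L M A) (hC : IsDefComponent C A) {g : G.Point}
    (hg : g ∈ C) : C = atom A g :=
  (hC.2.2.2 _ (hC.2.2.1.subset_of_mem hC.2.1 (atom_mem hA g) hg (mem_atom (hC.2.1 hg)))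
    sdiff_subset (isDefinablyConnected_atom hA (hC.2.1 hg))).symm

theorem IsDefComponent.mem_defClopens (hA : DSet L M A) (hC : IsDefComponent C A) :
    C ∈ DefClopens L M A := by
  obtain ⟨g, hg⟩ := hC.1
  exact hC.eq_atom hA hg ▸ atom_mem hA g

theorem le_dim_iff {k : ℕ} (hA : DSet L M A) : (k : WithBot ℕ) ≤ dim A ↔ HasDimGE L M k A :=
  le_omDim_iff (L := L) (A := G.coord '' A) ((congrArg _ (image_id _)).mpr hA)

theorem exists_isDefComponent_hasDimGE {k : ℕ} (hA : DSet L M A) (h : HasDimGE L M k A) :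
    ∃ C, IsDefComponent C A ∧ HasDimGE L M k C := by
  have hfin : Finite {C // IsDefComponent C A} :=
    ((finite_defClopens hA).subset fun C hC => IsDefComponent.mem_defClopens hA hC).to_subtype
  have hU : A ⊆ ⋃ C : {C // IsDefComponent C A}, C.1 := fun g hg =>
    mem_iUnion.2 ⟨⟨_, isDefComponent_atom hA hg⟩, mem_atom hg⟩
  obtain ⟨C, hC⟩ := (h.mono hU).exists_of_iUnion
  exact ⟨C.1, C.2, hC⟩

end Components

/-! ### Germs of X and Y, and the bad pairs -/

section Germs

/-- The germ of `X - g` at `0` is that of `Y - h`. -/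
def GermEq (X : Set G.Point) (g : G.Point) (Y : Set G.Point) (h : G.Point) : Prop :=
  ∀ᶠ u in 𝓝 0, (u + g ∈ X ↔ u + h ∈ Y)

variable {X Y Z : Set G.Point} {g h z : G.Point}

theorem GermEq.symm (H : GermEq X g Y h) : GermEq Y h X g := H.mono fun _ => Iff.symm

theorem GermEq.trans (H : GermEq X g Y h) (H' : GermEq Y h Z z) : GermEq X g Z z := by
  filter_upwards [H, H'] with u h1 h2 using h1.trans h2

theorem sameGermAt_iff : SameGermAt 0 (translate X g) (translate Y h) ↔ GermEq X g Y h := by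
  have ht : ∀ (X : Set G.Point) g u, u ∈ translate X g ↔ u + g ∈ X := fun X g u =>
    ⟨fun ⟨x, hx, hxu⟩ => by rwa [← hxu, sub_add_cancel], fun h => ⟨_, h, add_sub_cancel_right _ _⟩⟩
  unfold GermEq
  rw [eventually_nhds_iff]
  constructor
  · rintro ⟨U, hU, h0, hs⟩
    refine ⟨U, fun u hu => ?_, hU, h0⟩
    have := Set.ext_iff.1 hs u
    simpa only [mem_inter_iff, hu, and_true, ht] using this
  · rintro ⟨U, hs, hU, h0⟩
    refine ⟨U, hU, h0, ?_⟩
    ext u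
    simp only [mem_inter_iff, ht]
    exact and_congr_left fun hu => hs u hu

@[fun_prop]
theorem dMap_germEq {T : Type*} [DefSpace L M T] (hX : DSet L M X) (hY : DSet L M Y)
    {f f' : T → G.Point} (hf : DMap L M f) (hf' : DMap L M f') :
    DMap L M fun t => GermEq X (f t) Y (f' t) := by
  unfold GermEq; fun_prop

theorem mem_lin_iff : g ∈ lin X ↔ g ∈ X ∧ ∀ᶠ h in 𝓝 g, h ∈ X → GermEq X g X h := by
  refine and_congr_right fun _ => ?_
  unfold IsLocallyGLinearAt
  simp only [sameGermAt_iff]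
  rw [eventually_nhds_iff]
  exact exists_congr fun U => ⟨fun ⟨h1, h2, h3⟩ => ⟨fun h hU hX => h3 h ⟨hU, hX⟩, h1, h2⟩,
    fun ⟨h1, h2, h3⟩ => ⟨h2, h3, fun h hh => h1 h hh.1 hh.2⟩⟩

theorem dSet_lin (hX : DSet L M X) : DSet L M (lin X) := by
  refine (congrArg _ ?_).mp (DMap.dSet (L := L) (M := M)
    (p := fun g => g ∈ X ∧ ∀ᶠ h in 𝓝 g, h ∈ X → GermEq X g X h) (by fun_prop))
  ext g
  exact mem_lin_iff.symm

theorem eventually_mem_lin (hg : g ∈ lin X) : ∀ᶠ h in 𝓝 g, h ∈ X → h ∈ lin X := by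
  have := (mem_lin_iff.1 hg).2
  filter_upwards [this, this.eventually_nhds] with h h1 h2 hX
  refine mem_lin_iff.2 ⟨hX, h2.mono fun h' h3 h4 => ?_⟩
  exact (h1 hX).symm.trans (h3 h4)

/-- Having the germ of X at g is a definable clopen condition on `lin X`. -/
theorem IsDefComponent.germEq {C : Set G.Point} (hX : DSet L M X) (hC : IsDefComponent C (lin X))
    (hg : g ∈ C) (hh : h ∈ C) : GermEq X g X h := by
  have hl := dSet_lin hX
  have hW : {x ∈ lin X | GermEq X g X x} ∈ DefClopens L M (lin X) := by
    refine ⟨fun x hx => hx.1, DMap.dSet (by fun_prop), fun x hx => ?_, fun x hx hxW => ?_⟩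
    · filter_upwards [(mem_lin_iff.1 hx.1).2] with y h1 h2 using ⟨h2, hx.2.trans (h1 h2.1)⟩
    · filter_upwards [(mem_lin_iff.1 hx).2] with y h1 h2 h3
      exact hxW ⟨hx, h3.2.trans (h1 h2.1).symm⟩
  exact (hC.2.2.1.subset_of_mem hC.2.1 hW hg
    ⟨hC.2.1 hg, Eventually.of_forall fun _ => Iff.rfl⟩ hh).2

theorem linMax_mem_defClopens (hX : DSet L M X) : linMax X ∈ DefClopens L M (lin X) :=
  DefClopens.sUnion (dSet_lin hX) ((finite_defClopens (dSet_lin hX)).subset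
    fun _ hC => hC.1.mem_defClopens (dSet_lin hX)) fun _ hC => hC.1.mem_defClopens (dSet_lin hX)

/-- `linMax X` is open in `lin X`, which is open in X, so passing from X to `linMax X` does not
change germs. -/
theorem germEq_linMax (hX : DSet L M X) (hg : g ∈ linMax X) : GermEq (linMax X) g X g := by
  have hW := linMax_mem_defClopens hX
  have h1 := eventually_nhds_iff_zero.1 (hW.2.2.1 g hg)
  have h2 := eventually_nhds_iff_zero.1 (eventually_mem_lin (hW.1 hg))
  filter_upwards [h1, h2] with u h1 h2
  exact ⟨fun h => (hW.1 h).1, fun h => h1 (h2 h)⟩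

theorem exists_component_of_mem_linMax {d : ℕ} (hX : DSet L M X) (hd : HasDimGE L M d (lin X))
    (hg : g ∈ linMax X) : ∃ C, IsDefComponent C (lin X) ∧ g ∈ C ∧ HasDimGE L M d C := by
  obtain ⟨C, ⟨hC, hmax⟩, hgC⟩ := hg
  obtain ⟨C', hC', hd'⟩ := exists_isDefComponent_hasDimGE (dSet_lin hX) hd
  exact ⟨C, hC, hgC, (le_dim_iff hC.2.2.1.1).1
    (((le_dim_iff hC'.2.2.1.1).2 hd').trans (hmax C' hC'))⟩

theorem linMax_nonempty (hX : DSet L M X) (h : (lin X).Nonempty) : (linMax X).Nonempty := by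
  obtain ⟨g, hg⟩ := h
  have hl := dSet_lin hX
  have hfin : {C | IsDefComponent C (lin X)}.Finite :=
    (finite_defClopens hl).subset fun C hC => IsDefComponent.mem_defClopens hl hC
  obtain ⟨C, hC, hmax⟩ := Set.exists_max_image _ dim hfin ⟨_, isDefComponent_atom hl hg⟩
  obtain ⟨x, hx⟩ := hC.1
  exact ⟨x, C, ⟨hC, hmax⟩, hx⟩

/-- The pairs `(x, y)` for which the germs at `0` of `X - x` and `y - Y` differ. -/
def badPairs (X Y : Set G.Point) : Set (G.Point × G.Point) :=
  {p | p.1 ∈ X ∧ p.2 ∈ Y ∧ ¬ ∀ᶠ u in 𝓝 0, (u + p.1 ∈ X ↔ p.2 - u ∈ Y)}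

theorem dSet_badPairs (hX : DSet L M X) (hY : DSet L M Y) : DSet L M (badPairs X Y) :=
  DMap.dSet (by fun_prop)

/-- A common point with different germs is a limit of X \ Y or of Y \ X, without belonging to
either. -/
theorem not_hasDimGE_germ_ne {d : ℕ} (hX : DSet L M X) (hY : DSet L M Y)
    (hXd : ¬ HasDimGE L M (d + 1) X) (hYd : ¬ HasDimGE L M (d + 1) Y) :
    ¬ HasDimGE L M d {x | x ∈ X ∧ x ∈ Y ∧ ¬ ∀ᶠ w in 𝓝 x, (w ∈ X ↔ w ∈ Y)} := by
  intro h
  have : {x | x ∈ X ∧ x ∈ Y ∧ ¬ ∀ᶠ w in 𝓝 x, (w ∈ X ↔ w ∈ Y)} ⊆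
      (closure (X ∩ Yᶜ) \ (X ∩ Yᶜ)) ∪ (closure (Y ∩ Xᶜ) \ (Y ∩ Xᶜ)) := by
    rintro x ⟨hxX, hxY, hx⟩
    by_contra hc
    have h1 : x ∉ closure (X ∩ Yᶜ) := fun h => hc (Or.inl ⟨h, fun h => h.2 hxY⟩)
    have h2 : x ∉ closure (Y ∩ Xᶜ) := fun h => hc (Or.inr ⟨h, fun h => h.2 hxX⟩)
    rw [mem_closure_iff_frequently, not_frequently] at h1 h2
    refine hx ?_
    filter_upwards [h1, h2] with w h1 h2
    simp only [mem_inter_iff, mem_compl_iff] at h1 h2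
    tauto
  rcases HasDimGE.union_iff.1 (h.mono this) with h | h
  · exact hXd ((hasDimGE_of_frontier (hX.inter hY.compl) h).mono inter_subset_left)
  · exact hYd ((hasDimGE_of_frontier (hY.inter hX.compl) h).mono inter_subset_left)

/-- In the coordinates (x, x + y) the fibre of bad pairs over z consists of points where X and z - Y
have different germs. Dimension 2d over the d-dimensional base X + Y would force a fibre of
dimension d. -/
theorem not_hasDimGE_badPairs {d : ℕ} (hX : DSet L M X) (hY : DSet L M Y)
    (hXd : ¬ HasDimGE L M (d + 1) X) (hYd : ¬ HasDimGE L M (d + 1) Y)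
    (hXY : ¬ HasDimGE L M (d + 1) (X + Y)) : ¬ HasDimGE L M (d + d) (badPairs X Y) := by
  intro h
  have hB := dSet_badPairs hX hY
  have hf : DMap L M fun p : G.Point × G.Point => (p.1, p.1 + p.2) := by fun_prop
  have h1 := h.image hf hB (fun p _ q _ hpq => by
    simp only [Prod.mk.injEq] at hpq
    exact Prod.ext hpq.1 (add_left_cancel (hpq.1 ▸ hpq.2)))
  obtain ⟨z, hz⟩ := h1.exists_fiber (hB.image hf) hXY (by
    rintro _ ⟨p, hp, rfl⟩
    exact add_mem_add hp.1 hp.2.1)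
  have hY' : DSet L M {w | z - w ∈ Y} := DMap.dSet (by fun_prop)
  refine not_hasDimGE_germ_ne (Y := {w | z - w ∈ Y}) hX hY' hXd (fun h => hYd ?_) (hz.mono ?_)
  · refine HasDimGE.of_image (f := fun y => z - y) (by fun_prop) hY (h.mono fun w hw => ?_)
    exact ⟨z - w, hw, sub_sub_cancel z w⟩
  · rintro x ⟨⟨x', y⟩, ⟨hx, hy, hxy⟩, he⟩
    simp only [Prod.mk.injEq] at he
    obtain ⟨rfl, rfl⟩ := he
    refine ⟨hx, (by simpa using hy), ?_⟩
    rw [eventually_nhds_iff_zero]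
    intro h
    refine hxy (h.mono fun u hu => ?_)
    rwa [mem_ofPred_eq, show x' + y - (u + x') = y - u by abel] at hu

theorem not_hasDimGE_diff_lin {d : ℕ} (hX : DSet L M X) (hY : DSet L M Y)
    (hXd : ¬ HasDimGE L M (d + 1) X) (hYd : ¬ HasDimGE L M (d + 1) Y) (hYd' : HasDimGE L M d Y)
    (hXY : ¬ HasDimGE L M (d + 1) (X + Y)) : ¬ HasDimGE L M d (X \ lin X) := by
  intro h
  have hB := dSet_badPairs hX hY
  -- R holds the good pairs whose first coordinate is a limit of bad ones for the same y. Its fibres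
  -- over Y lie in frontiers, and a good pair outside R has x in `lin X`.
  set R : Set (G.Point × G.Point) := {p | p.1 ∈ X ∧ p.2 ∈ Y ∧ p ∉ badPairs X Y ∧
    ¬ ∀ᶠ x in 𝓝 p.1, ¬ (x, p.2) ∈ badPairs X Y} with hR
  have hRd : DSet L M R := DMap.dSet (by fun_prop)
  have hsub : (X \ lin X) ×ˢ Y ⊆ badPairs X Y ∪ R := by
    rintro ⟨x, y⟩ ⟨⟨hx, hxl⟩, hy⟩
    by_contra hc
    simp only [hR, mem_union, not_or, mem_ofPred_eq, not_and, not_not] at hc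
    refine hxl (mem_lin_iff.2 ⟨hx, ?_⟩)
    have h0 : ∀ᶠ u in 𝓝 0, (u + x ∈ X ↔ y - u ∈ Y) := not_not.1 fun h => hc.1 ⟨hx, hy, h⟩
    filter_upwards [hc.2 hx hy hc.1] with x' h1 hx'
    have h2 : ∀ᶠ u in 𝓝 0, (u + x' ∈ X ↔ y - u ∈ Y) := not_not.1 fun h => h1 ⟨hx', hy, h⟩
    filter_upwards [h0, h2] with u h0 h2 using h0.trans h2.symm
  rcases HasDimGE.union_iff.1 ((h.prod hYd').mono hsub) with h | h
  · exact not_hasDimGE_badPairs hX hY hXd hYd hXY h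
  · obtain ⟨y, hy⟩ := h.exists_fiber hRd hYd fun p hp => hp.2.1
    have hBy : DSet L M {x | (x, y) ∈ badPairs X Y} := DMap.dSet (by fun_prop)
    refine hXd ((hasDimGE_of_frontier hBy (hy.mono ?_)).mono fun x hx => hx.1)
    rintro x ⟨-, -, h1, h2⟩
    exact ⟨mem_closure_iff_frequently.2 h2, h1⟩

/-- If the germs of `X` at the points of a subset of full dimension agree, then they are
symmetric. -/
theorem exists_eventually_neg {d : ℕ} {C : Set G.Point} (hX : DSet L M X) (hC : DSet L M C)
    (hCX : C ⊆ X) (hXd : ¬ HasDimGE L M (d + 1) X) (hCd : HasDimGE L M d C)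
    (hgerm : ∀ g ∈ C, ∀ h ∈ C, GermEq X g X h) :
    ∃ a ∈ C, ∀ᶠ u in 𝓝 0, u + a ∈ X → -u + a ∈ X := by
  obtain ⟨k, U, f, f', hc, h0⟩ := exists_chart_zero (G := G)
  obtain ⟨b, hb⟩ := hCd.nonempty
  have hf := hc.dMap
  have hU := hc.dSet
  set R : Set (G.Point × (Fin k → M) × (Fin k → M)) := {p | p.1 ∈ C ∧
    InBox p.2.1 p.2.2 (f 0) ∧ ∀ u, u ∈ U → InBox p.2.1 p.2.2 (f u) → (u + p.1 ∈ X ↔ u + b ∈ X)}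
    with hR
  have hRd : DSet L M R := DMap.dSet (by fun_prop)
  -- Shrinking a box on which the germs at a and b agree gives a 2k-dimensional family of boxes for
  -- each a in C. Counting dimensions, one box (p, q) works for a d-dimensional set D of points a.
  have h1 : HasDimGE L M (d + (k + k)) R := by
    refine HasDimGE.prod_iff.2 ⟨d, k + k, rfl, hCd.mono fun a ha => ?_⟩
    obtain ⟨p, q, hpq, hs⟩ := (hc.eventually_nhds_iff h0).1 (hgerm a ha b hb)
    have h2 : HasDimGE L M k {x | InBox p (f 0) x} :=
      HasDimGE.pi_iff.2 (DimGE.of_inBox (fun i => (hpq i).1) fun _ h => h)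
    have h3 : HasDimGE L M k {x | InBox (f 0) q x} :=
      HasDimGE.pi_iff.2 (DimGE.of_inBox (fun i => (hpq i).2) fun _ h => h)
    refine (h2.prod h3).mono ?_
    rintro ⟨p', q'⟩ ⟨hp, hq⟩
    refine ⟨ha, fun i => ⟨(hp i).2, (hq i).1⟩, fun u hu hbox => hs u hu fun i => ?_⟩
    exact ⟨(hp i).1.trans (hbox i).1, (hbox i).2.trans (hq i).2⟩
  obtain ⟨⟨p, q⟩, hpq⟩ : ∃ t, HasDimGE L M d {a | (a, t) ∈ R} := by
    refine HasDimGE.exists_fiber (d := k + k) (B := univ) hRd (fun h => ?_) (fun _ _ => mem_univ _)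
      (add_comm d _ ▸ h1)
    have := h.le_n
    change k + k + 1 ≤ k + k at this
    omega
  set D : Set G.Point := {a | (a, (p, q)) ∈ R} with hD
  have hDd : DSet L M D := DMap.dSet (by fun_prop)
  -- D cannot lie in the frontier of X \ D, so some a in D has all nearby points of X in D.
  obtain ⟨a, ha, hacl⟩ : ∃ a ∈ D, a ∉ closure (X ∩ Dᶜ) := by
    by_contra! hcl
    exact hXd ((hasDimGE_of_frontier (hX.inter hDd.compl)
      (hpq.mono fun a ha => ⟨hcl a ha, fun h => h.2 ha⟩)).mono inter_subset_left)
  have hN : ∀ᶠ u in 𝓝 (0 : G.Point), u ∈ U ∧ InBox p q (f u) :=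
    (hc.eventually_nhds_iff h0).2 ⟨p, q, ha.2.1, fun u hu h => ⟨hu, h⟩⟩
  have hN' : ∀ᶠ u in 𝓝 (0 : G.Point), -u ∈ U ∧ InBox p q (f (-u)) := by
    have := (continuous_neg (G := G.Point)).tendsto 0
    rw [neg_zero] at this
    exact this.eventually hN
  rw [mem_closure_iff_frequently, not_frequently, eventually_nhds_iff_zero] at hacl
  refine ⟨a, ha.1, ?_⟩
  filter_upwards [hN', hacl] with u hu h2 h3
  -- Comparing at u + a: the point a = -u + (u + a) is in X, so -u + b is in X. Comparing at a then
  -- gives -u + a in X.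
  have h4 : u + a ∈ D := not_not.1 fun h => h2 ⟨h3, h⟩
  have h5 := (h4.2.2 (-u) hu.1 hu.2).1 (by rw [neg_add_cancel_left]; exact hCX ha.1)
  exact (ha.2.2 (-u) hu.1 hu.2).2 h5

theorem eventually_neg_of_mem_linMax {d : ℕ} (hX : DSet L M X) (hXd : ¬ HasDimGE L M (d + 1) X)
    (hd : HasDimGE L M d (lin X)) (hg : g ∈ linMax X) :
    ∀ᶠ u in 𝓝 0, (u + g ∈ X ↔ -u + g ∈ X) := by
  obtain ⟨C, hC, hgC, hCd⟩ := exists_component_of_mem_linMax hX hd hg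
  obtain ⟨a, ha, h⟩ := exists_eventually_neg hX hC.2.2.1.1 (fun x hx => (hC.2.1 hx).1) hXd hCd
    fun _ hx _ hy => hC.germEq hX hx hy
  have hneg := (continuous_neg (G := G.Point)).tendsto 0
  rw [neg_zero] at hneg
  have hga := hC.germEq hX hgC ha
  filter_upwards [h, hneg.eventually h, hga, hneg.eventually hga] with u h1 h2 h3 h4
  rw [neg_neg] at h2
  rw [h3, h4]
  exact ⟨h1, h2⟩

/-- One good pair in C × D suffices: constancy of germs along C and along D carries it to (g, h),
and symmetry of the germ of Y at h turns y - Y into Y - h. -/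
theorem germEq_of_mem_linMax {d : ℕ} (hX : DSet L M X) (hY : DSet L M Y)
    (hXd : ¬ HasDimGE L M (d + 1) X) (hYd : ¬ HasDimGE L M (d + 1) Y)
    (hXd' : HasDimGE L M d (lin X)) (hYd' : HasDimGE L M d (lin Y))
    (hXY : ¬ HasDimGE L M (d + 1) (X + Y)) (hg : g ∈ linMax X) (hh : h ∈ linMax Y) :
    GermEq X g Y h := by
  obtain ⟨C, hC, hgC, hCd⟩ := exists_component_of_mem_linMax hX hXd' hg
  obtain ⟨D, hD, hhD, hDd⟩ := exists_component_of_mem_linMax hY hYd' hh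
  obtain ⟨⟨x, y⟩, ⟨hx, hy⟩, hxy⟩ : ∃ p ∈ C ×ˢ D, p ∉ badPairs X Y := by
    by_contra! hc
    exact not_hasDimGE_badPairs hX hY hXd hYd hXY ((hCd.prod hDd).mono hc)
  have hxy' : ∀ᶠ u in 𝓝 0, (u + x ∈ X ↔ y - u ∈ Y) :=
    not_not.1 fun h => hxy ⟨(hC.2.1 hx).1, (hD.2.1 hy).1, h⟩
  have hneg := (continuous_neg (G := G.Point)).tendsto 0
  rw [neg_zero] at hneg
  filter_upwards [hxy', hC.germEq hX hgC hx, hneg.eventually (hD.germEq hY hhD hy),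
    eventually_neg_of_mem_linMax hY hYd hYd' hh] with u h1 h2 h3 h4
  rw [h2, h1, h4, h3, sub_eq_neg_add]

end Germs

/-! ### Conclusion in terms of the o-minimal dimension -/

section Sumset

variable {X Y : Set G.Point} {d : ℕ}

theorem hasDimGE_of_dim_eq (hX : DSet L M X) (hXd : dim X = d) : HasDimGE L M d X :=
  (le_dim_iff hX).1 hXd.ge

theorem not_hasDimGE_of_dim_eq (hX : DSet L M X) (hXd : dim X = d) : ¬ HasDimGE L M (d + 1) X :=
  fun h => by
    have := (le_dim_iff hX).2 h
    rw [hXd, Nat.cast_le] at this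
    omega

theorem dSet_add (hX : DSet L M X) (hY : DSet L M Y) : DSet L M (X + Y) :=
  DMap.dSet (p := fun z => ∃ x, x ∈ X ∧ ∃ y, y ∈ Y ∧ x + y = z) (by fun_prop)

theorem isLargeIn_lin (hX : DSet L M X) (hY : DSet L M Y) (hXd : dim X = d) (hYd : dim Y = d)
    (hXY : dim (X + Y) = d) : IsLargeIn (lin X) X := by
  refine ⟨dSet_lin hX, fun x hx => hx.1, ?_⟩
  rw [hXd, ← not_le]
  refine fun h => absurd ((le_dim_iff (hX.inter (dSet_lin hX).compl)).1 h) ?_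
  exact not_hasDimGE_diff_lin hX hY (not_hasDimGE_of_dim_eq hX hXd) (not_hasDimGE_of_dim_eq hY hYd)
    (hasDimGE_of_dim_eq hY hYd) (not_hasDimGE_of_dim_eq (dSet_add hX hY) hXY)

theorem IsLargeIn.hasDimGE {A : Set G.Point} (hX : DSet L M X) (hXd : dim X = d)
    (h : IsLargeIn A X) : HasDimGE L M d A := by
  have hX' := hasDimGE_of_dim_eq hX hXd
  rw [← union_sdiff_cancel h.2.1] at hX'
  refine (HasDimGE.union_iff.1 hX').resolve_right fun h' => ?_
  have := (le_dim_iff (hX.inter (DSet.compl h.1))).2 h'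
  exact absurd h.2.2 (not_lt.2 (hXd ▸ this))

theorem germEq_of_dim_add_eq (hX : DSet L M X) (hY : DSet L M Y) (hXd : dim X = d)
    (hYd : dim Y = d) (hXY : dim (X + Y) = d) {g h : G.Point} (hg : g ∈ linMax X)
    (hh : h ∈ linMax Y) : GermEq X g Y h :=
  germEq_of_mem_linMax hX hY (not_hasDimGE_of_dim_eq hX hXd) (not_hasDimGE_of_dim_eq hY hYd)
    ((isLargeIn_lin hX hY hXd hYd hXY).hasDimGE hX hXd)
    ((isLargeIn_lin hY hX hYd hXd (add_comm X Y ▸ hXY)).hasDimGE hY hYd)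
    (not_hasDimGE_of_dim_eq (dSet_add hX hY) hXY) hg hh

/-- Points of different components of `lin X` are compared through a point of `linMax Y`, which
exists because `lin Y` is large in Y. -/
theorem isGLinear_linMax (hX : DSet L M X) (hY : DSet L M Y) (hXd : dim X = d)
    (hYd : dim Y = d) (hXY : dim (X + Y) = d) : IsGLinear (linMax X) := by
  obtain ⟨y, hy⟩ := linMax_nonempty hY
    ((isLargeIn_lin hY hX hYd hXd (add_comm X Y ▸ hXY)).hasDimGE hY hYd).nonempty
  refine ⟨(linMax_mem_defClopens hX).2.1, fun g hg h hh => sameGermAt_iff.2 ?_⟩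
  exact (germEq_linMax hX hg).trans <| (germEq_of_dim_add_eq hX hY hXd hYd hXY hg hy).trans <|
    (germEq_of_dim_add_eq hX hY hXd hYd hXY hh hy).symm.trans (germEq_linMax hX hh).symm

theorem gEquivalent_linMax (hX : DSet L M X) (hY : DSet L M Y) (hXd : dim X = d)
    (hYd : dim Y = d) (hXY : dim (X + Y) = d) : GEquivalent (linMax X) (linMax Y) :=
  fun _ hg _ hh => sameGermAt_iff.2 <| (germEq_linMax hX hg).trans <|
    (germEq_of_dim_add_eq hX hY hXd hYd hXY hg hh).trans (germEq_linMax hY hh).symm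

end Sumset

end DefinableAbelianGroup

end

theorem mainTheorem8 {L : FirstOrder.Language.{u, v}} {M : Type w} [L.Structure M]
    [LinearOrder M] [AddGroup M] [TopologicalSpace M] [OrderTopology M]
    (hM : IsOMinimalExpansionOfOrderedGroup L M)
    (G : DefinableAbelianGroup L M) [TopologicalSpace G.Point] (hG : G.IsGroupTopology)
    (X Y : Set G.Point) (hX : DefinableAbelianGroup.IsDef X) (hY : DefinableAbelianGroup.IsDef Y)
    (d : ℕ) (hXd : DefinableAbelianGroup.dim X = d) (hYd : DefinableAbelianGroup.dim Y = d)
    (hXY : DefinableAbelianGroup.dim (X + Y) = d) :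
    DefinableAbelianGroup.IsLargeIn (DefinableAbelianGroup.lin X) X ∧
    DefinableAbelianGroup.IsLargeIn (DefinableAbelianGroup.lin Y) Y ∧
    DefinableAbelianGroup.IsGLinear (DefinableAbelianGroup.linMax X) ∧
    DefinableAbelianGroup.IsGLinear (DefinableAbelianGroup.linMax Y) ∧
    DefinableAbelianGroup.GEquivalent
      (DefinableAbelianGroup.linMax X) (DefinableAbelianGroup.linMax Y) := by
  have := Fact.mk hM
  have := Fact.mk hG
  have := hM.denselyOrdered
  have := hM.noMinOrder
  have := hM.noMaxOrder
  have := hM.addLeftMono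
  have := hM.addRightMono
  have : Nontrivial M := ⟨0, (exists_gt (0 : M)).choose, (exists_gt (0 : M)).choose_spec.ne⟩
  have hYX : DefinableAbelianGroup.dim (Y + X) = d := add_comm X Y ▸ hXY
  exact ⟨DefinableAbelianGroup.isLargeIn_lin hX hY hXd hYd hXY,
    DefinableAbelianGroup.isLargeIn_lin hY hX hYd hXd hYX,
    DefinableAbelianGroup.isGLinear_linMax hX hY hXd hYd hXY,
    DefinableAbelianGroup.isGLinear_linMax hY hX hYd hXd hYX,
    DefinableAbelianGroup.gEquivalent_linMax hX hY hXd hYd hXY⟩
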